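/- Let $k\ge 3$ and $d\ge 1$, and let $F,G\in\mathbb Z[X_1,\dots,X_k]$ be relatively prime homogeneous polynomials of degree $d$ such that $G$ is monic in $X_k$ and the monomial $X_k^d$ does not occur in $F$. For a commutative ring $B$ let $R_B$ be the $B$-subalgebra of $B[S,T,X_1,\dots,X_k]/(SF-TG)$ generated by the elements $sx_1,\dots,sx_k,tx_1,\dots,tx_k$ (lower case letters denote images of variables), and put $R=R_{\mathbb Q}$, graded so that the elements $sx_i,tx_i$ have degree one. Let $m$ be the ideal of $R$ generated by its elements of positive degree. (1) $\dim R=k$, and the Hilbert polynomial multiplicity of $R$ is $d(k-1)+1$; that is, $\dim_{\mathbb Q}R_n$ agrees for $n\gg0$ with a polynomial in $n$ of degree $k-1$ and leading coefficient $\frac{d(k-1)+1}{(k-1)!}$. The $k$ elements $sx_1,\ sx_2-tx_1,\ \dots,\ sx_k-tx_{k-1}$ form a homogeneous system of parameters of $R$ (their images form a system of parameters of $R_m$). (2) If $d\le k$, then the quotient of $R$ by the ideal generated by this system of parameters has length $d(k-1)+1$, and $R$ is Cohen–Macaulay. (3) If $d=k$, then $a(R)=-1$, where $a(R)$ is the highest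 degree in which the local cohomology module $H^k_m(R)$ is nonzero. (4) If $k\le d$, then for every prime number $p$, in the fiber $A=R_{\mathbb Z}\otimes_{\mathbb Z}\mathbb Z/p\mathbb Z$ the element $(tx_k)^{d-1}$ does not lie in the ideal $I=(sx_1,\dots,sx_{k-1},tx_1,\dots,tx_{k-1})A$ but lies in the tight closure $I^*$, so that $A$ is not $F$-regular; and $R$ is not of $F$-regular type, i.e. there do not exist a finitely generated $\mathbb Z$-subalgebra $A'\subseteq\mathbb Q$ and a finitely generated $A'$-algebra $R_{A'}$ with $R_{A'}\otimes_{A'}\mathbb Q\cong R$ such that $R_{A'}\otimes_{A'}A'/\mu$ is $F$-regular for all $\mu$ in some Zariski dense set of maximal ideals of $A'$. (A ring of characteristic $p$ is $F$-regular if all ideals of all its localizations are tightly closed.) (5) Let $d=k$. For suitably general $F,G$ as above, $R$ has only isolated singularities: for each $k\ge3$ there is an integer polynomial $\Phi$ in the coefficients of $F$ and $G$, not vanishing at every pair $(F,G)$ as above, such that the localization of $R$ at every prime ideal other than $m$ is a regular local ring whenever $\Phi(F,G)\ne0$. For $k=3$, the pair $F=X_1X_2X_3$, $G=X_1^3+X_2^3+X_3^3$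 satisfies the hypotheses, and $R$ has only isolated singularities for it. -/

import Mathlib

open scoped TensorProduct

noncomputable section

/-! ### Commutative algebra: systems of parameters, Cohen–Macaulay rings -/

/-- `x₁, …, x_r` is a system of parameters of the local ring `A`: there are `dim A` of them and
the ideal they generate is primary to the maximal ideal. -/
def IsSystemOfParameters {A : Type*} [CommRing A] [IsLocalRing A] {r : ℕ} (x : Fin r → A) : Prop :=
  ringKrullDim A = (r : WithBot ℕ∞) ∧
    (Ideal.span (Set.range x)).radical = IsLocalRing.maximalIdeal A

/-- A local ring has depth equal to its dimension: its maximal ideal contains a regular sequence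
of length `dim A`. -/
def HasMaximalDepth (A : Type*) [CommRing A] [IsLocalRing A] : Prop :=
  ∃ rs : List A, (∀ r ∈ rs, r ∈ IsLocalRing.maximalIdeal A) ∧
    RingTheory.Sequence.IsRegular A rs ∧ (rs.length : WithBot ℕ∞) = ringKrullDim A

/-- A Noetherian ring is Cohen–Macaulay if its localizations at maximal ideals have depth equal
to their dimension. -/
def IsCohenMacaulay (R : Type*) [CommRing R] : Prop :=
  IsNoetherianRing R ∧
    ∀ (P : Ideal R) [P.IsMaximal], HasMaximalDepth (Localization.AtPrime P)

/-- The length of the ring `R/(x₁, …, x_r)`. -/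
def quotientLength {R : Type*} [CommRing R] {r : ℕ} (x : Fin r → R) : ℕ∞ :=
  Module.length R (R ⧸ Ideal.span (Set.range x))

/-! ### Graded rings: homogeneous parameters, multiplicity, the `a`-invariant -/

section Graded

variable {K R : Type*} [Field K] [CommRing R] [Algebra K R]
variable (𝒜 : ℕ → Submodule K R)

/-- The ideal `R₊` generated by the elements of positive degree. -/
def irrelevantIdeal [GradedAlgebra 𝒜] : Ideal R := (HomogeneousIdeal.irrelevant 𝒜).toIdeal

/-- `x₁, …, x_r` are homogeneous elements of degrees `δ₁, …, δ_r` whose images form a system of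
parameters of the localization of `R` at `R₊`. -/
def IsHomogeneousSOP [GradedAlgebra 𝒜] {r : ℕ} (x : Fin r → R) (δ : Fin r → ℕ) : Prop :=
  (∀ i, x i ∈ 𝒜 (δ i)) ∧ ∃ _ : (irrelevantIdeal 𝒜).IsPrime,
    IsSystemOfParameters fun i =>
      algebraMap R (Localization.AtPrime (irrelevantIdeal 𝒜)) (x i)

/-- The Hilbert polynomial multiplicity of `R` is `e`: the function `n ↦ dim_K R_n` agrees for
large `n` with a polynomial of degree `D = dim R - 1` and leading coefficient `e / D!`. -/
def HasHilbertMultiplicity [GradedAlgebra 𝒜] (e : ℕ) : Prop :=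
  ∃ P : Polynomial ℚ,
    (∀ᶠ n : ℕ in Filter.atTop, P.eval (n : ℚ) = Module.finrank K (𝒜 n)) ∧
    ringKrullDim R = ((P.natDegree + 1 : ℕ) : WithBot ℕ∞) ∧
    P.leadingCoeff * (P.natDegree.factorial : ℚ) = e

section TopLocalCohomology

variable {r : ℕ} (x : Fin r → R)

/-- The ideal `(x₁ᵗ, …, x_rᵗ)`. -/
def powerIdeal (t : ℕ) : Ideal R := Ideal.span (Set.range fun i => x i ^ t)

/-- Multiplication by `(x₁ ⋯ x_r)^(t - s)` from `R/(x₁ˢ, …, x_rˢ)` to `R/(x₁ᵗ, …, x_rᵗ)`. -/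
def powerTransition (s t : ℕ) (h : s ≤ t) :
    (R ⧸ powerIdeal x s) →ₗ[R] (R ⧸ powerIdeal x t) :=
  Submodule.mapQ (powerIdeal x s) (powerIdeal x t)
    (LinearMap.mulLeft R ((∏ i, x i) ^ (t - s))) (by
      change Ideal.span _ ≤ _
      rw [Ideal.span_le]
      rintro _ ⟨i, rfl⟩
      change (∏ i, x i) ^ (t - s) * x i ^ s ∈ powerIdeal x t
      have h1 : x i ^ t ∣ (∏ i, x i) ^ (t - s) * x i ^ s := by
        calc x i ^ t = x i ^ (t - s) * x i ^ s := by rw [← pow_add, Nat.sub_add_cancel h]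
          _ ∣ _ := mul_dvd_mul_right
            (pow_dvd_pow_of_dvd (Finset.dvd_prod_of_mem x (Finset.mem_univ i)) _) _
      exact Ideal.mem_of_dvd _ h1 (Ideal.subset_span ⟨i, rfl⟩))

/-- The top local cohomology module `H^r_{R₊}(R) = lim_t R/(x₁ᵗ, …, x_rᵗ)` for a system of
parameters `x₁, …, x_r`. -/
abbrev TopLocalCohomology : Type _ :=
  Module.DirectLimit (fun t : ℕ => R ⧸ powerIdeal x t) (powerTransition x)

/-- The degree `a` piece of the top local cohomology module: the class of a homogeneous `f` at
stage `t` has degree `deg f - t (δ₁ + ⋯ + δ_r)`. -/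
def topLocalCohomologyPiece (δ : Fin r → ℕ) (a : ℤ) : AddSubgroup (TopLocalCohomology x) :=
  AddSubgroup.closure {h | ∃ (t n : ℕ) (f : R), f ∈ 𝒜 n ∧ (n : ℤ) - t * ∑ i, (δ i : ℤ) = a ∧
    h = Module.DirectLimit.of R ℕ (fun t : ℕ => R ⧸ powerIdeal x t) (powerTransition x) t
      (Ideal.Quotient.mk (powerIdeal x t) f)}

end TopLocalCohomology

/-- The `a`-invariant of `R` is `a`: the highest degree in which the top local cohomology module
(which up to graded isomorphism does not depend on the homogeneous system of parameters used to
compute it) is nonzero. -/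
def HasAInvariant [GradedAlgebra 𝒜] (a : ℤ) : Prop :=
  ∃ (r : ℕ) (x : Fin r → R) (δ : Fin r → ℕ), IsHomogeneousSOP 𝒜 x δ ∧
    IsGreatest {b : ℤ | topLocalCohomologyPiece 𝒜 x δ b ≠ ⊥} a

/-- `R` is regular away from the homogeneous maximal ideal. -/
def HasOnlyIsolatedSingularity [GradedAlgebra 𝒜] : Prop :=
  ∀ (P : Ideal R) [P.IsPrime], P ≠ irrelevantIdeal 𝒜 →
    IsRegularLocalRing (Localization.AtPrime P)

end Graded

/-! ### Tight closure and `F`-regularity -/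

/-- `I^[q]`, the ideal generated by the `q`-th powers of the elements of `I`. -/
def frobeniusPower {R : Type*} [CommRing R] (I : Ideal R) (q : ℕ) : Ideal R :=
  Ideal.span ((fun x => x ^ q) '' (I : Set R))

/-- The tight closure of an ideal of a Noetherian ring of characteristic `p`. -/
def tightClosure (p : ℕ) {R : Type*} [CommRing R] (I : Ideal R) : Set R :=
  {x | ∃ c : R, (∀ P ∈ minimalPrimes R, c ∉ P) ∧
    ∀ᶠ e : ℕ in Filter.atTop, c * x ^ p ^ e ∈ frobeniusPower I (p ^ e)}

/-- All ideals are tightly closed. -/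
def IsWeaklyFRegular (p : ℕ) (R : Type*) [CommRing R] : Prop :=
  ∀ I : Ideal R, tightClosure p I = (I : Set R)

/-- All localizations are weakly `F`-regular. -/
def IsFRegular (p : ℕ) (R : Type*) [CommRing R] : Prop :=
  ∀ M : Submonoid R, IsWeaklyFRegular p (Localization M)

/-- `F`-regular type, for a finitely generated algebra `R` over a field `K` of characteristic
zero: there are a finitely generated subring `A` of `K` and a finitely generated `A`-algebra `R_A`
with `K ⊗ R_A ≅ R`, and a dense set of closed points of `Spec A` over which the fibers of `R_A` are
`F`-regular. -/
def IsOfFRegularType.{u} (K R : Type u) [Field K] [CommRing R] [Algebra K R] : Prop :=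
  ∃ (A : Subalgebra ℤ K) (RA : Type u) (_ : CommRing RA) (_ : Algebra A RA),
    A.FG ∧ Algebra.FiniteType A RA ∧ Nonempty ((K ⊗[A] RA) ≃ₐ[K] R) ∧
    ∃ D : Set (PrimeSpectrum A), Dense D ∧ ∀ μ ∈ D, μ.asIdeal.IsMaximal ∧
      ∃ p : ℕ, p.Prime ∧ CharP (A ⧸ μ.asIdeal) p ∧ IsFRegular p ((A ⧸ μ.asIdeal) ⊗[A] RA)

/-! ### The rings `B[S,T,X₁,…,X_k]/(SF - TG)` and their subrings -/

namespace FormPair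

open MvPolynomial

section

variable {k : ℕ} (B : Type*) [CommRing B] (F G : MvPolynomial (Fin k) ℤ)

/-- An integer polynomial in `X₁, …, X_k`, regarded in `B[S,T,X₁,…,X_k]`. The variables `S`, `T`
are `X (Sum.inl 0)`, `X (Sum.inl 1)` and `X_i` is `X (Sum.inr i)`. -/
def lift (H : MvPolynomial (Fin k) ℤ) : MvPolynomial (Fin 2 ⊕ Fin k) B :=
  rename Sum.inr (map (Int.castRingHom B) H)

/-- `SF - TG`. -/
def equation : MvPolynomial (Fin 2 ⊕ Fin k) B :=
  X (Sum.inl 0) * lift B F - X (Sum.inl 1) * lift B G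

/-- The hypersurface `B[S,T,X₁,…,X_k]/(SF - TG)`. -/
abbrev Hypersurface : Type _ :=
  MvPolynomial (Fin 2 ⊕ Fin k) B ⧸ Ideal.span {equation B F G}

/-- The image in the hypersurface of a variable. -/
def var (j : Fin 2 ⊕ Fin k) : Hypersurface B F G := Ideal.Quotient.mk _ (X j)

/-- The `B`-subalgebra of the hypersurface generated by the `s xᵢ` and the `t xᵢ`. -/
def subring : Subalgebra B (Hypersurface B F G) :=
  Algebra.adjoin B (Set.range fun ji : Fin 2 × Fin k =>
    var B F G (Sum.inl ji.1) * var B F G (Sum.inr ji.2))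

/-- The generators: `gen B F G 0 i` is `s xᵢ` and `gen B F G 1 i` is `t xᵢ`. -/
def gen (j : Fin 2) (i : Fin k) : subring B F G :=
  ⟨var B F G (Sum.inl j) * var B F G (Sum.inr i), Algebra.subset_adjoin ⟨(j, i), rfl⟩⟩

/-- The grading in which the generators `s xᵢ`, `t xᵢ` have degree one: the piece of degree `n` is
spanned by the products of `n` generators. -/
def grading (n : ℕ) : Submodule B (subring B F G) :=
  Submodule.span B (Set.range fun ji : Fin 2 × Fin k => gen B F G ji.1 ji.2) ^ n

/-- The homomorphism `s ↦ sY`, `t ↦ tY`, `xᵢ ↦ xᵢ`, which exhibits the degree in `s, t`. -/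
def coaction : Hypersurface B F G →ₐ[B] Polynomial (Hypersurface B F G) :=
  Ideal.Quotient.liftₐ _
    (aeval (Sum.elim (fun j => Polynomial.C (var B F G (Sum.inl j)) * Polynomial.X)
      (fun i => Polynomial.C (var B F G (Sum.inr i))))) (by
    have key : ∀ H : MvPolynomial (Fin k) ℤ,
        aeval (Sum.elim (fun j => Polynomial.C (var B F G (Sum.inl j)) * Polynomial.X)
          (fun i => Polynomial.C (var B F G (Sum.inr i)))) (lift B H) =
        Polynomial.C (Ideal.Quotient.mk (Ideal.span {equation B F G}) (lift B H)) := by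
      intro H
      have h2 : (aeval (Sum.elim (fun j => Polynomial.C (var B F G (Sum.inl j)) * Polynomial.X)
          (fun i => Polynomial.C (var B F G (Sum.inr i))))).comp (rename Sum.inr) =
        ((Polynomial.CAlgHom (R := B) (A := Hypersurface B F G)).comp
          (Ideal.Quotient.mkₐ B (Ideal.span {equation B F G}))).comp
            (rename (R := B) Sum.inr) := by
        apply MvPolynomial.algHom_ext
        intro i
        simp [var]
      exact DFunLike.congr_fun h2 (map (Int.castRingHom B) H)
    suffices h : Ideal.span {equation B F G} ≤ RingHom.ker
        (aeval (R := B) (Sum.elim (fun j => Polynomial.C (var B F G (Sum.inl j)) * Polynomial.X)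
          (fun i => Polynomial.C (var B F G (Sum.inr i))))) from fun a ha => h ha
    rw [Ideal.span_le, Set.singleton_subset_iff, SetLike.mem_coe, RingHom.mem_ker]
    have h0 : Ideal.Quotient.mk (Ideal.span {equation B F G}) (equation B F G) = 0 :=
      Ideal.Quotient.eq_zero_iff_mem.mpr (Ideal.subset_span rfl)
    have h3 : Polynomial.C (Ideal.Quotient.mk (Ideal.span {equation B F G}) (equation B F G)) *
        (Polynomial.X : Polynomial (Hypersurface B F G)) = 0 := by rw [h0]; simp
    rw [← h3]
    have h5 : Ideal.Quotient.mk (Ideal.span {equation B F G}) (equation B F G) =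
        var B F G (Sum.inl 0) * Ideal.Quotient.mk (Ideal.span {equation B F G}) (lift B F) -
        var B F G (Sum.inl 1) * Ideal.Quotient.mk (Ideal.span {equation B F G}) (lift B G) := by
      rw [var, var, ← map_mul, ← map_mul, ← map_sub]
      rfl
    rw [h5]
    refine (congrArg _ (show equation B F G =
      X (Sum.inl 0) * lift B F - X (Sum.inl 1) * lift B G from rfl)).trans ?_
    rw [map_sub, map_mul, map_mul, key, key, aeval_X, aeval_X]
    simp only [map_sub, map_mul, Sum.elim_inl]
    ring)

theorem coaction_var (j : Fin 2 ⊕ Fin k) : coaction B F G (var B F G j) =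
    Sum.elim (fun j => Polynomial.C (var B F G (Sum.inl j)) * Polynomial.X)
      (fun i => Polynomial.C (var B F G (Sum.inr i))) j := by
  change aeval (R := B) _ (X j) = _
  rw [aeval_X]

theorem coaction_apply_of_mem_grading (n : ℕ) (f : subring B F G) (hf : f ∈ grading B F G n) :
    coaction B F G f = Polynomial.C (f : Hypersurface B F G) * Polynomial.X ^ n := by
  have hgen : ∀ g ∈ Submodule.span B
      (Set.range fun ji : Fin 2 × Fin k => gen B F G ji.1 ji.2),
      coaction B F G g = Polynomial.C (g : Hypersurface B F G) * Polynomial.X := by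
    intro g hg
    induction hg using Submodule.span_induction with
    | mem g h =>
      obtain ⟨⟨j, i⟩, rfl⟩ := h
      simp only [gen, map_mul, coaction_var, Sum.elim_inl, Sum.elim_inr]
      ring
    | zero => simp
    | add a b _ _ ha hb => simp [ha, hb, add_mul]
    | smul c a _ ha =>
      simp only [Subalgebra.coe_smul, map_smul, ha, ← Polynomial.smul_C, smul_mul_assoc]
  unfold grading at hf
  induction hf using Submodule.pow_induction_on_left' with
  | algebraMap r =>
    simp
  | add a b i _ _ ha hb => simp [ha, hb, add_mul]
  | mem_mul m hm i x hx ih =>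
    simp only [MulMemClass.coe_mul, map_mul, hgen m hm, ih, Nat.succ_eq_add_one]
    ring

theorem iSup_grading : ⨆ n, grading B F G n = ⊤ := by
  have hle : ∀ n m, grading B F G n * grading B F G m ≤ ⨆ n, grading B F G n := by
    intro n m
    refine le_trans (le_of_eq ?_) (le_iSup _ (n + m))
    simp [grading, pow_add]
  have h1 : (1 : Submodule B (subring B F G)) ≤ ⨆ n, grading B F G n :=
    le_trans (le_of_eq (by simp [grading])) (le_iSup _ 0)
  let W : Subalgebra B (subring B F G) :=
    Submodule.toSubalgebra (⨆ n, grading B F G n) (h1 (Submodule.one_le.mp le_rfl)) (by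
      intro a b ha hb
      have : (⨆ n, grading B F G n) * (⨆ n, grading B F G n) ≤ ⨆ n, grading B F G n := by
        rw [Submodule.iSup_mul]
        refine iSup_le fun n => ?_
        rw [Submodule.mul_iSup]
        exact iSup_le fun m => hle n m
      exact this (Submodule.mul_mem_mul ha hb))
  rw [eq_top_iff]
  rintro ⟨f, hf⟩ -
  change (⟨f, hf⟩ : subring B F G) ∈ W
  refine Algebra.adjoin_induction (p := fun f hf => (⟨f, hf⟩ : subring B F G) ∈ W)
    ?_ ?_ ?_ ?_ hf
  · rintro _ ⟨⟨j, i⟩, rfl⟩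
    refine (le_iSup (grading B F G) 1 : _) ?_
    rw [grading, pow_one]
    exact Submodule.subset_span ⟨(j, i), rfl⟩
  · intro r
    exact W.algebraMap_mem r
  · intro a b ha hb h1 h2
    exact W.add_mem h1 h2
  · intro a b ha hb h1 h2
    exact W.mul_mem h1 h2

instance gradedMonoid_grading : SetLike.GradedMonoid (grading B F G) :=
  Submodule.nat_power_gradedMonoid _

theorem isInternal_grading : DirectSum.IsInternal (grading B F G) := by
  have hcoeff : ∀ (v : DirectSum ℕ fun n => grading B F G n) (n : ℕ),
      (coaction B F G (DirectSum.coeAddMonoidHom (grading B F G) v : subring B F G)).coeff n =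
        ((v n : subring B F G) : Hypersurface B F G) := by
    intro v n
    induction v using DirectSum.induction_on with
    | zero => simp
    | of i f =>
      rw [DirectSum.coeAddMonoidHom_of, coaction_apply_of_mem_grading B F G i f f.2,
        Polynomial.coeff_C_mul, Polynomial.coeff_X_pow]
      by_cases h : n = i
      · subst h
        simp
      · rw [DirectSum.of_eq_of_ne _ _ _ h]
        simp [h]
    | add v w hv hw => simp [hv, hw]
  refine ⟨(injective_iff_map_eq_zero _).mpr fun v hv => ?_, ?_⟩
  · ext n
    rw [← hcoeff, hv]
    simp
  · have h := iSup_grading B F G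
    rw [Submodule.iSup_eq_range_dfinsupp_lsum, LinearMap.range_eq_top] at h
    exact h

instance gradedAlgebra_grading : GradedAlgebra (grading B F G) where
  toGradedMonoid := gradedMonoid_grading B F G
  __ := (isInternal_grading B F G).chooseDecomposition

end

/-- The index of the last variable. -/
def last {k : ℕ} (hk : 3 ≤ k) : Fin k := ⟨k - 1, by omega⟩

/-- `F` and `G` are relatively prime homogeneous integer polynomials of degree `d` in `X₁, …, X_k`
such that `G` is monic in `X_k` and the monomial `X_k^d` does not occur in `F`. -/
structure IsAdmissible {k : ℕ} (hk : 3 ≤ k) (d : ℕ) (F G : MvPolynomial (Fin k) ℤ) : Prop where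
  homogeneous_left : F.IsHomogeneous d
  homogeneous_right : G.IsHomogeneous d
  isRelPrime : IsRelPrime F G
  coeff_right : G.coeff (Finsupp.single (last hk) d) = 1
  coeff_left : F.coeff (Finsupp.single (last hk) d) = 0

section

variable {k : ℕ} (B : Type*) [CommRing B] (F G : MvPolynomial (Fin k) ℤ)

/-- The sequence `s x₁, s x₂ - t x₁, s x₃ - t x₂, …, s x_k - t x_{k-1}`. -/
def parameters (i : Fin k) : subring B F G :=
  gen B F G 0 i - if h : 0 < i.val then gen B F G 1 ⟨i.val - 1, by omega⟩ else 0

/-- The fiber over `pℤ` of `ℤ → R_ℤ`, where `R_ℤ` is the subring of `ℤ[S,T,X₁,…,X_k]/(SF - TG)`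
generated by the `s xᵢ` and the `t xᵢ`. -/
abbrev Fiber (p : ℕ) : Type := ZMod p ⊗[ℤ] subring ℤ F G

/-- The images of the generators in the fiber. -/
def fiberGen (p : ℕ) (j : Fin 2) (i : Fin k) : Fiber F G p := 1 ⊗ₜ[ℤ] gen ℤ F G j i

/-- The ideal `(s x₁, …, s x_{k-1}, t x₁, …, t x_{k-1})` of the fiber over `pℤ`. -/
def fiberIdeal (hk : 3 ≤ k) (p : ℕ) : Ideal (Fiber F G p) :=
  Ideal.span {z | ∃ (j : Fin 2) (i : Fin k), i ≠ last hk ∧ z = fiberGen F G p j i}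

end

/-- The coefficients of a pair `(F, G)` as one family. -/
def coefficients {k : ℕ} (F G : MvPolynomial (Fin k) ℤ) : (Fin k →₀ ℕ) ⊕ (Fin k →₀ ℕ) → ℤ :=
  Sum.elim (fun m => F.coeff m) (fun m => G.coeff m)

end FormPair

end

/-! Write k = r + 1. Bigrade the hypersurface by the degree in S, T and the degree in the Xᵢ. Then R
is its diagonal subalgebra: Rₙ is the part of bidegree (n, n) (`map_grading`). The equation is a
nonzero form of bidegree (1, d), so over a field dim Rₙ = (n+1)·C(n+r, r) − n·C(n−d+r, r), the last
term being absent for n < d (`finrank_grading`). The dimension and the multiplicity are read against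
this function.

Modulo the proposed parameters, s xᵢ and t xᵢ become y_{i-1} and yᵢ with y₀ = 0. The 2 × 2 minors
then say that yᵢyⱼ depends only on i + j: it is 0 if i + j ≤ k and y_{i+j-k}·y_k otherwise. So a
product of n + 1 generators is determined by its total weight w, as 0 or y_{w-kn}·y_kⁿ
(`map_eq_normalFormMap`). The equation times sᵃtᵇ with a + b = d − 1 has a single term of highest
weight, tᵇ⁺¹X_kᵈ, because G is monic in X_k and X_kᵈ does not occur in F. Hence the d highest
weights in degree d are redundant and degree d + 1 vanishes. The quotient is spanned by 1, the t
xⱼ(t x_k)ⁿ with n < d − 1, and the t xⱼ(t x_k)^{d-1} with j ≤ k − d (`map_mem_span_moduleGen`); by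
graded Nakayama these generate R over the polynomial ring in the parameters. Finiteness gives dim R
≤ k, and a chain of kernels of maps s ↦ G(y), t ↦ F(y), x ↦ y gives the reverse inequality.

If d ≤ k, a binomial identity (`sum_formDim_genDegree`) shows that the free module on these
generators has the Hilbert function of R, so R is free over the parameters (`paramMap_injective`).
The length of the quotient is the number of generators, the Cohen–Macaulay property follows from
flatness over a polynomial ring, and for d = k the highest generator degree d − 1 gives a(R) = (d −
1) − k = −1.

For k ≤ d, each use of the equation trades t·x_kᵈ for terms with fewer factors x_k. After
multiplying (t x_k)^{(d-1)q} by an element of degree at least d there are enough factors t to lower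
the x_k-exponent until pigeonhole produces a q-th power of a generator of I
(`monomial_mem_contraction`). So (t x_k)^{d-1} lies in I*, while the specialization s = 0, t = 1,
x_k ↦ y with yᵈ = 0 shows that it is not in I. An arbitrary model over a finitely generated subring
of ℚ agrees with R_ℤ after inverting one integer (`exists_isBaseChangeOf`), which excludes F-regular
type.

Away from m the ring is covered by charts that are localizations of hypersurfaces σF − τG = 0 in
affine space, with σ or τ equal to 1. By Euler's formula such a chart is nonsingular wherever F, G
and the minors of their Jacobian matrix have no common zero. For the diagonal pair ∑ aᵢXᵢᵈ, ∑ Xᵢᵈ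
with distinct aᵢ those polynomials generate, up to nonzero integers, all monomials of some degree N.
A determinant Φ of coefficients carries this over to every pair with Φ ≠ 0 (`exists_eliminant`). -/

open scoped TensorProduct

noncomputable section

namespace FormPair

open MvPolynomial

/-! ### The bigrading of the hypersurface and its diagonal -/

section Bigrading

variable {k : ℕ}

/-- The bidegree of the variables: `S`, `T` have bidegree `(1, 0)` and `Xᵢ` has bidegree `(0, 1)`. -/
def bideg : Fin 2 ⊕ Fin k → ℕ × ℕ := Sum.elim (fun _ => (1, 0)) (fun _ => (0, 1))

theorem weight_bideg (m : Fin 2 ⊕ Fin k →₀ ℕ) :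
    Finsupp.weight bideg m =
      (m (Sum.inl 0) + m (Sum.inl 1), ∑ i, m (Sum.inr i)) := by
  rw [Finsupp.weight_apply, Finsupp.sum_fintype _ _ (by simp)]
  ext <;> simp [bideg, Prod.fst_sum, Prod.snd_sum]

variable (B : Type*) [CommRing B] (F G : MvPolynomial (Fin k) ℤ)

/-- The bihomogeneous polynomials of bidegree `(a, b)`. -/
abbrev bihom (a b : ℕ) : Submodule B (MvPolynomial (Fin 2 ⊕ Fin k) B) :=
  weightedHomogeneousSubmodule B bideg (a, b)

/-- The projection from the polynomial ring to the hypersurface. -/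
def proj : MvPolynomial (Fin 2 ⊕ Fin k) B →ₐ[B] Hypersurface B F G := Ideal.Quotient.mkₐ B _

theorem proj_X (j : Fin 2 ⊕ Fin k) : proj B F G (X j) = var B F G j := rfl

theorem proj_surjective : Function.Surjective (proj B F G) := Ideal.Quotient.mkₐ_surjective _ _

theorem proj_eq_zero_iff {p : MvPolynomial (Fin 2 ⊕ Fin k) B} :
    proj B F G p = 0 ↔ equation B F G ∣ p := by
  rw [← Ideal.mem_span_singleton]
  exact Ideal.Quotient.eq_zero_iff_mem

theorem proj_equation : proj B F G (equation B F G) = 0 := (proj_eq_zero_iff B F G).2 dvd_rfl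

/-- The inductive step for monomials on the diagonal: if both degrees are positive, some factor sⱼxᵢ
can be split off. -/
theorem exists_eq_add_of_weight {m : Fin 2 ⊕ Fin k →₀ ℕ} {a b : ℕ}
    (h : Finsupp.weight bideg m = (a + 1, b + 1)) :
    ∃ (j : Fin 2) (i : Fin k) (m' : Fin 2 ⊕ Fin k →₀ ℕ),
      m = Finsupp.single (Sum.inl j) 1 + Finsupp.single (Sum.inr i) 1 + m' ∧
        Finsupp.weight bideg m' = (a, b) := by
  have h' := h
  rw [weight_bideg, Prod.mk.injEq] at h
  have h1 : ∃ j : Fin 2, m (Sum.inl j) ≠ 0 := by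
    by_contra! hc
    have := hc 0; have := hc 1; omega
  have h2 : ∃ i : Fin k, m (Sum.inr i) ≠ 0 := by
    by_contra! hc
    have := h.2
    simp [hc] at this
  obtain ⟨j, hj⟩ := h1
  obtain ⟨i, hi⟩ := h2
  have hle : Finsupp.single (Sum.inl j) 1 + Finsupp.single (Sum.inr i) 1 ≤ m := by
    classical
    intro l
    rw [Finsupp.add_apply, Finsupp.single_apply, Finsupp.single_apply]
    rcases l with l | l
    · simp only [Sum.inl.injEq, reduceCtorEq, if_false, add_zero]
      split_ifs with h
      · subst h; omega
      · omega
    · simp only [Sum.inr.injEq, reduceCtorEq, if_false, zero_add]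
      split_ifs with h
      · subst h; omega
      · omega
  refine ⟨j, i, m - (Finsupp.single (Sum.inl j) 1 + Finsupp.single (Sum.inr i) 1),
    (add_tsub_cancel_of_le hle).symm, ?_⟩
  have h3 := congrArg (Finsupp.weight bideg) (add_tsub_cancel_of_le hle)
  rw [map_add, map_add, h', Finsupp.weight_single, Finsupp.weight_single] at h3
  simp only [bideg, Sum.elim_inl, Sum.elim_inr, one_smul, Prod.ext_iff, Prod.fst_add,
    Prod.snd_add] at h3 ⊢
  omega

theorem monomial_add_eq (j : Fin 2) (i : Fin k) (m : Fin 2 ⊕ Fin k →₀ ℕ) (r : B) :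
    monomial (Finsupp.single (Sum.inl j) 1 + Finsupp.single (Sum.inr i) 1 + m) r =
      X (Sum.inl j) * X (Sum.inr i) * monomial m r := by
  rw [X, X, monomial_mul, monomial_mul]
  simp

theorem gen_mem_grading (j : Fin 2) (i : Fin k) : gen B F G j i ∈ grading B F G 1 := by
  rw [grading, pow_one]
  exact Submodule.subset_span ⟨(j, i), rfl⟩

theorem coe_gen (j : Fin 2) (i : Fin k) : (gen B F G j i : Hypersurface B F G) =
    proj B F G (X (Sum.inl j) * X (Sum.inr i)) := by
  rw [map_mul, proj_X, proj_X]; rfl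

theorem X_mul_X_mem_bihom (j : Fin 2) (i : Fin k) :
    (X (Sum.inl j) * X (Sum.inr i) : MvPolynomial (Fin 2 ⊕ Fin k) B) ∈ bihom B 1 1 := by
  have := (isWeightedHomogeneous_X B (bideg (k := k)) (Sum.inl j)).mul
    (isWeightedHomogeneous_X B (bideg (k := k)) (Sum.inr i))
  simpa [bideg] using this

theorem mem_bihom_induction {a b : ℕ} {motive : MvPolynomial (Fin 2 ⊕ Fin k) B → Prop}
    (zero : motive 0) (add : ∀ p q, motive p → motive q → motive (p + q))
    (mon : ∀ m r, Finsupp.weight bideg m = (a, b) → motive (monomial m r))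
    {p : MvPolynomial (Fin 2 ⊕ Fin k) B} (hp : p ∈ bihom B a b) : motive p := by
  rw [p.as_sum]
  refine Finset.sum_induction _ motive add zero fun m hm => mon _ _ (hp ?_)
  exact mem_support_iff.1 hm

theorem exists_grading_eq_proj_monomial (n : ℕ) :
    ∀ (m : Fin 2 ⊕ Fin k →₀ ℕ) (r : B), Finsupp.weight bideg m = (n, n) →
      ∃ x ∈ grading B F G n, (x : Hypersurface B F G) = proj B F G (monomial m r) := by
  induction n with
  | zero =>
    intro m r h
    rw [weight_bideg, Prod.mk.injEq] at h
    have hm : m = 0 := by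
      ext l
      rcases l with l | l
      · fin_cases l <;> simp <;> omega
      · exact (Finset.sum_eq_zero_iff.1 h.2) l (Finset.mem_univ l)
    subst hm
    refine ⟨algebraMap B _ r, ?_, ?_⟩
    · rw [grading, pow_zero, Submodule.mem_one]
      exact ⟨r, rfl⟩
    · exact ((proj B F G).commutes r).symm
  | succ n ih =>
    intro m r h
    obtain ⟨j, i, m', rfl, hm'⟩ := exists_eq_add_of_weight h
    obtain ⟨x, hx, hx'⟩ := ih m' r hm'
    refine ⟨gen B F G j i * x, ?_, ?_⟩
    · rw [add_comm n 1]
      exact SetLike.mul_mem_graded (gen_mem_grading B F G j i) hx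
    · rw [MulMemClass.coe_mul, hx', coe_gen, ← map_mul, monomial_add_eq]

theorem exists_grading_eq_proj {n : ℕ} {p : MvPolynomial (Fin 2 ⊕ Fin k) B}
    (hp : p ∈ bihom B n n) :
    ∃ x ∈ grading B F G n, (x : Hypersurface B F G) = proj B F G p := by
  refine mem_bihom_induction B (a := n) (b := n) (motive := fun p =>
    ∃ x ∈ grading B F G n, (x : Hypersurface B F G) = proj B F G p) ?_ ?_
    (exists_grading_eq_proj_monomial B F G n) hp
  · exact ⟨0, zero_mem _, by simp⟩
  · rintro p q ⟨x, hx, hx'⟩ ⟨y, hy, hy'⟩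
    exact ⟨x + y, add_mem hx hy, by simp [hx', hy']⟩

theorem exists_bihom_of_mem_grading {n : ℕ} {x : subring B F G} (hx : x ∈ grading B F G n) :
    ∃ p ∈ bihom B n n, proj B F G p = x := by
  have hgen : ∀ g ∈ Submodule.span B
      (Set.range fun ji : Fin 2 × Fin k => gen B F G ji.1 ji.2),
      ∃ p ∈ bihom B 1 1, proj B F G p = (g : Hypersurface B F G) := by
    intro g hg
    induction hg using Submodule.span_induction with
    | mem g h =>
      obtain ⟨⟨j, i⟩, rfl⟩ := h
      exact ⟨_, X_mul_X_mem_bihom B j i, (coe_gen B F G j i).symm⟩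
    | zero => exact ⟨0, zero_mem _, by simp⟩
    | add a b _ _ ha hb =>
      obtain ⟨p, hp, hp'⟩ := ha
      obtain ⟨q, hq, hq'⟩ := hb
      exact ⟨p + q, add_mem hp hq, by simp [hp', hq']⟩
    | smul c a _ ha =>
      obtain ⟨p, hp, hp'⟩ := ha
      exact ⟨c • p, Submodule.smul_mem _ _ hp, by simp [hp']⟩
  unfold grading at hx
  induction hx using Submodule.pow_induction_on_left' with
  | algebraMap r => exact ⟨C r, isWeightedHomogeneous_C _ r, (proj B F G).commutes r⟩
  | add a b i _ _ ha hb =>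
    obtain ⟨p, hp, hp'⟩ := ha
    obtain ⟨q, hq, hq'⟩ := hb
    exact ⟨p + q, add_mem hp hq, by simp [hp', hq']⟩
  | mem_mul m hm i x hx ih =>
    obtain ⟨p, hp, hp'⟩ := hgen m hm
    obtain ⟨q, hq, hq'⟩ := ih
    refine ⟨p * q, ?_, by simp [hp', hq']⟩
    have := IsWeightedHomogeneous.mul hp hq
    rwa [Prod.mk_add_mk, add_comm 1 i] at this

/-- An element of the subring is determined by its image in the hypersurface, so the degree `n`
piece is the image of the forms of bidegree `(n, n)`. -/
theorem map_grading (n : ℕ) :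
    (grading B F G n).map (subring B F G).val.toLinearMap =
      (bihom B n n).map (proj B F G).toLinearMap := by
  ext h
  constructor
  · rintro ⟨x, hx, rfl⟩
    obtain ⟨p, hp, hp'⟩ := exists_bihom_of_mem_grading B F G hx
    exact ⟨p, hp, hp'⟩
  · rintro ⟨p, hp, rfl⟩
    obtain ⟨x, hx, hx'⟩ := exists_grading_eq_proj B F G hp
    exact ⟨x, hx, hx'⟩

/-- These are the 2 × 2 minors of the matrix with rows (s xᵢ) and (t xᵢ); the straightening modulo
the parameters rests on them. -/
theorem gen_mul_gen (i j : Fin k) :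
    gen B F G 0 i * gen B F G 1 j = gen B F G 0 j * gen B F G 1 i := by
  apply Subtype.ext
  simp only [MulMemClass.coe_mul, gen]
  ring

theorem lift_isWeightedHomogeneous {d : ℕ} {H : MvPolynomial (Fin k) ℤ} (h : H.IsHomogeneous d) :
    lift B H ∈ bihom B 0 d := by
  rw [mem_weightedHomogeneousSubmodule, lift, IsWeightedHomogeneous]
  intro m hm
  obtain ⟨u, rfl, hu⟩ := coeff_rename_ne_zero _ _ _ hm
  rw [coeff_map] at hu
  have h1 : H.coeff u ≠ 0 := by rintro h0; simp [h0] at hu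
  have h2 := h h1
  rw [weight_bideg]
  rw [Finsupp.weight_apply, Finsupp.sum_fintype _ _ (by simp)] at h2
  have h3 : ∀ j : Fin 2, Finsupp.mapDomain (Sum.inr : Fin k → Fin 2 ⊕ Fin k) u (Sum.inl j) = 0 :=
    fun j => Finsupp.mapDomain_of_notMem_range _ _ (by simp)
  rw [h3, h3]
  simp only [Finsupp.mapDomain_apply Sum.inr_injective]
  simp at h2
  simp [h2]

theorem equation_mem_bihom {d : ℕ} (hF : F.IsHomogeneous d) (hG : G.IsHomogeneous d) :
    equation B F G ∈ bihom B 1 d := by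
  have h1 := (isWeightedHomogeneous_X B (bideg (k := k)) (Sum.inl 0)).mul
    (lift_isWeightedHomogeneous B hF)
  have h2 := (isWeightedHomogeneous_X B (bideg (k := k)) (Sum.inl 1)).mul
    (lift_isWeightedHomogeneous B hG)
  simp only [bideg, Sum.elim_inl, Prod.mk_add_mk, add_zero, zero_add] at h1 h2
  exact sub_mem (S := Submodule B _) h1 h2

end Bigrading

/-! ### The Hilbert function -/

section Dimension

theorem finrank_restrictSupport {σ : Type*} (K : Type*) [Field K] (s : Set (σ →₀ ℕ)) :
    Module.finrank K (restrictSupport K s) = Nat.card s :=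
  Module.finrank_eq_nat_card_basis (basisRestrictSupport K s)

theorem finite_restrictSupport {σ : Type*} (K : Type*) [Field K] (s : Set (σ →₀ ℕ)) [Finite s] :
    Module.Finite K (restrictSupport K s) :=
  Module.Finite.of_basis (basisRestrictSupport K s)

theorem natCard_sum_eq (n b : ℕ) :
    Nat.card {u : Fin (n + 1) → ℕ // ∑ i, u i = b} = (b + n).choose n := by
  rw [Nat.card_congr (Sym.equivNatSumOfFintype (Fin (n + 1)) b).symm, Nat.card_eq_fintype_card,
    Sym.card_sym_eq_choose, Fintype.card_fin]
  rw [show n + 1 + b - 1 = b + n by omega, Nat.choose_symm_add]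

theorem finite_sum_eq (n b : ℕ) : Finite {u : Fin n → ℕ // ∑ i, u i = b} :=
  Finite.of_equiv _ (Sym.equivNatSumOfFintype (Fin n) b)

variable {k : ℕ} (K : Type*) [Field K]

/-- Exponents of bidegree `(a, b)` are pairs of exponents in `S, T` and in the `Xᵢ`. -/
def bihomExponentEquiv (a b : ℕ) :
    {m : Fin 2 ⊕ Fin k →₀ ℕ | Finsupp.weight bideg m = (a, b)} ≃
      {u : Fin 2 → ℕ // ∑ i, u i = a} × {u : Fin k → ℕ // ∑ i, u i = b} :=
  ((Finsupp.equivFunOnFinite.trans (Equiv.sumArrowEquivProdArrow _ _ _)).subtypeEquiv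
    (q := fun u => (∑ i, u.1 i = a) ∧ (∑ i, u.2 i = b)) (by
    intro m
    change Finsupp.weight bideg m = (a, b) ↔
      (∑ i, m (Sum.inl i) = a) ∧ (∑ i, m (Sum.inr i) = b)
    rw [weight_bideg, Fin.sum_univ_two, Prod.mk.injEq])).trans
    (Equiv.subtypeProdEquivProd (p := fun u : Fin 2 → ℕ => ∑ i, u i = a)
      (q := fun u : Fin k → ℕ => ∑ i, u i = b))

theorem finite_bihom (a b : ℕ) : Module.Finite K (bihom (k := k) K a b) := by
  have h1 := finite_sum_eq 2 a
  have h2 := finite_sum_eq k b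
  have := Finite.of_equiv _ (bihomExponentEquiv (k := k) a b).symm
  rw [bihom, weightedHomogeneousSubmodule_eq_finsupp_supported]
  exact finite_restrictSupport K {m | Finsupp.weight (bideg (k := k)) m = (a, b)}

theorem finrank_bihom (a b : ℕ) :
    Module.finrank K (bihom (k := k + 1) K a b) = (a + 1) * (b + k).choose k := by
  rw [bihom, weightedHomogeneousSubmodule_eq_finsupp_supported, ← restrictSupport,
    finrank_restrictSupport, Nat.card_congr (bihomExponentEquiv a b), Nat.card_prod, natCard_sum_eq, natCard_sum_eq]
  simp

theorem finite_homogeneousSubmodule (b : ℕ) :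
    Module.Finite K (homogeneousSubmodule (Fin k) K b) := by
  have h2 := finite_sum_eq k b
  have : Finite {d : Fin k →₀ ℕ | d.degree = b} := Finite.of_equiv _
    (Finsupp.equivFunOnFinite.subtypeEquiv (p := fun d : Fin k →₀ ℕ => d.degree = b)
      (q := fun u : Fin k → ℕ => ∑ i, u i = b)
      (by intro m; rw [Finsupp.degree_eq_sum]; rfl)).symm
  rw [homogeneousSubmodule_eq_finsupp_supported]
  exact finite_restrictSupport K _

theorem finrank_homogeneousSubmodule (b : ℕ) :
    Module.finrank K (homogeneousSubmodule (Fin (k + 1)) K b) = (b + k).choose k := by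
  rw [homogeneousSubmodule_eq_finsupp_supported, ← restrictSupport, finrank_restrictSupport,
    ← natCard_sum_eq]
  exact Nat.card_congr (Finsupp.equivFunOnFinite.subtypeEquiv
    (p := fun d : Fin (k + 1) →₀ ℕ => d.degree = b)
      (q := fun u : Fin (k + 1) → ℕ => ∑ i, u i = b)
      (by intro m; rw [Finsupp.degree_eq_sum]; rfl))

variable (F G : MvPolynomial (Fin k) ℤ)

/-- The specialization S = 0, T = 1 turns the equation into −G, which has the coefficient −1. -/
theorem equation_ne_zero [NeZero k] {d : ℕ} {i : Fin k} (hG : G.coeff (Finsupp.single i d) = 1)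
    (B : Type*) [CommRing B] [Nontrivial B] : equation B F G ≠ 0 := by
  intro h
  have h1 := congrArg (aeval (R := B) (Sum.elim (fun j => if j = 0 then 0 else 1)
    (fun i => (X i : MvPolynomial (Fin k) B)))) h
  have h2 : ∀ H : MvPolynomial (Fin k) ℤ, aeval (R := B)
      (Sum.elim (fun j : Fin 2 => if j = 0 then 0 else 1)
        (fun i => (X i : MvPolynomial (Fin k) B))) (lift B H) = map (Int.castRingHom B) H := by
    intro H
    rw [lift, aeval_rename]
    have : (Sum.elim (fun j : Fin 2 => if j = 0 then 0 else 1)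
        (fun i => (X i : MvPolynomial (Fin k) B))) ∘ Sum.inr = X := by ext; simp
    rw [this, aeval_X_left]; rfl
  rw [equation, map_sub, map_mul, map_mul, h2, h2] at h1
  simp only [aeval_X, Sum.elim_inl, if_true, zero_mul, one_ne_zero, if_false, one_mul,
    map_zero, zero_sub, neg_eq_zero] at h1
  have h3 := congrArg (coeff (Finsupp.single i d)) h1
  rw [coeff_map, hG] at h3
  simp at h3

/-- The cofactor q need not be bihomogeneous. Comparing the components of bidegree (a, b), only the
component of q of bidegree (a − 1, b − d) contributes, and there is none if this bidegree is
negative. -/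
theorem bihom_of_equation_mul {B : Type*} [CommRing B] {d : ℕ}
    (hF : F.IsHomogeneous d) (hG : G.IsHomogeneous d)
    {a b : ℕ} {q : MvPolynomial (Fin 2 ⊕ Fin k) B} (h : equation B F G * q ∈ bihom B a b) :
    (1 ≤ a ∧ d ≤ b → ∃ q' ∈ bihom B (a - 1) (b - d),
      equation B F G * q = equation B F G * q') ∧
    (¬ (1 ≤ a ∧ d ≤ b) → equation B F G * q = 0) := by
  classical
  let := weightedGradedAlgebra B (bideg (k := k))
  have he := equation_mem_bihom B F G hF hG
  have h1 : (DirectSum.decompose (weightedHomogeneousSubmodule B (bideg (k := k)))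
      (equation B F G * q) (a, b) : MvPolynomial (Fin 2 ⊕ Fin k) B) = equation B F G * q :=
    DirectSum.decompose_of_mem_same _ h
  constructor
  · intro hab
    have hle : ((1, d) : ℕ × ℕ) ≤ (a, b) := Prod.mk_le_mk.2 hab
    rw [DirectSum.coe_decompose_mul_of_left_mem_of_le
      (weightedHomogeneousSubmodule B (bideg (k := k))) he hle] at h1
    exact ⟨_, SetLike.coe_mem _, h1.symm⟩
  · intro hab
    have hle : ¬ ((1, d) : ℕ × ℕ) ≤ (a, b) := fun h => hab (Prod.mk_le_mk.1 h)
    rw [DirectSum.coe_decompose_mul_of_left_mem_of_not_le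
      (weightedHomogeneousSubmodule B (bideg (k := k))) he hle] at h1
    exact h1.symm

theorem finrank_grading_eq (n : ℕ) :
    Module.finrank K (grading K F G n) =
      Module.finrank K ((bihom K n n).map (proj K F G).toLinearMap) := by
  rw [← map_grading]
  exact (Submodule.equivMapOfInjective (subring K F G).val.toLinearMap Subtype.val_injective _).finrank_eq

theorem finite_grading (n : ℕ) : Module.Finite K (grading K F G n) := by
  have := finite_bihom (k := k) K n n
  have h : Module.Finite K ((bihom (k := k) K n n).map (proj K F G).toLinearMap) := inferInstance
  rw [← map_grading] at h
  exact Module.Finite.equiv (Submodule.equivMapOfInjective (subring K F G).val.toLinearMap Subtype.val_injective _).symm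

/-- The Hilbert function of the subring. -/
theorem finrank_grading (F G : MvPolynomial (Fin (k + 1)) ℤ) {d : ℕ} {i : Fin (k + 1)}
    (hF : F.IsHomogeneous d) (hG : G.IsHomogeneous d) (hG1 : G.coeff (Finsupp.single i d) = 1)
    (hd : 1 ≤ d) (n : ℕ) :
    Module.finrank K (grading K F G n) + (if d ≤ n then n * (n - d + k).choose k else 0) =
      (n + 1) * (n + k).choose k := by
  have hfin := finite_bihom (k := k + 1) K n n
  rw [finrank_grading_eq, ← finrank_bihom (k := k) K n n]
  set f : bihom (k := k + 1) K n n →ₗ[K] Hypersurface K F G :=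
    (proj K F G).toLinearMap.comp (bihom K n n).subtype with hf
  have hr : LinearMap.range f = (bihom K n n).map (proj K F G).toLinearMap := by
    rw [hf, LinearMap.range_comp, Submodule.range_subtype]
  rw [← LinearMap.finrank_range_add_finrank_ker f, hr]
  congr 1
  have he := equation_ne_zero F G hG1 K
  have heq := equation_mem_bihom K F G hF hG
  -- The kernel consists of the multiples of the equation of bidegree (n, n). Multiplication by the
  -- equation identifies it with the forms of bidegree (n − 1, n − d).
  split_ifs with hdn
  · have hr := finrank_bihom (k := k) K (n - 1) (n - d)
    rw [show n - 1 + 1 = n by omega] at hr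
    rw [← hr]
    let g : bihom (k := k + 1) K (n - 1) (n - d) →ₗ[K] LinearMap.ker f :=
      LinearMap.codRestrict _ (LinearMap.codRestrict _
        ((LinearMap.mulLeft K (equation K F G)).comp (Submodule.subtype _)) (by
          intro q
          have := IsWeightedHomogeneous.mul heq q.2
          rwa [Prod.mk_add_mk, show 1 + (n - 1) = n by omega, show d + (n - d) = n by omega]
            at this)) (by
        intro q
        exact (proj_eq_zero_iff K F G).2 (dvd_mul_right _ _))
    have : Function.Bijective g := by
      constructor
      · intro q q' h
        have h2 : equation K F G * q.1 = equation K F G * q'.1 :=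
          congrArg (fun x : LinearMap.ker f => x.1.1) h
        exact Subtype.ext (mul_left_cancel₀ he h2)
      · rintro ⟨⟨p, hp⟩, hp'⟩
        obtain ⟨q, rfl⟩ := (proj_eq_zero_iff K F G).1 hp'
        obtain ⟨q', hq', h⟩ := (bihom_of_equation_mul F G hF hG hp).1 ⟨by omega, hdn⟩
        exact ⟨⟨q', hq'⟩, Subtype.ext (Subtype.ext h.symm)⟩
    exact (LinearEquiv.ofBijective g this).finrank_eq
  · have : LinearMap.ker f = ⊥ := by
      rw [eq_bot_iff]
      rintro ⟨p, hp⟩ hp'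
      obtain ⟨q, rfl⟩ := (proj_eq_zero_iff K F G).1 hp'
      exact Subtype.ext ((bihom_of_equation_mul F G hF hG hp).2 (by omega))
    rw [this, finrank_bot]

end Dimension

/-! ### The Hilbert polynomial and its leading coefficient -/

section HilbertPolynomial

open Polynomial in
-- As a polynomial in n, C(n−d+r, r) is the translate of C(n+r, r) by −d. This makes the top
-- coefficients of the difference computable.
theorem preHilbertPoly_eq_taylor (r d : ℕ) :
    preHilbertPoly ℚ r d = taylor (-(d : ℚ)) (preHilbertPoly ℚ r 0) := by
  rw [preHilbertPoly, preHilbertPoly, map_smul]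
  congr 1
  simp [taylor_apply, comp_assoc, sub_eq_add_neg]

open Polynomial in
theorem coeff_taylor_of_natDegree_le {r : ℕ} {p : ℚ[X]} (hp : p.natDegree ≤ r + 1) (c : ℚ) :
    (taylor c p).coeff r = p.coeff r + (r + 1) * p.coeff (r + 1) * c := by
  rw [taylor_coeff]
  have h1 : (hasseDeriv r p).natDegree ≤ 1 := by
    refine (natDegree_hasseDeriv_le p r).trans ?_
    omega
  rw [eval_eq_sum_range' (Nat.lt_succ_of_le h1)]
  simp only [Finset.sum_range_succ, hasseDeriv_coeff, Finset.sum_range_zero, zero_add,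
    Nat.choose_self, add_comm 1 r, Nat.choose_succ_self_right]
  push_cast
  ring

/-- The Hilbert polynomial of the subring for forms of degree `d` in `r + 2` variables. -/
def hilbertPolynomial (r d : ℕ) : Polynomial ℚ :=
  Polynomial.preHilbertPoly ℚ (r + 1) 0 + Polynomial.X *
    (Polynomial.preHilbertPoly ℚ (r + 1) 0 - Polynomial.preHilbertPoly ℚ (r + 1) d)

theorem eval_hilbertPolynomial {r d n : ℕ} (h : d ≤ n) :
    (hilbertPolynomial r d).eval (n : ℚ) =
      (n + 1) * (n + (r + 1)).choose (r + 1) - n * (n - d + (r + 1)).choose (r + 1) := by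
  simp only [hilbertPolynomial, Polynomial.eval_add, Polynomial.eval_mul, Polynomial.eval_X,
    Polynomial.eval_sub, Polynomial.preHilbertPoly_eq_choose_sub_add ℚ (r + 1) (Nat.zero_le n),
    Polynomial.preHilbertPoly_eq_choose_sub_add ℚ (r + 1) h]
  simp only [Nat.sub_zero]
  ring

open Polynomial in
-- In the difference of the two binomial polynomials the leading terms cancel. Translation by d
-- leaves d·(r+1)/(r+1)! in degree r; multiplication by X moves it to degree r + 1, where the first
-- summand adds 1/(r+1)!.
theorem natDegree_and_coeff_hilbertPolynomial (r d : ℕ) :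
    (hilbertPolynomial r d).natDegree = r + 1 ∧
      (hilbertPolynomial r d).leadingCoeff * ((r + 1).factorial : ℚ) =
        ((d * (r + 1) + 1 : ℕ) : ℚ) := by
  have hf : ((r + 1).factorial : ℚ) ≠ 0 := by positivity
  have hc : (hilbertPolynomial r d).coeff (r + 1) =
      ((d * (r + 1) + 1 : ℕ) : ℚ) * ((r + 1).factorial : ℚ)⁻¹ := by
    rw [hilbertPolynomial, Polynomial.coeff_add, coeff_preHilbertPoly_self, Polynomial.coeff_X_mul, Polynomial.coeff_sub,
      preHilbertPoly_eq_taylor _ d, coeff_taylor_of_natDegree_le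
        (natDegree_preHilbertPoly ℚ (r + 1) 0).le, coeff_preHilbertPoly_self]
    push_cast
    ring
  have hle : (hilbertPolynomial r d).natDegree ≤ r + 1 := by
    rw [natDegree_le_iff_coeff_eq_zero]
    intro N hN
    obtain ⟨N, rfl⟩ : ∃ M, N = M + 1 := ⟨N - 1, by omega⟩
    rw [hilbertPolynomial, Polynomial.coeff_add, Polynomial.coeff_X_mul, Polynomial.coeff_sub,
      coeff_eq_zero_of_natDegree_lt ((natDegree_preHilbertPoly ℚ (r + 1) 0).trans_lt hN), zero_add]
    rcases Nat.lt_or_ge (r + 1) N with h | h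
    · rw [coeff_eq_zero_of_natDegree_lt ((natDegree_preHilbertPoly ℚ (r + 1) 0).trans_lt h),
        coeff_eq_zero_of_natDegree_lt ((natDegree_preHilbertPoly ℚ (r + 1) d).trans_lt h), sub_zero]
    · obtain rfl : N = r + 1 := by omega
      rw [coeff_preHilbertPoly_self, coeff_preHilbertPoly_self, sub_self]
  have hdeg : (hilbertPolynomial r d).natDegree = r + 1 := by
    refine natDegree_eq_of_le_of_coeff_ne_zero hle ?_
    rw [hc]
    positivity
  refine ⟨hdeg, ?_⟩
  rw [leadingCoeff, hdeg, hc]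
  field_simp

end HilbertPolynomial

/-! ### Straightening products of generators modulo the parameters -/

section Straightening

variable {r : ℕ} {B : Type*} [CommRing B] {F G : MvPolynomial (Fin (r + 1)) ℤ}
variable {Q : Type*} [CommRing Q] [Algebra B Q] (π : subring B F G →ₐ[B] Q)

/-- The images of `0, t x₁, …, t x_k` in a quotient of the subring. -/
def scroll : ℕ → Q
  | 0 => 0
  | j + 1 => if h : j < r + 1 then π (gen B F G 1 ⟨j, h⟩) else 0

theorem scroll_succ (i : Fin (r + 1)) : scroll π (i + 1) = π (gen B F G 1 i) := by
  rw [scroll, dif_pos i.2]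

variable (hπ : ∀ i, π (parameters B F G i) = 0)

include hπ in
theorem scroll_eq (i : Fin (r + 1)) : scroll π i = π (gen B F G 0 i) := by
  have h := hπ i
  rw [parameters, map_sub, sub_eq_zero] at h
  rw [h]
  obtain ⟨i, hi⟩ := i
  cases i with
  | zero => simp [scroll]
  | succ i => simp [scroll, show i < r + 1 by omega]

include hπ in
theorem map_gen (j : Fin 2) (i : Fin (r + 1)) : π (gen B F G j i) = scroll π (i + j) := by
  fin_cases j
  · exact (scroll_eq π hπ i).symm
  · exact (scroll_succ π i).symm

include hπ in
-- The minors become the relations of a rational normal scroll: one subscript may be raised while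
-- the other is lowered.
theorem scroll_mul_succ {i j : ℕ} (hi : i ≤ r) (hj : j ≤ r) :
    scroll π i * scroll π (j + 1) = scroll π (i + 1) * scroll π j := by
  have h := congrArg π (gen_mul_gen B F G ⟨i, by omega⟩ ⟨j, by omega⟩)
  rw [map_mul, map_mul, map_gen π hπ, map_gen π hπ, map_gen π hπ, map_gen π hπ] at h
  simpa [mul_comm] using h

include hπ in
-- Lower i and raise j until the first factor is `scroll π 0`, which is 0; the bound on i + j keeps
-- the second subscript in range.
theorem scroll_mul_eq_zero {i : ℕ} : ∀ {j : ℕ}, i + j ≤ r + 1 →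
    scroll π i * scroll π j = 0 := by
  induction i with
  | zero => intro j _; simp [scroll]
  | succ i ih =>
    intro j h
    rw [← scroll_mul_succ π hπ (by omega) (by omega)]
    exact ih (by omega)

include hπ in
-- The same sliding in the other direction: j is raised to its maximum r + 1, and s counts the
-- remaining moves.
theorem scroll_mul_eq (s : ℕ) : ∀ {i j : ℕ}, j + s = r + 1 → i ≤ r + 1 → r + 1 < i + j →
    scroll π i * scroll π j = scroll π (i + j - (r + 1)) * scroll π (r + 1) := by
  induction s with
  | zero =>
    intro i j h _ _
    rw [show j = r + 1 by omega, Nat.add_sub_cancel]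
  | succ s ih =>
    intro i j h hi hij
    obtain ⟨i, rfl⟩ : ∃ i', i = i' + 1 := ⟨i - 1, by omega⟩
    rw [← scroll_mul_succ π hπ (by omega) (by omega), ih (by omega) (by omega) (by omega)]
    congr 2
    omega

/-- The normal form of a product of `n + 1` generators of total weight `w`. -/
def normalForm (n w : ℕ) : Q :=
  if w ≤ (r + 1) * n then 0 else scroll π (w - (r + 1) * n) * scroll π (r + 1) ^ n

include hπ in
-- Only the two factors `scroll π (w - (r + 1) * n)` and `scroll π j` have to be straightened, and
-- their subscript sum decides between zero and the next normal form.
theorem normalForm_mul {n w j : ℕ} (hw : w ≤ (r + 1) * (n + 1)) (hj : j ≤ r + 1) :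
    normalForm π n w * scroll π j = normalForm π (n + 1) (w + j) := by
  unfold normalForm
  rw [mul_add, mul_one] at hw ⊢
  by_cases h1 : w ≤ (r + 1) * n
  · rw [if_pos h1, if_pos (by omega), zero_mul]
  rw [if_neg h1, mul_right_comm]
  by_cases h2 : w + j ≤ (r + 1) * n + (r + 1)
  · rw [if_pos h2, scroll_mul_eq_zero π hπ (by omega), zero_mul]
  · rw [if_neg h2, scroll_mul_eq π hπ (r + 1 - j) (by omega) (by omega) (by omega), pow_succ',
      mul_assoc]
    congr 2
    omega

/-- The weight of the variables under `s ↦ u`, `t ↦ v`, `xᵢ ↦ u^(k-i) v^(i-1)`. -/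
def scrollWeight : Fin 2 ⊕ Fin (r + 1) → ℕ := Sum.elim (fun j => j) (fun i => i)

theorem weight_scrollWeight_le {m : Fin 2 ⊕ Fin (r + 1) →₀ ℕ} {a b : ℕ}
    (h : Finsupp.weight bideg m = (a, b)) : Finsupp.weight scrollWeight m ≤ a + r * b := by
  rw [weight_bideg, Prod.mk.injEq] at h
  rw [Finsupp.weight_apply, Finsupp.sum_fintype _ _ (by simp), Fintype.sum_sum_type, ← h.1, ← h.2,
    Finset.mul_sum]
  refine add_le_add ?_ (Finset.sum_le_sum fun i _ => ?_)
  · simp [scrollWeight, Fin.sum_univ_two]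
  · simp only [scrollWeight, Sum.elim_inr, smul_eq_mul]
    rw [mul_comm]
    exact Nat.mul_le_mul_right _ (by omega)

include hπ in
theorem exists_map_eq_normalForm (n : ℕ) : ∀ m : Fin 2 ⊕ Fin (r + 1) →₀ ℕ,
    Finsupp.weight bideg m = (n + 1, n + 1) →
      ∃ x : subring B F G, (x : Hypersurface B F G) = proj B F G (monomial m 1) ∧
        π x = normalForm π n (Finsupp.weight scrollWeight m) := by
  induction n with
  | zero =>
    intro m h
    obtain ⟨j, i, m', rfl, hm'⟩ := exists_eq_add_of_weight h
    have hm0 : m' = 0 := by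
      rw [weight_bideg, Prod.mk.injEq] at hm'
      ext l
      rcases l with l | l
      · fin_cases l <;> simp <;> omega
      · exact (Finset.sum_eq_zero_iff.1 hm'.2) l (Finset.mem_univ l)
    subst hm0
    refine ⟨gen B F G j i, ?_, ?_⟩
    · rw [monomial_add_eq, coe_gen]; simp
    · rw [map_gen π hπ, normalForm]
      simp only [map_add, Finsupp.weight_single, scrollWeight, Sum.elim_inl, Sum.elim_inr,
        smul_eq_mul, one_mul, map_zero, add_zero, mul_zero, pow_zero, mul_one, Nat.sub_zero,
        nonpos_iff_eq_zero, add_comm]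
      split_ifs with h0
      · rw [h0]; rfl
      · rfl
  | succ n ih =>
    intro m h
    obtain ⟨j, i, m', rfl, hm'⟩ := exists_eq_add_of_weight h
    obtain ⟨x, hx, hx'⟩ := ih m' hm'
    refine ⟨gen B F G j i * x, ?_, ?_⟩
    · rw [MulMemClass.coe_mul, hx, coe_gen, ← map_mul, monomial_add_eq]
    · have hw := weight_scrollWeight_le hm'
      rw [map_mul, hx', map_gen π hπ, mul_comm, normalForm_mul π hπ (by linarith) (by omega)]
      congr 1
      simp only [map_add, Finsupp.weight_single, scrollWeight, Sum.elim_inl, Sum.elim_inr,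
        smul_eq_mul, one_mul]
      ring

/-- The linear extension of the normal form to all polynomials. -/
def normalFormMap (n : ℕ) : MvPolynomial (Fin 2 ⊕ Fin (r + 1)) B →ₗ[B] Q :=
  (basisMonomials (Fin 2 ⊕ Fin (r + 1)) B).constr B
    fun m => normalForm π n (Finsupp.weight scrollWeight m)

theorem normalFormMap_monomial (n : ℕ) (m : Fin 2 ⊕ Fin (r + 1) →₀ ℕ) (b : B) :
    normalFormMap π n (monomial m b) =
      b • normalForm π n (Finsupp.weight scrollWeight m) := by
  have h : (monomial m b : MvPolynomial (Fin 2 ⊕ Fin (r + 1)) B) =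
      b • basisMonomials (Fin 2 ⊕ Fin (r + 1)) B m := by
    rw [coe_basisMonomials, smul_monomial, smul_eq_mul, mul_one]
  rw [h, map_smul, normalFormMap, Module.Basis.constr_basis]

include hπ in
-- `normalFormMap` is linear on polynomials and ignores the equation, yet it computes π on classes.
-- Applied to a multiple of the equation it therefore yields a linear relation among normal forms.
theorem map_eq_normalFormMap {n : ℕ} {p : MvPolynomial (Fin 2 ⊕ Fin (r + 1)) B}
    (hp : p ∈ bihom B (n + 1) (n + 1)) {x : subring B F G}
    (hx : (x : Hypersurface B F G) = proj B F G p) : π x = normalFormMap π n p := by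
  have key : ∃ y : subring B F G, (y : Hypersurface B F G) = proj B F G p ∧
      π y = normalFormMap π n p := by
    refine mem_bihom_induction B (a := n + 1) (b := n + 1) (motive := fun p =>
      ∃ y : subring B F G, (y : Hypersurface B F G) = proj B F G p ∧
        π y = normalFormMap π n p) ?_ ?_ ?_ hp
    · exact ⟨0, by simp, by simp⟩
    · rintro p q ⟨y, hy, hy'⟩ ⟨z, hz, hz'⟩
      exact ⟨y + z, by simp [hy, hz], by simp [hy', hz']⟩
    · intro m b h
      obtain ⟨y, hy, hy'⟩ := exists_map_eq_normalForm π hπ n m h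
      have hb : (monomial m b : MvPolynomial (Fin 2 ⊕ Fin (r + 1)) B) = b • monomial m 1 := by
        rw [smul_monomial, smul_eq_mul, mul_one]
      refine ⟨b • y, ?_, ?_⟩
      · rw [hb, map_smul, Subalgebra.coe_smul, hy]
      · rw [map_smul, hy', normalFormMap_monomial]
  obtain ⟨y, hy, hy'⟩ := key
  rw [← hy', Subtype.ext (hx.trans hy.symm)]

theorem lift_eq_sum (H : MvPolynomial (Fin (r + 1)) ℤ) : lift B H =
    ∑ m ∈ H.support, monomial (Finsupp.mapDomain Sum.inr m) ((H.coeff m : ℤ) : B) := by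
  conv_lhs => rw [lift, H.as_sum]
  simp only [map_sum, map_monomial, rename_monomial, eq_intCast]

theorem normalFormMap_mul_lift (n a b : ℕ) (H : MvPolynomial (Fin (r + 1)) ℤ) :
    normalFormMap π n (X (Sum.inl 0) ^ a * X (Sum.inl 1) ^ b * lift B H) =
      ∑ m ∈ H.support, ((H.coeff m : ℤ) : B) •
        normalForm π n (b + Finsupp.weight (fun i : Fin (r + 1) => (i : ℕ)) m) := by
  rw [lift_eq_sum, Finset.mul_sum, map_sum]
  refine Finset.sum_congr rfl fun m _ => ?_
  rw [X_pow_eq_monomial, X_pow_eq_monomial, monomial_mul, monomial_mul, one_mul, one_mul,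
    normalFormMap_monomial]
  congr 2
  rw [map_add, map_add, Finsupp.weight_single, Finsupp.weight_single, Finsupp.weight_apply,
    Finsupp.sum_mapDomain_index (by simp) (by intros; rw [add_smul]), Finsupp.weight_apply]
  simp [scrollWeight]

/-- Among the monomials of degree d in the Xᵢ, the power of the last variable is the only one of
maximal weight r·d. -/
theorem weight_lt_of_ne {d : ℕ} {m : Fin (r + 1) →₀ ℕ} (hm : m.degree = d)
    (h : m ≠ Finsupp.single (Fin.last r) d) :
    Finsupp.weight (fun i : Fin (r + 1) => (i : ℕ)) m < r * d := by
  rw [Finsupp.weight_apply, Finsupp.sum_fintype _ _ (by simp)]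
  rw [Finsupp.degree_eq_sum] at hm
  rw [← hm, Finset.mul_sum]
  have hle : ∀ i ∈ Finset.univ, m i • (i : ℕ) ≤ r * m i := fun i _ => by
    rw [smul_eq_mul, mul_comm]
    exact Nat.mul_le_mul_right _ (by omega)
  refine Finset.sum_lt_sum hle ?_
  by_contra! hc
  apply h
  have h0 : ∀ i, i ≠ Fin.last r → m i = 0 := by
    intro i hi
    have h1 := hc i (Finset.mem_univ i)
    have h2 : (i : ℕ) < r := by
      have := Fin.val_lt_last hi
      exact this
    rw [smul_eq_mul, mul_comm] at h1
    by_contra h3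
    exact absurd (Nat.le_of_mul_le_mul_right ((mul_comm _ _).trans_le (h1.trans_eq (mul_comm _ _)))
      (Nat.pos_of_ne_zero h3)) (by omega)
  ext i
  rw [Finsupp.single_apply]
  split_ifs with hi
  · subst hi
    rw [← hm, Finset.sum_eq_single (Fin.last r) (fun i _ hi => h0 i hi) (by simp)]
  · exact h0 i (Ne.symm hi)

variable {d : ℕ} (hF : F.IsHomogeneous d) (hG : G.IsHomogeneous d)
  (hF1 : F.coeff (Finsupp.single (Fin.last r) d) = 0)
  (hG1 : G.coeff (Finsupp.single (Fin.last r) d) = 1) (hd : 1 ≤ d)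

include hπ hF hG hF1 hG1 hd

/-- The multiple s^{d-1-b}·tᵇ of the equation lies in bidegree (d, d) and maps to zero. Its term
t^{b+1}X_kᵈ has weight r·d + b + 1 and coefficient −1, and all its other terms have smaller weight.
-/
theorem normalForm_mem_span_lt {b : ℕ} (hb : b < d) :
    normalForm π (d - 1) (r * d + (b + 1)) ∈
      Submodule.span B (normalForm π (d - 1) '' Set.Iio (r * d + (b + 1))) := by
  set N := Submodule.span B (normalForm π (d - 1) '' Set.Iio (r * d + (b + 1))) with hN
  obtain ⟨e, rfl⟩ : ∃ e, d = e + 1 := ⟨d - 1, by omega⟩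
  rw [Nat.add_sub_cancel] at hN ⊢
  have hp : X (Sum.inl 0) ^ (e - b) * X (Sum.inl 1) ^ b * equation B F G ∈
      bihom B (e + 1) (e + 1) := by
    have h1 := (((isWeightedHomogeneous_X B (bideg (k := r + 1)) (Sum.inl 0)).pow (e - b)).mul
      ((isWeightedHomogeneous_X B (bideg (k := r + 1)) (Sum.inl 1)).pow b)).mul
      (equation_mem_bihom B F G hF hG)
    have h2 : (e - b) • bideg (k := r + 1) (Sum.inl 0) + b • bideg (k := r + 1) (Sum.inl 1) +
        (1, e + 1) = (e + 1, e + 1) := by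
      simp [bideg]
      omega
    rwa [h2] at h1
  have h0 := map_eq_normalFormMap π hπ hp (x := 0) (by
    rw [map_mul, proj_equation, mul_zero]; rfl)
  have hsplit : X (Sum.inl 0) ^ (e - b) * X (Sum.inl 1) ^ b * equation B F G =
      X (Sum.inl 0) ^ (e - b + 1) * X (Sum.inl 1) ^ b * lift B F -
      X (Sum.inl 0) ^ (e - b) * X (Sum.inl 1) ^ (b + 1) * lift B G := by
    rw [equation]; ring
  rw [map_zero, hsplit, map_sub, normalFormMap_mul_lift, normalFormMap_mul_lift] at h0
  have hmem : Finsupp.single (Fin.last r) (e + 1) ∈ G.support := by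
    rw [mem_support_iff, hG1]; exact one_ne_zero
  -- The pure power in G is isolated and the relation is solved for its normal form.
  rw [← Finset.add_sum_erase _ _ hmem, hG1, Finsupp.weight_single, smul_eq_mul, Fin.val_last,
    Int.cast_one, one_smul, eq_comm, sub_eq_zero, eq_comm, ← eq_sub_iff_add_eq] at h0
  have hdeg : ∀ {H : MvPolynomial (Fin (r + 1)) ℤ}, H.IsHomogeneous (e + 1) → ∀ m ∈ H.support,
      m.degree = e + 1 := by
    intro H hH m hm
    have := hH (mem_support_iff.1 hm)
    rwa [Pi.one_def, ← Finsupp.degree_eq_weight_one] at this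
  rw [show r * (e + 1) + (b + 1) = b + 1 + (e + 1) * r by ring, h0]
  refine sub_mem (Submodule.sum_mem _ fun m hm => Submodule.smul_mem _ _
    (Submodule.subset_span ⟨_, ?_, rfl⟩)) (Submodule.sum_mem _ fun m hm => Submodule.smul_mem _ _
    (Submodule.subset_span ⟨_, ?_, rfl⟩))
  · have := weight_lt_of_ne (hdeg hF m hm) (by
      rintro rfl; exact mem_support_iff.1 hm hF1)
    rw [Set.mem_Iio]
    omega
  · rw [Finset.mem_erase] at hm
    have := weight_lt_of_ne (hdeg hG m hm.2) hm.1
    rw [Set.mem_Iio]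
    omega

/-- Descending rewriting in degree d: every weight above r·d is lowered until it is at most r·d. -/
theorem normalForm_mem_span {w : ℕ} (hw : w ≤ (r + 1) * d) :
    normalForm π (d - 1) w ∈ Submodule.span B (normalForm π (d - 1) '' Set.Iic (r * d)) := by
  induction w using Nat.strong_induction_on with
  | _ w ih =>
    by_cases h : w ≤ r * d
    · exact Submodule.subset_span ⟨w, h, rfl⟩
    · obtain ⟨b, rfl⟩ : ∃ b, w = r * d + (b + 1) := ⟨w - r * d - 1, by omega⟩
      have hb : b < d := by
        rw [add_mul, one_mul] at hw
        omega
      refine Submodule.span_le.2 ?_ (normalForm_mem_span_lt π hπ hF hG hF1 hG1 hd hb)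
      rintro _ ⟨w', hw', rfl⟩
      exact ih w' hw' (le_trans (le_of_lt hw') hw)

/-- In degree d + 1 a nontrivial normal form contains the factor `scroll π (r + 1) ^ d`. That factor
is a combination of normal forms of smaller weight, so strong induction on the weight kills the
product. -/
theorem normalForm_eq_zero {w : ℕ} (hw : w ≤ (r + 1) * (d + 1)) : normalForm π d w = 0 := by
  induction w using Nat.strong_induction_on with
  | _ w ih =>
    by_cases h : w ≤ (r + 1) * d
    · rw [normalForm, if_pos h]
    obtain ⟨j, hj⟩ : ∃ j, w = (r + 1) * d + j := ⟨w - (r + 1) * d, by omega⟩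
    have hj' : j ≤ r + 1 := by
      rw [mul_add] at hw
      omega
    have hd1 : d - 1 + 1 = d := by omega
    have h1 : normalForm π d w = normalForm π (d - 1) ((r + 1) * d) * scroll π j := by
      rw [normalForm_mul π hπ (by rw [hd1]) hj', hd1, hj]
    have h2 := normalForm_mem_span_lt π hπ hF hG hF1 hG1 hd (b := d - 1) (by omega)
    have h3 : r * d + (d - 1 + 1) = (r + 1) * d := by rw [hd1]; ring
    rw [h3] at h2
    rw [h1]
    have h4 : ∀ y ∈ Submodule.span B (normalForm π (d - 1) '' Set.Iio ((r + 1) * d)),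
        y * scroll π j = 0 := by
      intro y hy
      induction hy using Submodule.span_induction with
      | mem y hy =>
        obtain ⟨w', hw', rfl⟩ := hy
        rw [Set.mem_Iio] at hw'
        rw [normalForm_mul π hπ (by rw [hd1]; exact hw'.le) hj', hd1]
        exact ih _ (by omega) (by omega)
      | zero => exact zero_mul _
      | add a b _ _ ha hb => rw [add_mul, ha, hb, add_zero]
      | smul c a _ ha => rw [Algebra.smul_mul_assoc, ha, smul_zero]
    exact h4 _ h2

end Straightening

/-! ### Module generators of the quotient by the parameters -/

section Generators

/-- The index set of the module generators of the subring over the parameters. -/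
abbrev GenIndex (r d : ℕ) : Type := Unit ⊕ ((Fin (d - 1) × Fin (r + 1)) ⊕ Fin (r + 1 - d))

/-- The degrees of the module generators. -/
def genDegree (r d : ℕ) : GenIndex r d → ℕ :=
  Sum.elim (fun _ => 0) (Sum.elim (fun nj => nj.1 + 1) fun _ => d)

variable {r : ℕ} (B : Type*) [CommRing B] (F G : MvPolynomial (Fin (r + 1)) ℤ)

/-- The module generators `1`, `t xⱼ (t x_k)ⁿ` of the subring over the parameters. -/
def moduleGen (d : ℕ) : GenIndex r d → subring B F G :=
  Sum.elim (fun _ => 1) (Sum.elim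
    (fun nj => gen B F G 1 nj.2 * gen B F G 1 (Fin.last r) ^ (nj.1 : ℕ))
    fun j => gen B F G 1 (Fin.castLE (Nat.sub_le _ _) j) * gen B F G 1 (Fin.last r) ^ (d - 1))

theorem moduleGen_mem_grading {d : ℕ} (hd : 1 ≤ d) (a : GenIndex r d) :
    moduleGen B F G d a ∈ grading B F G (genDegree r d a) := by
  have h : ∀ (j : Fin (r + 1)) (n : ℕ),
      gen B F G 1 j * gen B F G 1 (Fin.last r) ^ n ∈ grading B F G (n + 1) := by
    intro j n
    have := SetLike.mul_mem_graded (gen_mem_grading B F G 1 j)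
      (SetLike.pow_mem_graded n (gen_mem_grading B F G 1 (Fin.last r)))
    rwa [smul_eq_mul, mul_one, Nat.add_comm 1 n] at this
  rcases a with a | ⟨n, j⟩ | j
  · exact SetLike.one_mem_graded _
  · exact h j n
  · have := h (Fin.castLE (Nat.sub_le _ _) j) (d - 1)
    rwa [Nat.sub_add_cancel hd] at this

variable {B F G} {Q : Type*} [CommRing Q] [Algebra B Q] (π : subring B F G →ₐ[B] Q)
  (hπ : ∀ i, π (parameters B F G i) = 0)
  {d : ℕ} (hF : F.IsHomogeneous d) (hG : G.IsHomogeneous d)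
  (hF1 : F.coeff (Finsupp.single (Fin.last r) d) = 0)
  (hG1 : G.coeff (Finsupp.single (Fin.last r) d) = 1) (hd : 1 ≤ d)

include hπ hF hG hF1 hG1 hd

/-- Modulo the parameters the subring is spanned by the module generators. -/
theorem map_mem_span_moduleGen {n : ℕ} {x : subring B F G} (hx : x ∈ grading B F G n) :
    π x ∈ Submodule.span B ((fun a => π (moduleGen B F G d a)) '' {a | genDegree r d a = n}) := by
  set N := Submodule.span B ((fun a => π (moduleGen B F G d a)) '' {a | genDegree r d a = n})
    with hN
  cases n with
  | zero =>
    rw [grading, pow_zero, Submodule.mem_one] at hx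
    obtain ⟨b, rfl⟩ := hx
    rw [AlgHom.commutes, Algebra.algebraMap_eq_smul_one]
    refine Submodule.smul_mem _ _ (Submodule.subset_span ⟨Sum.inl (), rfl, ?_⟩)
    exact map_one π
  | succ n =>
    have key : ∀ w ≤ (r + 1) * (n + 1), normalForm π n w ∈ N := by
      have hsc : ∀ (j n : ℕ), 1 ≤ j → (hj : j - 1 < r + 1) →
          scroll π j * scroll π (r + 1) ^ n =
            π (gen B F G 1 ⟨j - 1, hj⟩ * gen B F G 1 (Fin.last r) ^ n) := by
        intro j n h1 hj
        rw [map_mul, map_pow, ← scroll_succ, ← scroll_succ]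
        simp [Nat.sub_add_cancel h1]
      intro w hw
      rw [mul_add, mul_one] at hw
      rcases Nat.lt_trichotomy (n + 1) d with h | h | h
      · rw [normalForm]
        split_ifs with hw0
        · exact zero_mem _
        · rw [hsc _ _ (by omega) (by omega)]
          exact Submodule.subset_span ⟨Sum.inr (Sum.inl (⟨n, by omega⟩, ⟨_, _⟩)), rfl, rfl⟩
      -- In degree d only weights w' ≤ r·d survive, so the free subscript w' − (r+1)(d−1) is at most
      -- r + 1 − d. This is the range of the last family of generators, which is empty when d ≥ r +
      -- 1.
      · subst h
        have h1 := normalForm_mem_span π hπ hF hG hF1 hG1 hd (w := w) (by linarith)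
        rw [Nat.add_sub_cancel] at h1
        refine Submodule.span_le.2 ?_ h1
        rintro _ ⟨w', hw', rfl⟩
        rw [Set.mem_Iic] at hw'
        rw [SetLike.mem_coe, normalForm]
        split_ifs with hw0
        · exact zero_mem _
        · have h2 : w' - (r + 1) * n - 1 < r + 1 - (n + 1) := by
            have h3 : r * (n + 1) = r * n + r := by ring
            have h4 : (r + 1) * n = r * n + n := by ring
            omega
          rw [hsc _ _ (by omega) (by omega)]
          exact Submodule.subset_span
            ⟨Sum.inr (Sum.inr ⟨w' - (r + 1) * n - 1, h2⟩), rfl, rfl⟩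
      · have h1 : normalForm π n w = 0 := by
          rw [normalForm]
          split_ifs with hw0
          · rfl
          · have h2 := normalForm_eq_zero π hπ hF hG hF1 hG1 hd
              (w := (r + 1) * d + (w - (r + 1) * n)) (by rw [mul_add, mul_one]; omega)
            rw [normalForm, if_neg (by omega), Nat.add_sub_cancel_left] at h2
            rw [show scroll π (r + 1) ^ n = scroll π (r + 1) ^ d * scroll π (r + 1) ^ (n - d) by
              rw [← pow_add]; congr 1; omega, ← mul_assoc, h2, zero_mul]
        rw [h1]
        exact zero_mem _
    obtain ⟨p, hp, hpx⟩ := exists_bihom_of_mem_grading B F G hx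
    rw [map_eq_normalFormMap π hπ hp hpx.symm]
    refine mem_bihom_induction B (a := n + 1) (b := n + 1)
      (motive := fun p => normalFormMap π n p ∈ N) ?_ ?_ ?_ hp
    · rw [map_zero]; exact zero_mem _
    · intro p q hp hq
      rw [map_add]; exact add_mem hp hq
    · intro m b hm
      rw [normalFormMap_monomial]
      have := weight_scrollWeight_le hm
      exact Submodule.smul_mem _ _ (key _ (by linarith))

end Generators

/-- Forms `F`, `G` of degree `d ≥ 1` such that `G` is monic in the last variable and the
corresponding power does not occur in `F`. -/
structure IsNormalized {r : ℕ} (d : ℕ) (F G : MvPolynomial (Fin (r + 1)) ℤ) : Prop where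
  left : F.IsHomogeneous d
  right : G.IsHomogeneous d
  coeff_left : F.coeff (Finsupp.single (Fin.last r) d) = 0
  coeff_right : G.coeff (Finsupp.single (Fin.last r) d) = 1
  pos : 1 ≤ d

/-! ### Graded Nakayama: finiteness over the parameters -/

section Nakayama

variable {r : ℕ} (K : Type*) [Field K] (F G : MvPolynomial (Fin (r + 1)) ℤ) (d : ℕ)

/-- The polynomial ring in the parameters acting on the subring. -/
def paramHom : MvPolynomial (Fin (r + 1)) K →ₐ[K] subring K F G := aeval (parameters K F G)

theorem paramHom_X (i : Fin (r + 1)) : paramHom K F G (X i) = parameters K F G i := aeval_X _ _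

theorem parameters_mem_grading (i : Fin (r + 1)) : parameters K F G i ∈ grading K F G 1 := by
  rw [parameters]
  refine sub_mem (gen_mem_grading _ _ _ _ _) ?_
  split_ifs
  · exact gen_mem_grading _ _ _ _ _
  · exact zero_mem _

theorem paramHom_mem_grading {n : ℕ} {p : MvPolynomial (Fin (r + 1)) K} (hp : p.IsHomogeneous n) :
    paramHom K F G p ∈ grading K F G n := by
  rw [p.as_sum, map_sum]
  refine Submodule.sum_mem _ fun m hm => ?_
  rw [paramHom, aeval_monomial, ← Algebra.smul_def]
  refine Submodule.smul_mem _ _ ?_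
  have h1 := hp (mem_support_iff.1 hm)
  rw [Pi.one_def, ← Finsupp.degree_eq_weight_one, Finsupp.degree_eq_sum] at h1
  rw [Finsupp.prod_fintype _ _ (by simp), ← h1]
  have h2 := SetLike.prod_mem_graded (A := grading K F G) (F := Finset.univ) (fun i => m i)
    (fun i => parameters K F G i ^ m i) (fun i _ => by
      simpa using SetLike.pow_mem_graded (m i) (parameters_mem_grading K F G i))
  exact h2

theorem decompose_paramHom (p : MvPolynomial (Fin (r + 1)) K) (n : ℕ) :
    (DirectSum.decompose (grading K F G) (paramHom K F G p) n : subring K F G) =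
      paramHom K F G (homogeneousComponent n p) := by
  conv_lhs => rw [← sum_homogeneousComponent p, map_sum, DirectSum.decompose_sum,
    DFinsupp.finsetSum_apply, AddSubmonoidClass.coe_finsetSum]
  have h : ∀ j, (DirectSum.decompose (grading K F G)
      (paramHom K F G (homogeneousComponent j p)) n : subring K F G) =
      if j = n then paramHom K F G (homogeneousComponent n p) else 0 := by
    intro j
    have hj := paramHom_mem_grading K F G (homogeneousComponent_isHomogeneous j p)
    split_ifs with h
    · subst h; exact DirectSum.decompose_of_mem_same _ hj
    · exact DirectSum.decompose_of_mem_ne _ hj h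
  simp only [h, Finset.sum_ite_eq', Finset.mem_range]
  split_ifs with h0
  · rfl
  · rw [homogeneousComponent_eq_zero _ _ (by omega), map_zero]

/-- Combinations of the module generators with coefficients polynomials in the parameters. -/
def paramMap : (GenIndex r d → MvPolynomial (Fin (r + 1)) K) →ₗ[K] subring K F G :=
  ∑ a, (LinearMap.mulRight K (moduleGen K F G d a)).comp
    ((paramHom K F G).toLinearMap.comp (LinearMap.proj a))

theorem paramMap_apply (v : GenIndex r d → MvPolynomial (Fin (r + 1)) K) :
    paramMap K F G d v = ∑ a, paramHom K F G (v a) * moduleGen K F G d a := by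
  simp [paramMap]

theorem paramMap_smul (p : MvPolynomial (Fin (r + 1)) K)
    (v : GenIndex r d → MvPolynomial (Fin (r + 1)) K) :
    paramMap K F G d (fun a => p * v a) = paramHom K F G p * paramMap K F G d v := by
  simp only [paramMap_apply, Finset.mul_sum, mul_assoc, map_mul]

/-- The coefficients of the `a`-th module generator which give elements of degree `n`. -/
def coeffPiece (n : ℕ) (a : GenIndex r d) : Submodule K (MvPolynomial (Fin (r + 1)) K) :=
  if genDegree r d a ≤ n then homogeneousSubmodule (Fin (r + 1)) K (n - genDegree r d a) else ⊥

theorem coeffPiece_of_le {n : ℕ} {a : GenIndex r d} (h : genDegree r d a ≤ n) :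
    coeffPiece K d n a = homogeneousSubmodule (Fin (r + 1)) K (n - genDegree r d a) := if_pos h

theorem coeffPiece_of_not_le {n : ℕ} {a : GenIndex r d} (h : ¬ genDegree r d a ≤ n) :
    coeffPiece K d n a = ⊥ := if_neg h

/-- The families of coefficients which give elements of degree `n`. -/
def coeffPieces (n : ℕ) : Submodule K (GenIndex r d → MvPolynomial (Fin (r + 1)) K) :=
  Submodule.pi Set.univ (coeffPiece K d n)

variable {F G d} (h : IsNormalized d F G)

include h

/-- The spanning result lifted to R. The correction stays in degree n, so the remainder is a
homogeneous element of the parameter ideal, as the induction on the degree requires. -/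
theorem exists_span_moduleGen_add {n : ℕ} {x : subring K F G} (hx : x ∈ grading K F G n) :
    ∃ y ∈ Submodule.span K (moduleGen K F G d '' {a | genDegree r d a = n}),
      x - y ∈ Ideal.span (Set.range (parameters K F G)) ∧ x - y ∈ grading K F G n := by
  set I := Ideal.span (Set.range (parameters K F G))
  have hπ : ∀ i, Ideal.Quotient.mkₐ K I (parameters K F G i) = 0 := fun i => by
    rw [Ideal.Quotient.mkₐ_eq_mk, Ideal.Quotient.eq_zero_iff_mem]
    exact Ideal.subset_span ⟨i, rfl⟩
  have h1 := map_mem_span_moduleGen (B := K) (Q := subring K F G ⧸ I)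
    (Ideal.Quotient.mkₐ K I) hπ h.left h.right h.coeff_left h.coeff_right h.pos hx
  have h2 : ((fun a => Ideal.Quotient.mkₐ K I (moduleGen K F G d a)) ''
      {a | genDegree r d a = n}) = (Ideal.Quotient.mkₐ K I).toLinearMap ''
        (moduleGen K F G d '' {a | genDegree r d a = n}) := by
    rw [Set.image_image]
    simp only [AlgHom.toLinearMap_apply]
  rw [h2, ← Submodule.map_span, Submodule.mem_map] at h1
  obtain ⟨y, hy, hyx⟩ := h1
  rw [AlgHom.toLinearMap_apply, Ideal.Quotient.mkₐ_eq_mk] at hyx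
  refine ⟨y, hy, Ideal.Quotient.eq.1 hyx.symm, sub_mem hx ?_⟩
  refine Submodule.span_le.2 ?_ hy
  rintro _ ⟨a, rfl, rfl⟩
  exact moduleGen_mem_grading K F G h.pos a

omit h in
-- In an arbitrary representation by the parameters, the coefficients may be replaced by their
-- components of degree n, since the parameters have degree one.
theorem exists_eq_sum_parameters {n : ℕ} {x : subring K F G} (hx : x ∈ grading K F G (n + 1))
    (hI : x ∈ Ideal.span (Set.range (parameters K F G))) :
    ∃ y : Fin (r + 1) → subring K F G, (∀ i, y i ∈ grading K F G n) ∧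
      x = ∑ i, parameters K F G i * y i := by
  obtain ⟨c, hc⟩ := (Ideal.mem_span_range_iff_exists_fun).1 hI
  refine ⟨fun i => DirectSum.decompose (grading K F G) (c i) n, fun i => SetLike.coe_mem _, ?_⟩
  have h1 : (DirectSum.decompose (grading K F G) x (n + 1) : subring K F G) = x :=
    DirectSum.decompose_of_mem_same _ hx
  rw [← h1]
  conv_lhs => rw [← hc, DirectSum.decompose_sum, DFinsupp.finsetSum_apply,
    AddSubmonoidClass.coe_finsetSum]
  refine Finset.sum_congr rfl fun i _ => ?_
  rw [mul_comm, DirectSum.coe_decompose_mul_of_left_mem_of_le (grading K F G)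
    (parameters_mem_grading K F G i) (by omega), Nat.add_sub_cancel]

omit h in
theorem eq_zero_of_mem_grading_zero {x : subring K F G} (hx : x ∈ grading K F G 0)
    (hI : x ∈ Ideal.span (Set.range (parameters K F G))) : x = 0 := by
  obtain ⟨c, hc⟩ := (Ideal.mem_span_range_iff_exists_fun).1 hI
  have h1 : (DirectSum.decompose (grading K F G) x 0 : subring K F G) = x :=
    DirectSum.decompose_of_mem_same _ hx
  rw [← h1, ← hc, DirectSum.decompose_sum, DFinsupp.finsetSum_apply,
    AddSubmonoidClass.coe_finsetSum]
  refine Finset.sum_eq_zero fun i _ => ?_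
  rw [mul_comm, DirectSum.coe_decompose_mul_of_left_mem_of_not_le (grading K F G)
    (parameters_mem_grading K F G i) (by omega)]

omit h in
theorem mem_map_coeffPieces_of_mem_span {n : ℕ} {y : subring K F G}
    (hy : y ∈ Submodule.span K (moduleGen K F G d '' {a | genDegree r d a = n})) :
    y ∈ (coeffPieces K d n).map (paramMap K F G d) := by
  classical
  refine Submodule.span_le.2 ?_ hy
  rintro _ ⟨a, rfl, rfl⟩
  refine ⟨Pi.single a 1, ?_, ?_⟩
  · intro b _
    change _ ∈ coeffPiece K d _ b
    by_cases hb : b = a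
    · subst hb
      rw [Pi.single_eq_same, coeffPiece_of_le K d le_rfl, Nat.sub_self]
      exact isHomogeneous_one _ _
    · rw [Pi.single_eq_of_ne hb]
      exact zero_mem _
  · rw [paramMap_apply, Finset.sum_eq_single a]
    · simp
    · intro b _ hb
      simp [Pi.single_eq_of_ne hb]
    · simp

/-- The subring is generated as a module over the parameters by the module generators. -/
theorem grading_le_map_paramMap (n : ℕ) :
    grading K F G n ≤ (coeffPieces K d n).map (paramMap K F G d) := by
  induction n with
  | zero =>
    intro x hx
    obtain ⟨y, hy, h1, h2⟩ := exists_span_moduleGen_add K h hx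
    have h3 := eq_zero_of_mem_grading_zero K h2 h1
    rw [sub_eq_zero] at h3
    rw [h3]
    exact mem_map_coeffPieces_of_mem_span K hy
  | succ n ih =>
    intro x hx
    obtain ⟨y, hy, h1, h2⟩ := exists_span_moduleGen_add K h hx
    obtain ⟨z, hz, hz'⟩ := exists_eq_sum_parameters K h2 h1
    rw [show x = y + (x - y) by ring, hz']
    refine add_mem (mem_map_coeffPieces_of_mem_span K hy) (Submodule.sum_mem _ fun i _ => ?_)
    obtain ⟨v, hv, hv'⟩ := ih (hz i)
    refine ⟨fun a => X i * v a, fun a _ => ?_, ?_⟩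
    · have h3 : v a ∈ coeffPiece K d n a := hv a trivial
      change X i * v a ∈ coeffPiece K d (n + 1) a
      by_cases h4 : genDegree r d a ≤ n
      · rw [coeffPiece_of_le K d h4] at h3
        rw [coeffPiece_of_le K d (by omega), show n + 1 - genDegree r d a = 1 + (n - genDegree r d a) by omega]
        exact (isHomogeneous_X K i).mul h3
      · rw [coeffPiece_of_not_le K d h4] at h3
        rw [(Submodule.mem_bot K).1 h3, mul_zero]
        exact zero_mem _
    · rw [paramMap_smul, paramHom_X, hv']

theorem paramMap_surjective : Function.Surjective (paramMap K F G d) := by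
  rw [← LinearMap.range_eq_top, eq_top_iff, ← iSup_grading K F G]
  refine iSup_le fun n => (grading_le_map_paramMap K h n).trans ?_
  exact LinearMap.map_le_range

/-- The elements of degree `> d` lie in the ideal generated by the parameters. -/
theorem mem_span_parameters_of_lt {n : ℕ} (hn : d < n) {x : subring K F G}
    (hx : x ∈ grading K F G n) : x ∈ Ideal.span (Set.range (parameters K F G)) := by
  obtain ⟨y, hy, h1, -⟩ := exists_span_moduleGen_add K h hx
  have h2 : {a | genDegree r d a = n} = ∅ := by
    rw [Set.eq_empty_iff_forall_notMem]
    rintro (a | ⟨j, i⟩ | j) ha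
    · simp [genDegree] at ha; omega
    · simp [genDegree] at ha; omega
    · simp [genDegree] at ha; omega
  rw [h2, Set.image_empty, Submodule.span_empty, Submodule.mem_bot] at hy
  rwa [hy, sub_zero] at h1

/-- The subring is finite over the polynomial ring in the parameters. -/
theorem finite_paramHom : (paramHom K F G).toRingHom.Finite := by
  classical
  let _ := (paramHom K F G).toRingHom.toAlgebra
  refine ⟨⟨Finset.univ.image (moduleGen K F G d), ?_⟩⟩
  rw [eq_top_iff]
  rintro x -
  obtain ⟨v, rfl⟩ := paramMap_surjective K h x
  rw [paramMap_apply]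
  refine Submodule.sum_mem _ fun a _ => ?_
  exact Submodule.smul_mem _ (v a) (Submodule.subset_span (by simp))

end Nakayama

/-! ### Homomorphisms out of the subring and the irrelevant ideal -/

section Homs

variable {k : ℕ} {B C : Type*} [CommRing B] [CommRing C] [Algebra B C]
variable (F G : MvPolynomial (Fin k) ℤ)

/-- Evaluation of integer polynomials. -/
def evalInt (f : Fin k → C) : MvPolynomial (Fin k) ℤ →+* C := eval₂Hom (Int.castRingHom C) f

@[simp]
theorem evalInt_X (f : Fin k → C) (i : Fin k) : evalInt f (X i) = f i := eval₂Hom_X' _ _ _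

theorem map_evalInt {C' : Type*} [CommRing C'] (g : C →+* C') (f : Fin k → C)
    (H : MvPolynomial (Fin k) ℤ) : g (evalInt f H) = evalInt (fun i => g (f i)) H := by
  have : g.comp (evalInt f) = evalInt (fun i => g (f i)) := by
    apply MvPolynomial.ringHom_ext
    · intro n; simp
    · intro i; simp
  exact DFunLike.congr_fun this H

theorem aeval_lift (f : Fin 2 ⊕ Fin k → C) (H : MvPolynomial (Fin k) ℤ) :
    aeval f (lift B H) = evalInt (fun i => f (Sum.inr i)) H := by
  have : ((aeval (R := B) f : MvPolynomial _ B →ₐ[B] C).toRingHom.comp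
      (rename Sum.inr : MvPolynomial (Fin k) B →ₐ[B] MvPolynomial (Fin 2 ⊕ Fin k) B).toRingHom).comp
        (map (Int.castRingHom B)) = evalInt (fun i => f (Sum.inr i)) := by
    apply MvPolynomial.ringHom_ext
    · intro n; simp
    · intro i; simp
  exact DFunLike.congr_fun this H

theorem aeval_equation (f : Fin 2 ⊕ Fin k → C) : aeval f (equation B F G) =
    f (Sum.inl 0) * evalInt (fun i => f (Sum.inr i)) F -
      f (Sum.inl 1) * evalInt (fun i => f (Sum.inr i)) G := by
  rw [equation, map_sub, map_mul, map_mul, aeval_lift, aeval_lift, aeval_X, aeval_X]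

theorem aeval_eq_zero_of_mem {f : Fin 2 ⊕ Fin k → C}
    (hf : f (Sum.inl 0) * evalInt (fun i => f (Sum.inr i)) F =
      f (Sum.inl 1) * evalInt (fun i => f (Sum.inr i)) G) :
    ∀ a ∈ Ideal.span {equation B F G}, aeval f a = 0 := by
  suffices h : Ideal.span {equation B F G} ≤ RingHom.ker (aeval (R := B) f) from fun a ha => h ha
  rw [Ideal.span_le, Set.singleton_subset_iff, SetLike.mem_coe, RingHom.mem_ker, aeval_equation,
    hf, sub_self]

/-- Homomorphisms out of the subring obtained by evaluating the variables. -/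
def evalHom (f : Fin 2 ⊕ Fin k → C)
    (hf : f (Sum.inl 0) * evalInt (fun i => f (Sum.inr i)) F =
      f (Sum.inl 1) * evalInt (fun i => f (Sum.inr i)) G) : subring B F G →ₐ[B] C :=
  (Ideal.Quotient.liftₐ (Ideal.span {equation B F G}) (aeval f)
    (aeval_eq_zero_of_mem F G hf)).comp (subring B F G).val

theorem evalHom_gen (f : Fin 2 ⊕ Fin k → C)
    (hf : f (Sum.inl 0) * evalInt (fun i => f (Sum.inr i)) F =
      f (Sum.inl 1) * evalInt (fun i => f (Sum.inr i)) G) (j : Fin 2) (i : Fin k) :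
    evalHom (B := B) F G f hf (gen B F G j i) = f (Sum.inl j) * f (Sum.inr i) := by
  have h : ∀ l, Ideal.Quotient.liftₐ (Ideal.span {equation B F G}) (aeval f)
      (aeval_eq_zero_of_mem F G hf) (var B F G l) = f l := fun l => aeval_X (R := B) f l
  rw [evalHom, AlgHom.comp_apply, gen, Subalgebra.coe_val, map_mul, h, h]

theorem algHom_ext_gen {φ ψ : subring B F G →ₐ[B] C}
    (h : ∀ j i, φ (gen B F G j i) = ψ (gen B F G j i)) : φ = ψ := by
  refine AlgHom.adjoin_ext ?_
  rintro _ ⟨⟨j, i⟩, rfl⟩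
  exact h j i

theorem map_eq_zero_of_mem_grading {φ : subring B F G →ₐ[B] C}
    (h : ∀ j i, φ (gen B F G j i) = 0) {n : ℕ} (hn : n ≠ 0) {x : subring B F G}
    (hx : x ∈ grading B F G n) : φ x = 0 := by
  obtain ⟨n, rfl⟩ := Nat.exists_eq_succ_of_ne_zero hn
  have h1 : ∀ g ∈ Submodule.span B (Set.range fun ji : Fin 2 × Fin k => gen B F G ji.1 ji.2),
      φ g = 0 := by
    intro g hg
    induction hg using Submodule.span_induction with
    | mem g h' => obtain ⟨⟨j, i⟩, rfl⟩ := h'; exact h j i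
    | zero => exact map_zero φ
    | add a b _ _ ha hb => rw [map_add, ha, hb, add_zero]
    | smul c a _ ha => rw [map_smul, ha, smul_zero]
  rw [grading, pow_succ'] at hx
  induction hx using Submodule.mul_induction_on' with
  | mem_mul_mem a ha b hb => rw [map_mul, h1 a ha, zero_mul]
  | add a _ b _ ha hb => rw [map_add, ha, hb, add_zero]

theorem sum_decompose_eq [DecidableEq (subring B F G)] (x : subring B F G) :
    x = ∑ i ∈ (DirectSum.decompose (grading B F G) x).support,
      (DirectSum.decompose (grading B F G) x i : subring B F G) :=
  (DirectSum.sum_support_decompose (grading B F G) x).symm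

theorem exists_algebraMap_eq_of_mem_grading {x : subring B F G} (hx : x ∈ grading B F G 0) :
    ∃ c, algebraMap B _ c = x := by
  rwa [grading, pow_zero, Submodule.mem_one] at hx

variable (K : Type*) [Field K] [Algebra K C] [Nontrivial C]

/-- A homomorphism killing the generators sees only the degree 0 part, which consists of scalars,
and it is injective on scalars. So the irrelevant ideal is its kernel. -/
theorem mem_irrelevantIdeal_iff {φ : subring K F G →ₐ[K] C}
    (h : ∀ j i, φ (gen K F G j i) = 0) (x : subring K F G) :
    x ∈ irrelevantIdeal (grading K F G) ↔ φ x = 0 := by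
  classical
  have h1 : φ x = φ (DirectSum.decompose (grading K F G) x 0) := by
    conv_lhs => rw [sum_decompose_eq F G x, map_sum]
    rw [Finset.sum_eq_single 0]
    · intro n _ hn
      exact map_eq_zero_of_mem_grading F G h hn (SetLike.coe_mem _)
    · intro h0
      rw [DFinsupp.notMem_support_iff] at h0
      rw [h0, ZeroMemClass.coe_zero, map_zero]
  obtain ⟨c, hc⟩ := exists_algebraMap_eq_of_mem_grading F G
    (SetLike.coe_mem (DirectSum.decompose (grading K F G) x 0))
  rw [irrelevantIdeal]
  change GradedRing.proj (grading K F G) 0 x = 0 ↔ _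
  rw [GradedRing.proj_apply, h1, ← hc, AlgHom.commutes]
  constructor
  · intro h0
    rw [← φ.commutes, h0, map_zero]
  · intro h0
    rw [(map_eq_zero (algebraMap K C)).1 h0, map_zero]

theorem irrelevantIdeal_isMaximal : (irrelevantIdeal (grading K F G)).IsMaximal := by
  let φ : subring K F G →ₐ[K] K := evalHom F G (fun _ => 0) (by simp)
  have h : irrelevantIdeal (grading K F G) = RingHom.ker φ := by
    ext x
    rw [mem_irrelevantIdeal_iff F G K (φ := φ) (fun j i => by rw [evalHom_gen, zero_mul]),
      RingHom.mem_ker]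
  rw [h]
  exact RingHom.ker_isMaximal_of_surjective φ fun c => ⟨algebraMap K _ c, φ.commutes c⟩

end Homs

/-! ### Krull dimension and the system of parameters -/

section Dimension

variable {r : ℕ} {F G : MvPolynomial (Fin (r + 1)) ℤ} {d : ℕ}

/-- On a coordinate axis every monomial of a form vanishes except the pure power. -/
theorem evalInt_of_eq_zero {R : Type*} [CommRing R] {k : ℕ} {i : Fin k}
    {H : MvPolynomial (Fin k) ℤ} (hH : H.IsHomogeneous d) (f : Fin k → R)
    (hf : ∀ j, j ≠ i → f j = 0) :
    evalInt f H = ((H.coeff (Finsupp.single i d) : ℤ) : R) * f i ^ d := by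
  classical
  rw [evalInt, coe_eval₂Hom, eval₂_eq']
  rw [Finset.sum_eq_single (Finsupp.single i d)]
  · rw [Finset.prod_eq_single i]
    · simp
    · intro j _ hj
      rw [Finsupp.single_eq_of_ne hj, pow_zero]
    · simp
  · intro m hm hne
    have h1 : ∃ j, j ≠ i ∧ m j ≠ 0 := by
      by_contra! hc
      apply hne
      have h2 := hH (mem_support_iff.1 hm)
      rw [Pi.one_def, ← Finsupp.degree_eq_weight_one, Finsupp.degree_eq_sum,
        Finset.sum_eq_single i (fun j _ hj => hc j hj) (by simp)] at h2
      ext j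
      rw [Finsupp.single_apply]
      split_ifs with hj
      · rw [← hj, h2]
      · exact hc j (Ne.symm hj)
    obtain ⟨j, hj, hmj⟩ := h1
    rw [Finset.prod_eq_zero (Finset.mem_univ j), mul_zero]
    rw [hf j hj, zero_pow hmj]
  · intro h0
    rw [notMem_support_iff.1 h0]
    simp

variable (F G) in
/-- The homomorphism `s ↦ G(y)`, `t ↦ F(y)`, `x ↦ y` to the polynomial ring, where
`y = (0, …, 0, X_{j+1}, …, X_k)`. -/
def graphHom (B : Type*) [CommRing B] (j : ℕ) :
    subring B F G →ₐ[B] MvPolynomial (Fin (r + 1)) B :=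
  evalHom F G (Sum.elim
    (fun l => evalInt (fun i : Fin (r + 1) => if i.val < j then 0 else X i)
      (if l = 0 then G else F))
    (fun i => if i.val < j then 0 else X i)) (by simp [mul_comm])

theorem graphHom_gen (B : Type*) [CommRing B] (j : ℕ) (l : Fin 2) (i : Fin (r + 1)) :
    graphHom F G B j (gen B F G l i) =
      evalInt (fun i : Fin (r + 1) => if i.val < j then 0 else (X i : MvPolynomial _ B))
        (if l = 0 then G else F) * (if i.val < j then 0 else X i) := evalHom_gen F G _ _ l i

/-- Each graph map factors through the earlier ones by setting more variables to zero, so the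
kernels increase with j. -/
theorem graphHom_comp (B : Type*) [CommRing B] {i j : ℕ} (hij : i ≤ j) :
    (aeval (fun i : Fin (r + 1) => if i.val < j then 0 else (X i : MvPolynomial _ B))).comp
      (graphHom F G B i) = graphHom F G B j := by
  refine algHom_ext_gen F G fun l m => ?_
  have h1 : ∀ n : Fin (r + 1), (aeval fun i : Fin (r + 1) => if i.val < j then 0 else
      (X i : MvPolynomial _ B)) (if n.val < i then 0 else (X n : MvPolynomial _ B)) =
      if n.val < j then 0 else X n := by
    intro n
    by_cases h : n.val < i
    · simp [h, h.trans_le hij]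
    · simp [h]
  rw [AlgHom.comp_apply, graphHom_gen, graphHom_gen, map_mul, h1]
  congr 1
  refine (map_evalInt (RingHomClass.toRingHom (aeval (R := B) _)) _ _).trans ?_
  congr 2
  funext n
  exact h1 n

variable (h : IsNormalized d F G)

include h

/-- Evaluation at the last unit vector returns the coefficient 1 of the pure power of the last
variable. -/
theorem evalInt_right_ne_zero {B : Type*} [CommRing B] [Nontrivial B] {j : ℕ} (hj : j ≤ r) :
    evalInt (fun i : Fin (r + 1) => if i.val < j then 0 else (X i : MvPolynomial _ B)) G ≠ 0 := by
  intro h0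
  have h1 := congrArg (RingHomClass.toRingHom (aeval (R := B)
    (fun i : Fin (r + 1) => if i = Fin.last r then (1 : B) else 0))) h0
  rw [map_zero, map_evalInt,
    evalInt_of_eq_zero (i := Fin.last r) h.right, h.coeff_right] at h1
  · simp [show ¬ r < j by omega] at h1
  · intro i hi
    by_cases h2 : i.val < j <;> simp [h2, hi]

theorem graphHom_gen_ne_zero {B : Type*} [CommRing B] [IsDomain B] (i : Fin (r + 1)) :
    graphHom F G B i (gen B F G 0 i) ≠ 0 := by
  rw [graphHom_gen, if_neg (lt_irrefl _)]
  exact mul_ne_zero (evalInt_right_ne_zero h (by omega)) (X_ne_zero _)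

omit h in
theorem graphHom_gen_of_lt {B : Type*} [CommRing B] {j : ℕ} (hj : r < j) (l : Fin 2)
    (i : Fin (r + 1)) : graphHom F G B j (gen B F G l i) = 0 := by
  rw [graphHom_gen, if_pos (i.is_le.trans_lt hj), mul_zero]

/-- The kernels form a chain of primes, as the targets are domains. It is strict: with indices
starting at 0, the generator s xⱼ has nonzero image G(y)·Xⱼ at step j and image 0 at step j + 1. -/
theorem le_height_ker_graphHom (K : Type*) [Field K] (j : ℕ) (hj : j ≤ r + 1) :
    (j : ℕ∞) ≤ (RingHom.ker (graphHom F G K j)).height := by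
  induction j with
  | zero => simp
  | succ j ih =>
    have h1 := ih (by omega)
    have h2 : RingHom.ker (graphHom F G K j) < RingHom.ker (graphHom F G K (j + 1)) := by
      refine lt_of_le_of_ne ?_ ?_
      · intro x hx
        rw [RingHom.mem_ker] at hx ⊢
        rw [← graphHom_comp K (Nat.le_succ j), AlgHom.comp_apply, hx, map_zero]
      · intro heq
        have h3 := graphHom_gen_ne_zero h (B := K) ⟨j, by omega⟩
        apply h3
        rw [← RingHom.mem_ker]
        change _ ∈ RingHom.ker (graphHom F G K j)
        rw [heq, RingHom.mem_ker, graphHom_gen, if_pos (Nat.lt_succ_self j), mul_zero]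
    have := RingHom.ker_isPrime (graphHom F G K j)
    have := RingHom.ker_isPrime (graphHom F G K (j + 1))
    rw [Nat.cast_succ]
    exact (add_le_add_left h1 1).trans (Ideal.height_add_one_le_of_lt_of_isPrime h2)

variable (K : Type*) [Field K]

theorem le_height_irrelevantIdeal :
    ((r + 1 : ℕ) : ℕ∞) ≤ (irrelevantIdeal (grading K F G)).height := by
  have h1 : irrelevantIdeal (grading K F G) = RingHom.ker (graphHom F G K (r + 1)) := by
    ext x
    rw [mem_irrelevantIdeal_iff F G K (graphHom_gen_of_lt (B := K) (Nat.lt_succ_self r)),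
      RingHom.mem_ker]
  rw [h1]
  exact le_height_ker_graphHom h K (r + 1) le_rfl

theorem ringKrullDim_le : ringKrullDim (subring K F G) ≤ ((r + 1 : ℕ) : WithBot ℕ∞) := by
  let _ := (paramHom K F G).toRingHom.toAlgebra
  have hint : Algebra.IsIntegral (MvPolynomial (Fin (r + 1)) K) (subring K F G) :=
    ⟨(finite_paramHom K h).to_isIntegral⟩
  have h1 : ringKrullDim (subring K F G) ≤ ringKrullDim (MvPolynomial (Fin (r + 1)) K) := by
    -- Incomparability for the integral extension given by the parameters: contraction of primes is
    -- strictly monotone.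
    refine Order.krullDim_le_of_strictMono
      (PrimeSpectrum.comap (algebraMap (MvPolynomial (Fin (r + 1)) K) (subring K F G))) ?_
    intro I J hIJ
    exact Ideal.IsIntegral.comap_lt_comap (I := I.asIdeal) (J := J.asIdeal) hIJ
  rw [MvPolynomial.ringKrullDim_of_isNoetherianRing, ringKrullDim_eq_zero_of_field] at h1
  simpa using h1

theorem height_irrelevantIdeal : (irrelevantIdeal (grading K F G)).height = (r + 1 : ℕ) := by
  refine le_antisymm ?_ (le_height_irrelevantIdeal h K)
  have := (Ideal.height_le_ringKrullDim_of_ne_top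
    (irrelevantIdeal_isMaximal F G K).ne_top).trans (ringKrullDim_le h K)
  exact_mod_cast this

theorem ringKrullDim_subring : ringKrullDim (subring K F G) = ((r + 1 : ℕ) : WithBot ℕ∞) := by
  refine le_antisymm (ringKrullDim_le h K) ?_
  have := Ideal.height_le_ringKrullDim_of_ne_top (irrelevantIdeal_isMaximal F G K).ne_top
  rw [height_irrelevantIdeal h K] at this
  exact_mod_cast this

theorem radical_span_parameters : (Ideal.span (Set.range (parameters K F G))).radical =
    irrelevantIdeal (grading K F G) := by
  classical
  have hmax := irrelevantIdeal_isMaximal F G K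
  apply le_antisymm
  · rw [hmax.isPrime.radical_le_iff, Ideal.span_le]
    rintro _ ⟨i, rfl⟩
    exact HomogeneousIdeal.mem_irrelevant_of_mem (grading K F G) one_pos
      (parameters_mem_grading K F G i)
  · intro x hx
    rw [sum_decompose_eq F G x]
    refine Ideal.sum_mem _ fun n _ => ?_
    rcases Nat.eq_zero_or_pos n with rfl | hn
    · have : (DirectSum.decompose (grading K F G) x 0 : subring K F G) = 0 := hx
      rw [this]
      exact zero_mem _
    -- The (d+1)-st power of a homogeneous element of positive degree has degree above d, where
    -- everything lies in the parameter ideal.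
    · refine ⟨d + 1, mem_span_parameters_of_lt K h (n := (d + 1) • n) ?_
        (SetLike.pow_mem_graded _ (SetLike.coe_mem _))⟩
      rw [smul_eq_mul]
      nlinarith

theorem isHomogeneousSOP_parameters :
    IsHomogeneousSOP (grading K F G) (parameters K F G) (fun _ => 1) := by
  have hP := (irrelevantIdeal_isMaximal F G K).isPrime
  refine ⟨parameters_mem_grading K F G, hP, ?_, ?_⟩
  · rw [IsLocalization.AtPrime.ringKrullDim_eq_height (irrelevantIdeal (grading K F G)),
      height_irrelevantIdeal h K]
    rfl
  · have hrange : Set.range (fun i => algebraMap (subring K F G)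
        (Localization.AtPrime (irrelevantIdeal (grading K F G))) (parameters K F G i)) =
        algebraMap (subring K F G) (Localization.AtPrime (irrelevantIdeal (grading K F G))) ''
          Set.range (parameters K F G) := by
      rw [← Set.range_comp]; rfl
    have hrad := radical_span_parameters h K
    have hmax := Localization.AtPrime.map_eq_maximalIdeal (I := irrelevantIdeal (grading K F G))
    rw [hrange, ← Ideal.map_span]
    apply le_antisymm
    · rw [(IsLocalRing.maximalIdeal.isMaximal _).isPrime.radical_le_iff, ← hmax]
      exact Ideal.map_mono (Ideal.le_radical.trans hrad.le)
    · rw [← hmax]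
      exact (Ideal.map_mono hrad.ge).trans (Ideal.map_radical_le _)

end Dimension

/-! ### The multiplicity -/

section Multiplicity

variable {r : ℕ} {F G : MvPolynomial (Fin (r + 2)) ℤ} {d : ℕ}

theorem hasHilbertMultiplicity (h : IsNormalized d F G) :
    HasHilbertMultiplicity (grading ℚ F G) (d * (r + 1) + 1) := by
  obtain ⟨h1, h2⟩ := natDegree_and_coeff_hilbertPolynomial r d
  refine ⟨hilbertPolynomial r d, ?_, ?_, ?_⟩
  · filter_upwards [Filter.eventually_ge_atTop d] with n hn
    have h3 := finrank_grading ℚ F G h.left h.right h.coeff_right h.pos n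
    rw [if_pos hn] at h3
    rw [eval_hilbertPolynomial hn, sub_eq_iff_eq_add]
    exact_mod_cast h3.symm
  · rw [ringKrullDim_subring h ℚ, h1]
  · rw [h1, h2]

end Multiplicity

/-! ### Length as vector space dimension -/

section Length

variable {K R : Type*} [Field K] [CommRing R] [Algebra K R]

/-- Here R acts through K, so R-submodules and K-subspaces are the same. -/
theorem length_eq_of_smul_eq_zero {M : Type*} [AddCommGroup M] [Module R M] [Module K M]
    [IsScalarTower K R M] {m : Ideal R} (hm : ∀ x : R, ∃ c : K, x - algebraMap K R c ∈ m)
    (h : ∀ a ∈ m, ∀ y : M, a • y = 0) : Module.length R M = Module.length K M := by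
  let e : Submodule R M ≃o Submodule K M :=
    { toFun := fun p => p.restrictScalars K
      invFun := fun p =>
        { p with
          smul_mem' := fun x y hy => by
            obtain ⟨c, hc⟩ := hm x
            have h1 := h _ hc y
            rw [sub_smul, sub_eq_zero, algebraMap_smul] at h1
            rw [h1]
            exact p.smul_mem c hy }
      left_inv := fun p => rfl
      right_inv := fun p => rfl
      map_rel_iff' := Iff.rfl }
  rw [← WithBot.coe_inj, Module.coe_length, Module.coe_length]
  exact Order.krullDim_eq_of_orderIso e

/-- The length of a module killed by a power of a `K`-rational maximal ideal is its dimension. -/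
theorem length_eq_of_pow_smul_eq_zero {m : Ideal R}
    (hm : ∀ x : R, ∃ c : K, x - algebraMap K R c ∈ m) (N : ℕ) :
    ∀ (M : Type*) [AddCommGroup M] [Module R M] [Module K M] [IsScalarTower K R M],
      (∀ a ∈ m ^ N, ∀ y : M, a • y = 0) → Module.length R M = Module.length K M := by
  induction N with
  | zero =>
    intro M _ _ _ _ h
    have : Subsingleton M := ⟨fun a b => by
      rw [← one_smul R a, ← one_smul R b, h 1 (by simp), h 1 (by simp)]⟩
    rw [Module.length_eq_zero, Module.length_eq_zero]
  | succ N ih =>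
    intro M _ _ _ _ h
    set P : Submodule R M := m • ⊤ with hP
    have h1 : Module.length R P = Module.length K P := by
      refine ih P ?_
      rintro a ha ⟨y, hy⟩
      apply Subtype.ext
      change a • y = 0
      induction hy using Submodule.smul_induction_on' with
      | smul b hb z _ =>
        rw [smul_smul]
        exact h _ (by rw [pow_succ]; exact Ideal.mul_mem_mul ha hb) z
      | add y _ z _ hy hz => rw [smul_add, hy, hz, add_zero]
    have h2 : Module.length R (M ⧸ P) = Module.length K (M ⧸ P) := by
      refine length_eq_of_smul_eq_zero hm ?_
      intro a ha y
      obtain ⟨y, rfl⟩ := Submodule.Quotient.mk_surjective P y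
      rw [← Submodule.Quotient.mk_smul, Submodule.Quotient.mk_eq_zero]
      exact Submodule.smul_mem_smul ha trivial
    rw [Module.length_eq_add_of_exact P.subtype P.mkQ P.subtype_injective P.mkQ_surjective
      (LinearMap.exact_subtype_mkQ P), h1, h2]
    exact (Module.length_eq_add_of_exact (P.subtype.restrictScalars K) (P.mkQ.restrictScalars K)
      P.subtype_injective P.mkQ_surjective (LinearMap.exact_subtype_mkQ P)).symm

end Length

/-! ### Regular sequences in polynomial rings and flat extensions -/

section RegularSequence

open RingTheory.Sequence

open Polynomial in
-- A monic polynomial stays monic over A/I, hence is a nonzerodivisor there.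
theorem monic_isSMulRegular_quotient {A : Type*} [CommRing A] (I : Ideal A) {f : A[X]}
    (hf : f.Monic) : IsSMulRegular (A[X] ⧸ I.map (C : A →+* A[X])) f := by
  rw [isSMulRegular_iff_right_eq_zero_of_smul]
  intro x hx
  obtain ⟨g, rfl⟩ := Ideal.Quotient.mk_surjective x
  have hk : I.map (C : A →+* A[X]) = RingHom.ker (mapRingHom (Ideal.Quotient.mk I)) := by
    rw [Polynomial.ker_mapRingHom, Ideal.mk_ker]
  rw [← Ideal.Quotient.mk_eq_mk, ← Submodule.Quotient.mk_smul, Ideal.Quotient.mk_eq_mk,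
    Ideal.Quotient.eq_zero_iff_mem, smul_eq_mul, hk] at hx
  rw [Ideal.Quotient.eq_zero_iff_mem, hk]
  rw [RingHom.mem_ker] at hx ⊢
  rw [map_mul] at hx
  nontriviality (A ⧸ I)[X]
  have h1 : ((mapRingHom (Ideal.Quotient.mk I)) f).Monic := hf.map _
  exact h1.isRegular.left.mul_left_eq_zero_iff.1 hx

open Polynomial in
-- For a Jacobson ring the contraction q of p to A is maximal. As the polynomial ring over A/q is
-- not a field, p is generated by q and one monic polynomial f, and f is regular modulo q. So one
-- element is appended to a regular sequence generating q.
theorem exists_isWeaklyRegular_polynomial {A : Type*} [CommRing A] [IsJacobsonRing A] {n : ℕ}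
    (hA : ∀ p : Ideal A, p.IsMaximal → ∃ rs : List A, Ideal.ofList rs = p ∧
      IsWeaklyRegular A rs ∧ rs.length = n) (p : Ideal A[X]) (hp : p.IsMaximal) :
    ∃ rs : List A[X], Ideal.ofList rs = p ∧ IsWeaklyRegular A[X] rs ∧ rs.length = n + 1 := by
  have hq := Polynomial.isMaximal_comap_C_of_isJacobsonRing p
  have hne : p ≠ (p.comap Polynomial.C).map Polynomial.C := by
    intro h
    have hk : p = RingHom.ker (mapRingHom (Ideal.Quotient.mk (p.comap Polynomial.C))) := by
      rw [Polynomial.ker_mapRingHom, Ideal.mk_ker]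
      exact h
    have h1 := (Ideal.Quotient.maximal_ideal_iff_isField_quotient p).1 hp
    have e := (Ideal.quotEquivOfEq hk).trans (RingHom.quotientKerEquivOfSurjective
      (Polynomial.map_surjective _ Ideal.Quotient.mk_surjective))
    exact Polynomial.not_isField _ (e.symm.toMulEquiv.isField h1)
  obtain ⟨f, hf, hpf⟩ := Polynomial.exists_monic_span_sup_map_eq A p hq hne
  obtain ⟨rs, h1, h2, h3⟩ := hA _ hq
  have h4 : Ideal.ofList (rs.map (Polynomial.C : A →+* A[X])) = (p.comap Polynomial.C).map Polynomial.C := by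
    rw [← Ideal.map_ofList, h1]
  refine ⟨rs.map Polynomial.C ++ [f], ?_, ?_, by simp [h3]⟩
  · rw [Ideal.ofList_append, h4, Ideal.ofList_singleton]
    exact hpf.symm
  · rw [isWeaklyRegular_append_iff, isWeaklyRegular_singleton_iff]
    refine ⟨h2.of_flat, ?_⟩
    have := monic_isSMulRegular_quotient (p.comap Polynomial.C) hf
    rw [h4, smul_eq_mul, Ideal.mul_top]
    exact this

theorem exists_isWeaklyRegular_of_ringEquiv {A B : Type*} [CommRing A] [CommRing B] (e : A ≃+* B)
    {n : ℕ} (hA : ∀ p : Ideal A, p.IsMaximal → ∃ rs : List A, Ideal.ofList rs = p ∧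
      IsWeaklyRegular A rs ∧ rs.length = n) (p : Ideal B) (hp : p.IsMaximal) :
    ∃ rs : List B, Ideal.ofList rs = p ∧ IsWeaklyRegular B rs ∧ rs.length = n := by
  obtain ⟨rs, h1, h2, h3⟩ := hA (p.comap e) (Ideal.comap_isMaximal_of_equiv e)
  let _ := e.toRingHom.toAlgebra
  have : Module.Flat A B := Module.Flat.of_linearEquiv
    ({ e with map_smul' := fun a x => by simp [Algebra.smul_def, RingHom.algebraMap_toAlgebra] } :
      A ≃ₗ[A] B).symm
  refine ⟨rs.map e, ?_, h2.of_flat, by simp [h3]⟩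
  rw [← Ideal.map_comap_of_surjective e e.surjective p, ← h1]
  exact (Ideal.map_ofList e.toRingHom rs).symm

/-- Maximal ideals of polynomial rings are generated by regular sequences. -/
theorem exists_isWeaklyRegular_mvPolynomial (K : Type*) [Field K] (n : ℕ) :
    ∀ p : Ideal (MvPolynomial (Fin n) K), p.IsMaximal → ∃ rs : List (MvPolynomial (Fin n) K),
      Ideal.ofList rs = p ∧ IsWeaklyRegular (MvPolynomial (Fin n) K) rs ∧ rs.length = n := by
  induction n with
  | zero =>
    refine exists_isWeaklyRegular_of_ringEquiv (isEmptyRingEquiv K (Fin 0)).symm ?_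
    intro p hp
    refine ⟨[], ?_, by simp, rfl⟩
    rw [Ideal.ofList_nil]
    exact ((Ideal.eq_bot_or_top p).resolve_right hp.ne_top).symm
  | succ n ih =>
    exact exists_isWeaklyRegular_of_ringEquiv (finSuccEquiv K n).symm.toRingEquiv
      (exists_isWeaklyRegular_polynomial ih)

/-- A finite flat algebra over a polynomial ring in `n` variables which has dimension at most `n`
is Cohen–Macaulay. -/
theorem isCohenMacaulay_of_flat {K R : Type*} [Field K] [CommRing R] {n : ℕ}
    (f : MvPolynomial (Fin n) K →+* R) (hf : f.Finite) (hflat : f.Flat)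
    (hdim : ringKrullDim R ≤ n) : IsCohenMacaulay R := by
  let _ := f.toAlgebra
  have : Module.Finite (MvPolynomial (Fin n) K) R := hf
  have : Module.Flat (MvPolynomial (Fin n) K) R := hflat
  have hN : IsNoetherianRing R := IsNoetherianRing.of_finite (MvPolynomial (Fin n) K) R
  refine ⟨hN, fun P hP => ?_⟩
  have hq : (P.comap f).IsMaximal :=
    Ideal.isMaximal_comap_of_isIntegral_of_isMaximal (R := MvPolynomial (Fin n) K) P
  obtain ⟨rs, h1, h2, h3⟩ := exists_isWeaklyRegular_mvPolynomial K n _ hq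
  have hmem : ∀ x ∈ rs.map f, x ∈ P := by
    intro x hx
    obtain ⟨y, hy, rfl⟩ := List.mem_map.1 hx
    have : y ∈ P.comap f := by
      rw [← h1]
      exact Ideal.subset_span hy
    exact this
  -- Flatness carries the sequence generating the contraction of P to R. After localization at P it
  -- is regular of length n, and n ≤ dim R_P ≤ dim R ≤ n.
  have h4 : IsWeaklyRegular R (rs.map f) := h2.of_flat
  have h5 := h4.isRegular_of_isLocalization_of_mem (Localization.AtPrime P) P hmem
  refine ⟨_, ?_, h5, ?_⟩
  · intro y hy
    obtain ⟨x, hx, rfl⟩ := List.mem_map.1 hy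
    exact (IsLocalization.AtPrime.to_map_mem_maximal_iff _ P x).2 (hmem x hx)
  · apply le_antisymm
    · rw [← ringKrullDim_add_length_eq_ringKrullDim_of_isRegular _ h5]
      have := h5.quot_ofList_smul_nontrivial ⊤
      have hnt : Nontrivial (Localization.AtPrime P ⧸
          Ideal.ofList ((rs.map f).map (algebraMap R (Localization.AtPrime P)))) := by
        rw [Ideal.Quotient.nontrivial_iff]
        have := h5.top_ne_smul
        rw [smul_eq_mul, Ideal.mul_top] at this
        exact this.symm
      exact le_add_of_nonneg_left ringKrullDim_nonneg_of_nontrivial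
    · rw [IsLocalization.AtPrime.ringKrullDim_eq_height P]
      refine (Ideal.height_le_ringKrullDim_of_ne_top hP.ne_top).trans (hdim.trans ?_)
      simp [h3]

end RegularSequence

theorem length_quotient_eq_card {K R ι : Type*} [Field K] [CommRing R] [Algebra K R] [Fintype ι]
    {I m : Ideal R} (hm : ∀ x : R, ∃ c : K, x - algebraMap K R c ∈ m) {N : ℕ} (hN : m ^ N ≤ I)
    (c : R →ₗ[K] (ι → K)) (hc : Function.Surjective c)
    (hker : LinearMap.ker c = I.restrictScalars K) :
    Module.length R (R ⧸ I) = (Fintype.card ι : ℕ∞) := by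
  let e : (R ⧸ I.restrictScalars K) ≃ₗ[K] (ι → K) :=
    (Submodule.quotEquivOfEq _ _ hker.symm).trans (c.quotKerEquivOfSurjective hc)
  have e' : (R ⧸ I) ≃ₗ[K] (ι → K) := e
  rw [length_eq_of_pow_smul_eq_zero hm N, e'.length_eq, Module.length_eq_finrank,
    Module.finrank_fintype_fun_eq_card]
  intro a ha y
  obtain ⟨y, rfl⟩ := Ideal.Quotient.mk_surjective y
  rw [← Ideal.Quotient.mk_eq_mk, ← Submodule.Quotient.mk_smul, Ideal.Quotient.mk_eq_mk,
    Ideal.Quotient.eq_zero_iff_mem]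
  exact I.mul_mem_right _ (hN ha)

/-! ### Freeness over the parameters for d ≤ k -/

section Free

theorem add_mul_choose_eq (r m : ℕ) :
    (r + (m + 1)) * (m + r).choose r = (m + 1) * (m + 1 + r).choose r := by
  have h := Nat.choose_mul_succ_eq (m + r) r
  rw [show m + r + 1 - r = m + 1 by omega, show m + r + 1 = m + 1 + r by omega] at h
  rw [show r + (m + 1) = m + 1 + r by omega, mul_comm, h, mul_comm]

/-- The dimension of the forms of degree `n - j` in `r + 1` variables. -/
def formDim (r n j : ℕ) : ℕ := if j ≤ n then (n - j + r).choose r else 0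

/-- The absorption identity for binomial coefficients, in a form that also holds where the truncated
dimensions vanish. -/
theorem mul_formDim_succ (r n j : ℕ) :
    ((r : ℤ) - j + n) * formDim r n (j + 1) = ((n : ℤ) - j) * formDim r n j := by
  unfold formDim
  rcases lt_trichotomy j n with h | h | h
  · rw [if_pos h.le, if_pos (Nat.succ_le_of_lt h)]
    obtain ⟨m, rfl⟩ := Nat.exists_eq_add_of_lt h
    have := add_mul_choose_eq r m
    rw [show j + m + 1 - (j + 1) = m by omega, show j + m + 1 - j = m + 1 by omega]
    zify at this
    push_cast
    linear_combination this
  · subst h; simp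
  · rw [if_neg (by omega), if_neg (by omega)]; simp

/-- The sum telescopes: the absorption identity trades the last term for the next one. -/
theorem sum_formDim (r n : ℕ) : ∀ d : ℕ,
    (∑ i : Fin d, ((r : ℤ) + 1) * formDim r n (i + 1)) + (r - d + n) * formDim r n (d + 1) =
      n * formDim r n 0 := by
  intro d
  induction d with
  | zero =>
    have := mul_formDim_succ r n 0
    simpa using this
  | succ d ih =>
    rw [Fin.sum_univ_castSucc, ← ih]
    have := mul_formDim_succ r n (d + 1)
    push_cast at this ⊢
    simp only [Fin.val_castSucc]
    linear_combination this

/-- The Hilbert function of the free module on the generators equals that of R. The hypothesis d ≤ r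
+ 1 makes r + 1 − d the true number of generators of degree d. -/
theorem sum_formDim_genDegree {r d : ℕ} (n : ℕ) (hd : 1 ≤ d) (hdr : d ≤ r + 1) :
    ((∑ a : GenIndex r d, formDim r n (genDegree r d a) : ℕ) : ℤ) + n * formDim r n d =
      (n + 1) * formDim r n 0 := by
  obtain ⟨d, rfl⟩ := Nat.exists_eq_add_of_le' hd
  have h := sum_formDim r n d
  change ((∑ a : Unit ⊕ ((Fin d × Fin (r + 1)) ⊕ Fin (r + 1 - (d + 1))),
    formDim r n (genDegree r (d + 1) a) : ℕ) : ℤ) + _ = _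
  simp only [Fintype.sum_sum_type, genDegree, Sum.elim_inl, Sum.elim_inr, Fintype.sum_prod_type,
    Finset.sum_const, Finset.card_univ, Fintype.card_fin, smul_eq_mul,
    Fintype.card_unit, one_mul]
  rw [show r + 1 - (d + 1) = r - d by omega]
  push_cast [show d ≤ r by omega]
  linear_combination h

variable {r : ℕ} (K : Type*) [Field K] {F G : MvPolynomial (Fin (r + 1)) ℤ} {d : ℕ}

theorem finrank_coeffPiece (n : ℕ) (a : GenIndex r d) :
    Module.finrank K (coeffPiece K d n a) = formDim r n (genDegree r d a) := by
  unfold formDim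
  split_ifs with h
  · rw [coeffPiece_of_le K d h, finrank_homogeneousSubmodule]
  · rw [coeffPiece_of_not_le K d h, finrank_bot]

theorem finite_coeffPiece (n : ℕ) (a : GenIndex r d) :
    Module.Finite K (coeffPiece K d n a) := by
  by_cases h : genDegree r d a ≤ n
  · rw [coeffPiece_of_le K d h]
    exact finite_homogeneousSubmodule K _
  · rw [coeffPiece_of_not_le K d h]
    infer_instance

variable (F G) in
theorem paramMap_mem_grading {n : ℕ} (hd : 1 ≤ d) {v : GenIndex r d → MvPolynomial (Fin (r + 1)) K}
    (hv : v ∈ coeffPieces K d n) : paramMap K F G d v ∈ grading K F G n := by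
  rw [paramMap_apply]
  refine Submodule.sum_mem _ fun a _ => ?_
  have h3 : v a ∈ coeffPiece K d n a := hv a trivial
  by_cases h4 : genDegree r d a ≤ n
  · rw [coeffPiece_of_le K d h4] at h3
    have := SetLike.mul_mem_graded (paramHom_mem_grading K F G h3) (moduleGen_mem_grading K F G hd a)
    rwa [Nat.sub_add_cancel h4] at this
  · rw [coeffPiece_of_not_le K d h4] at h3
    rw [(Submodule.mem_bot K).1 h3, map_zero, zero_mul]
    exact zero_mem _

variable (h : IsNormalized d F G) (hdr : d ≤ r + 1)

include h hdr

/-- In each degree the generators give a surjection between spaces of the same finite dimension, so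
it is injective. -/
theorem eq_zero_of_paramMap_eq_zero {n : ℕ} {v : GenIndex r d → MvPolynomial (Fin (r + 1)) K}
    (hv : v ∈ coeffPieces K d n) (h0 : paramMap K F G d v = 0) : v = 0 := by
  have hfin := finite_coeffPiece (r := r) (d := d) K n
  have hfin' := finite_grading K F G n
  let e : (∀ a, coeffPiece K d n a) →ₗ[K] grading K F G n :=
    ((paramMap K F G d).comp (LinearMap.pi fun a =>
      (coeffPiece K d n a).subtype.comp (LinearMap.proj a))).codRestrict _ fun w =>
        paramMap_mem_grading K F G h.pos (fun a _ => (w a).2)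
  have hsurj : Function.Surjective e := by
    rintro ⟨x, hx⟩
    obtain ⟨w, hw, rfl⟩ := grading_le_map_paramMap K h n hx
    exact ⟨fun a => ⟨w a, hw a trivial⟩, rfl⟩
  have hdim : Module.finrank K (∀ a : GenIndex r d, coeffPiece K d n a) = Module.finrank K (grading K F G n) := by
    rw [Module.finrank_pi_fintype]
    simp only [finrank_coeffPiece]
    have h1 := sum_formDim_genDegree n h.pos hdr
    have h2 := finrank_grading K F G h.left h.right h.coeff_right h.pos n
    rw [← @Nat.cast_inj ℤ]
    zify at h2
    unfold formDim at h1 ⊢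
    simp only [zero_le, if_true, Nat.sub_zero] at h1
    split_ifs at h1 h2 <;> push_cast at h1 h2 ⊢ <;> linarith
  have hinj := (LinearMap.injective_iff_surjective_of_finrank_eq_finrank hdim).2 hsurj
  have h1 : (fun a => ⟨v a, hv a trivial⟩ : ∀ a : GenIndex r d, coeffPiece K d n a) = 0 := by
    apply hinj
    rw [map_zero]
    exact Subtype.ext h0
  ext1 a
  exact congrArg Subtype.val (congrFun h1 a)

/-- The generators are homogeneous, so a relation splits into relations in single degrees. -/
theorem paramMap_injective : Function.Injective (paramMap K F G d) := by
  rw [injective_iff_map_eq_zero]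
  intro v hv
  have key : ∀ n, (fun a => if genDegree r d a ≤ n then
      homogeneousComponent (n - genDegree r d a) (v a) else 0) = 0 := by
    intro n
    refine eq_zero_of_paramMap_eq_zero K h hdr (n := n) ?_ ?_
    · intro a _
      change _ ∈ coeffPiece K d n a
      by_cases ha : genDegree r d a ≤ n
      · rw [coeffPiece_of_le K d ha]
        simp only [if_pos ha]
        exact homogeneousComponent_isHomogeneous _ _
      · simp only [if_neg ha]
        exact zero_mem _
    · have h1 : (DirectSum.decompose (grading K F G) (paramMap K F G d v) n : subring K F G) =
          0 := by rw [hv]; simp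
      rw [paramMap_apply, DirectSum.decompose_sum, DFinsupp.finsetSum_apply,
        AddSubmonoidClass.coe_finsetSum] at h1
      rw [paramMap_apply, ← h1]
      refine Finset.sum_congr rfl fun a _ => ?_
      by_cases ha : genDegree r d a ≤ n
      · rw [if_pos ha, DirectSum.coe_decompose_mul_of_right_mem_of_le (grading K F G)
          (moduleGen_mem_grading K F G h.pos a) ha, decompose_paramHom]
      · rw [if_neg ha, DirectSum.coe_decompose_mul_of_right_mem_of_not_le (grading K F G)
          (moduleGen_mem_grading K F G h.pos a) ha, map_zero, zero_mul]
  ext1 a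
  rw [← sum_homogeneousComponent (v a)]
  refine Finset.sum_eq_zero fun i _ => ?_
  have := congrFun (key (i + genDegree r d a)) a
  simpa using this

/-- The coordinates with respect to the module generators. -/
def paramEquiv : (GenIndex r d → MvPolynomial (Fin (r + 1)) K) ≃ₗ[K] subring K F G :=
  LinearEquiv.ofBijective (paramMap K F G d) ⟨paramMap_injective K h hdr, paramMap_surjective K h⟩

theorem paramEquiv_apply (v : GenIndex r d → MvPolynomial (Fin (r + 1)) K) :
    paramEquiv K h hdr v = ∑ a, paramHom K F G (v a) * moduleGen K F G d a :=
  paramMap_apply K F G d v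

theorem paramEquiv_symm_mul (p : MvPolynomial (Fin (r + 1)) K) (x : subring K F G)
    (a : GenIndex r d) : (paramEquiv K h hdr).symm (paramHom K F G p * x) a =
      p * (paramEquiv K h hdr).symm x a := by
  have : (paramEquiv K h hdr).symm (paramHom K F G p * x) =
      fun a => p * (paramEquiv K h hdr).symm x a := by
    rw [LinearEquiv.symm_apply_eq]
    refine Eq.trans ?_ (paramMap_smul K F G d p _).symm
    congr 1
    exact ((paramEquiv K h hdr).apply_symm_apply x).symm
  rw [this]

theorem flat_paramHom : (paramHom K F G).toRingHom.Flat := by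
  let _ := (paramHom K F G).toRingHom.toAlgebra
  let e : subring K F G ≃ₗ[MvPolynomial (Fin (r + 1)) K]
      (GenIndex r d → MvPolynomial (Fin (r + 1)) K) :=
    { (paramEquiv K h hdr).symm with
      map_smul' := fun p x => by
        ext1 a
        exact paramEquiv_symm_mul K h hdr p x a }
  exact Module.Flat.of_linearEquiv e

theorem isCohenMacaulay_subring : IsCohenMacaulay (subring K F G) :=
  isCohenMacaulay_of_flat (paramHom K F G).toRingHom (finite_paramHom K h)
    (flat_paramHom K h hdr) (ringKrullDim_le h K)

/-- An element lies in the ideal generated by the images of an ideal of the polynomial ring in the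
parameters if and only if its coordinates lie in this ideal. -/
theorem mem_map_paramHom_iff (I : Ideal (MvPolynomial (Fin (r + 1)) K)) (x : subring K F G) :
    x ∈ I.map (paramHom K F G) ↔ ∀ a, (paramEquiv K h hdr).symm x a ∈ I := by
  constructor
  · intro hx
    induction hx using Submodule.span_induction with
    | mem x hx =>
      obtain ⟨p, hp, rfl⟩ := hx
      intro a
      have := paramEquiv_symm_mul K h hdr p 1 a
      rw [mul_one] at this
      change (paramEquiv K h hdr).symm (paramHom K F G p) a ∈ I
      rw [this]
      exact I.mul_mem_right _ hp
    | zero =>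
      intro a
      rw [LinearEquiv.map_zero]
      exact I.zero_mem
    | add x y _ _ hx hy =>
      intro a
      rw [LinearEquiv.map_add]
      exact I.add_mem (hx a) (hy a)
    | smul c x _ hx =>
      intro a
      have h1 : c • x = ∑ b, paramHom K F G ((paramEquiv K h hdr).symm x b) *
          (c * moduleGen K F G d b) := by
        conv_lhs => rw [← (paramEquiv K h hdr).apply_symm_apply x, paramEquiv_apply]
        rw [smul_eq_mul, Finset.mul_sum]
        exact Finset.sum_congr rfl fun b _ => by ring
      have h2 := _root_.map_sum (paramEquiv K h hdr).symm.toLinearMap (fun b =>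
        paramHom K F G ((paramEquiv K h hdr).symm x b) * (c * moduleGen K F G d b)) Finset.univ
      rw [h1, show (paramEquiv K h hdr).symm _ = _ from h2, Finset.sum_apply]
      refine Ideal.sum_mem _ fun b _ => ?_
      refine Eq.subst (motive := (· ∈ I)) (paramEquiv_symm_mul K h hdr _ _ a).symm ?_
      exact I.mul_mem_right _ (hx b)
  · intro hx
    rw [← (paramEquiv K h hdr).apply_symm_apply x, paramEquiv_apply]
    exact Ideal.sum_mem _ fun a _ => Ideal.mul_mem_right _ _ (Ideal.mem_map_of_mem _ (hx a))

/-- Taking constant terms of the coordinates identifies the quotient with a K-space having one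
dimension per generator. There are 1 + (d−1)(r+1) + (r+1−d) = d·r + 1 of them. -/
theorem quotientLength_parameters :
    quotientLength (parameters K F G) = ((d * r + 1 : ℕ) : ℕ∞) := by
  set I := Ideal.span (Set.range (parameters K F G)) with hI
  have hmax := irrelevantIdeal_isMaximal F G K
  have hN : IsNoetherianRing (subring K F G) := (isCohenMacaulay_subring K h hdr).1
  -- A power of the irrelevant ideal lies in I, which allows length to be computed as dimension over
  -- K.
  obtain ⟨N, hN'⟩ := Ideal.exists_radical_pow_le_of_fg I (IsNoetherian.noetherian _)
  have hX : ∀ p : MvPolynomial (Fin (r + 1)) K, p ∈ Ideal.span (Set.range X) ↔ lcoeff K 0 p = 0 := by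
    intro p
    rw [← Set.image_univ, mem_ideal_span_X_image, lcoeff_apply]
    constructor
    · intro h0
      by_contra h1
      obtain ⟨i, -, hi⟩ := h0 0 (mem_support_iff.2 h1)
      exact hi rfl
    · intro h0 m hm
      have : m ≠ 0 := by
        rintro rfl
        exact mem_support_iff.1 hm h0
      obtain ⟨i, hi⟩ := Finsupp.ne_iff.1 this
      exact ⟨i, trivial, hi⟩
  have hIm : I = (Ideal.span (Set.range (X : _ → MvPolynomial (Fin (r + 1)) K))).map
      (paramHom K F G) := by
    rw [Ideal.map_span, hI, ← Set.range_comp]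
    congr 2
    ext1 i
    exact (paramHom_X K F G i).symm
  let c : (GenIndex r d → MvPolynomial (Fin (r + 1)) K) →ₗ[K] (GenIndex r d → K) :=
    LinearMap.pi fun a => (lcoeff K 0).comp (LinearMap.proj a)
  let c' : subring K F G →ₗ[K] (GenIndex r d → K) := c.comp (paramEquiv K h hdr).symm.toLinearMap
  have hc : Function.Surjective c' := by
    intro w
    refine ⟨paramEquiv K h hdr fun a => C (w a), ?_⟩
    ext1 a
    change coeff 0 ((paramEquiv K h hdr).symm (paramEquiv K h hdr fun a => C (w a)) a) = w a
    rw [LinearEquiv.symm_apply_apply, coeff_zero_C]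
  have hker : LinearMap.ker c' = I.restrictScalars K := by
    ext x
    rw [LinearMap.mem_ker, Submodule.restrictScalars_mem, hIm, mem_map_paramHom_iff K h hdr,
      funext_iff]
    exact forall_congr' fun a => (hX _).symm
  refine (length_quotient_eq_card (m := irrelevantIdeal (grading K F G)) ?_
    (N := N) (by rwa [radical_span_parameters h K] at hN') c' hc hker).trans ?_
  · intro x
    have h0 : x - (DirectSum.decompose (grading K F G) x 0 : subring K F G) ∈
        irrelevantIdeal (grading K F G) := by
      change ((DirectSum.decompose (grading K F G) (x - _) 0 : _) : subring K F G) = 0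
      rw [DirectSum.decompose_sub, DirectSum.decompose_coe]
      simp
    obtain ⟨b, hb⟩ := exists_algebraMap_eq_of_mem_grading (B := K) (F := F) (G := G)
      (SetLike.coe_mem (DirectSum.decompose (grading K F G) x 0))
    exact ⟨b, by rwa [hb]⟩
  congr 1
  obtain ⟨d, rfl⟩ := Nat.exists_eq_add_of_le' h.pos
  change Fintype.card (Unit ⊕ ((Fin d × Fin (r + 1)) ⊕ Fin (r + 1 - (d + 1)))) = _
  simp only [Fintype.card_sum, Fintype.card_prod, Fintype.card_fin, Fintype.card_unit]
  rw [show r + 1 - (d + 1) = r - d by omega]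
  have : d ≤ r := by omega
  zify [this]
  ring

end Free

/-! ### Top local cohomology and the a-invariant -/

section TopLocalCohomology

variable {R : Type*} [CommRing R] {r : ℕ} (x : Fin r → R)

theorem powerTransition_mk (s t : ℕ) (h : s ≤ t) (f : R) :
    powerTransition x s t h (Ideal.Quotient.mk (powerIdeal x s) f) =
      Ideal.Quotient.mk (powerIdeal x t) ((∏ i, x i) ^ (t - s) * f) := rfl

theorem directedSystem_powerTransition :
    DirectedSystem (fun t : ℕ => R ⧸ powerIdeal x t) fun s t h => powerTransition x s t h where
  map_self s y := by
    obtain ⟨f, rfl⟩ := Ideal.Quotient.mk_surjective y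
    rw [powerTransition_mk, Nat.sub_self, pow_zero, one_mul]
  map_map k j i hij hjk y := by
    obtain ⟨f, rfl⟩ := Ideal.Quotient.mk_surjective y
    simp only [powerTransition_mk]
    rw [← mul_assoc, ← pow_add]
    congr 3
    omega

theorem exists_mul_mem_powerIdeal {t : ℕ} {f : R}
    (h : Module.DirectLimit.of R ℕ (fun t : ℕ => R ⧸ powerIdeal x t) (powerTransition x) t
      (Ideal.Quotient.mk (powerIdeal x t) f) = 0) :
    ∃ u, t ≤ u ∧ (∏ i, x i) ^ (u - t) * f ∈ powerIdeal x u := by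
  have := directedSystem_powerTransition x
  obtain ⟨u, hu, h1⟩ := Module.DirectLimit.of.zero_exact h
  refine ⟨u, hu, ?_⟩
  rwa [powerTransition_mk, Ideal.Quotient.eq_zero_iff_mem] at h1

theorem topLocalCohomologyPiece_ne_bot {K : Type*} [Field K] [Algebra K R]
    {𝒜 : ℕ → Submodule K R} {δ : Fin r → ℕ} {a : ℤ} {t n : ℕ} {f : R} (hf : f ∈ 𝒜 n)
    (hn : (n : ℤ) - t * ∑ i, (δ i : ℤ) = a)
    (h : ∀ u, t ≤ u → (∏ i, x i) ^ (u - t) * f ∉ powerIdeal x u) :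
    topLocalCohomologyPiece 𝒜 x δ a ≠ ⊥ := by
  intro h0
  have h1 : Module.DirectLimit.of R ℕ (fun t : ℕ => R ⧸ powerIdeal x t) (powerTransition x) t
      (Ideal.Quotient.mk (powerIdeal x t) f) ∈ topLocalCohomologyPiece 𝒜 x δ a :=
    AddSubgroup.subset_closure ⟨t, n, f, hf, hn, rfl⟩
  rw [h0, AddSubgroup.mem_bot] at h1
  obtain ⟨u, hu, h2⟩ := exists_mul_mem_powerIdeal x h1
  exact h u hu h2

theorem topLocalCohomologyPiece_eq_bot {K : Type*} [Field K] [Algebra K R]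
    {𝒜 : ℕ → Submodule K R} {δ : Fin r → ℕ} {a : ℤ}
    (h : ∀ (t n : ℕ), ∀ f ∈ 𝒜 n, (n : ℤ) - t * ∑ i, (δ i : ℤ) = a → f ∈ powerIdeal x t) :
    topLocalCohomologyPiece 𝒜 x δ a = ⊥ := by
  rw [topLocalCohomologyPiece, AddSubgroup.closure_eq_bot_iff]
  rintro _ ⟨t, n, f, hf, hn, rfl⟩
  rw [Set.mem_singleton_iff, Ideal.Quotient.eq_zero_iff_mem.2 (h t n f hf hn), map_zero]

theorem mem_span_X_pow_iff {σ R : Type*} [CommRing R] (t : ℕ) (p : MvPolynomial σ R) :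
    p ∈ Ideal.span (Set.range fun i => (X i : MvPolynomial σ R) ^ t) ↔
      ∀ m ∈ p.support, ∃ i, t ≤ m i := by
  have h : (Set.range fun i => (X i : MvPolynomial σ R) ^ t) =
      (fun s => monomial s (1 : R)) '' Set.range fun i => Finsupp.single i t := by
    rw [← Set.range_comp]
    congr 1
    ext1 i
    rw [X_pow_eq_monomial]
    rfl
  rw [h, mem_ideal_span_monomial_image]
  refine forall₂_congr fun m _ => ?_
  simp only [Set.exists_range_iff, Finsupp.single_le_iff]

variable (K : Type*) [Field K] {r : ℕ} {F G : MvPolynomial (Fin (r + 1)) ℤ} {d : ℕ}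
  (h : IsNormalized d F G) (hdr : d ≤ r + 1)

include h hdr

theorem mem_powerIdeal_parameters_iff (t : ℕ) (y : subring K F G) :
    y ∈ powerIdeal (parameters K F G) t ↔
      ∀ a, ∀ m ∈ ((paramEquiv K h hdr).symm y a).support, ∃ i, t ≤ m i := by
  have h1 : powerIdeal (parameters K F G) t = (Ideal.span (Set.range fun i =>
      (X i : MvPolynomial (Fin (r + 1)) K) ^ t)).map (paramHom K F G) := by
    rw [Ideal.map_span, powerIdeal, ← Set.range_comp]
    congr 2
    ext1 i
    rw [Function.comp_apply, map_pow, paramHom_X]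
  rw [h1, mem_map_paramHom_iff K h hdr]
  exact forall_congr' fun a => mem_span_X_pow_iff t _

theorem paramEquiv_symm_mem {n : ℕ} {y : subring K F G} (hy : y ∈ grading K F G n) :
    (paramEquiv K h hdr).symm y ∈ coeffPieces K d n := by
  obtain ⟨v, hv, rfl⟩ := grading_le_map_paramMap K h n hy
  have : (paramEquiv K h hdr).symm (paramMap K F G d v) = v :=
    (paramEquiv K h hdr).symm_apply_apply v
  rwa [this]

theorem paramEquiv_symm_moduleGen (a : GenIndex r d) :
    (paramEquiv K h hdr).symm (moduleGen K F G d a) = Pi.single a 1 := by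
  classical
  rw [LinearEquiv.symm_apply_eq, paramEquiv_apply, Finset.sum_eq_single a]
  · simp
  · intro b _ hb
    simp [Pi.single_eq_of_ne hb]
  · simp

/-- The coordinate on the generator a has degree above (r+1)(t−1), so each of its monomials has some
exponent at least t. -/
theorem mem_powerIdeal_of_lt {n t : ℕ} {y : subring K F G} (hy : y ∈ grading K F G n)
    (hn : ∀ a : GenIndex r d, (r + 1) * (t - 1) + genDegree r d a < n) :
    y ∈ powerIdeal (parameters K F G) t := by
  rw [mem_powerIdeal_parameters_iff K h hdr]
  intro a m hm
  have h1 : (paramEquiv K h hdr).symm y a ∈ coeffPiece K d n a :=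
    paramEquiv_symm_mem K h hdr hy a trivial
  have h0 := hn a
  rw [coeffPiece_of_le K d (by omega)] at h1
  have h2 := h1 (mem_support_iff.1 hm)
  rw [Pi.one_def, ← Finsupp.degree_eq_weight_one, Finsupp.degree_eq_sum] at h2
  by_contra! h3
  have h4 : ∑ i, m i ≤ ∑ _i : Fin (r + 1), (t - 1) :=
    Finset.sum_le_sum fun i _ => Nat.le_sub_one_of_lt (h3 i)
  rw [Finset.sum_const, Finset.card_univ, Fintype.card_fin, smul_eq_mul, h2] at h4
  omega

omit hdr in
-- For d = r + 1 there is no generator of degree d, and the highest generator degree is r. Stage t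
-- shifts degrees by t(r+1), so the top degree is r − (r+1) = −1.
theorem hasAInvariant_grading (hdr : d = r + 1) (hr : 1 ≤ r) :
    HasAInvariant (grading K F G) (-1) := by
  refine ⟨r + 1, parameters K F G, fun _ => 1, isHomogeneousSOP_parameters h K, ?_, ?_⟩
  · subst hdr
    -- The generator (t x_k)^r. Its class at stage 1 has degree −1, and at stage u its coordinate is
    -- the monomial with all exponents u − 1, which is outside the ideal of u-th powers.
    let a : GenIndex r (r + 1) := Sum.inr (Sum.inl (⟨r - 1, by omega⟩, Fin.last r))
    have ha : genDegree r (r + 1) a = r := by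
      change r - 1 + 1 = r
      omega
    refine topLocalCohomologyPiece_ne_bot (parameters K F G) (t := 1) (n := r)
      (f := moduleGen K F G (r + 1) a) ?_ (by simp) ?_
    · have := moduleGen_mem_grading K F G h.pos a
      rwa [ha] at this
    intro u hu h2
    have h3 : (∏ i, parameters K F G i) ^ (u - 1) =
        paramHom K F G (∏ i, X i ^ (u - 1)) := by
      rw [map_prod, ← Finset.prod_pow]
      exact Finset.prod_congr rfl fun i _ => by rw [map_pow, paramHom_X]
    rw [h3, mem_powerIdeal_parameters_iff K h le_rfl] at h2
    have h4 := h2 a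
    rw [paramEquiv_symm_mul, paramEquiv_symm_moduleGen, Pi.single_eq_same, mul_one] at h4
    have h5 : (∏ i : Fin (r + 1), (X i : MvPolynomial (Fin (r + 1)) K) ^ (u - 1)) =
        monomial (Finsupp.equivFunOnFinite.symm fun _ => u - 1) 1 := by
      rw [monomial_eq, C_1, one_mul, Finsupp.prod_fintype _ _ (by simp)]
      rfl
    rw [h5] at h4
    obtain ⟨i, hi⟩ := h4 _ (mem_support_iff.2 (by rw [coeff_monomial, if_pos rfl]; exact one_ne_zero))
    change u ≤ u - 1 at hi
    omega
  · intro b hb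
    by_contra! hlt
    apply hb
    refine topLocalCohomologyPiece_eq_bot _ fun t n f hf hn => ?_
    simp only [Nat.cast_one, Finset.sum_const, Finset.card_univ, Fintype.card_fin,
      nsmul_eq_mul, mul_one] at hn
    -- At t = 0 the ideal is the unit ideal, being generated by zeroth powers.
    rcases Nat.eq_zero_or_pos t with rfl | ht
    · have h1 : (1 : subring K F G) ∈ powerIdeal (parameters K F G) 0 :=
        Ideal.subset_span ⟨0, pow_zero _⟩
      have h2 := Ideal.mul_mem_left _ f h1
      rwa [mul_one] at h2
    · obtain ⟨t, rfl⟩ := Nat.exists_eq_add_of_le' ht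
      refine mem_powerIdeal_of_lt K h hdr.le hf ?_
      have h2 : (t + 1) * (r + 1) ≤ n := by
        zify
        push_cast at hn
        linarith
      have h3 : ∀ a : GenIndex r d, genDegree r d a ≤ r := by
        rintro (a | ⟨i, j⟩ | j)
        · exact Nat.zero_le _
        · change i.val + 1 ≤ r
          omega
        · exact absurd j.2 (by omega)
      intro a
      have := h3 a
      rw [Nat.add_sub_cancel]
      nlinarith

end TopLocalCohomology

/-! ### Rewriting into the ideal of q-th powers -/

section PowerContainment

variable {r : ℕ} {B : Type*} [CommRing B] {F G : MvPolynomial (Fin (r + 1)) ℤ}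

/-- The forms whose classes lie in an ideal of the subring. -/
def contraction (J : Ideal (subring B F G)) :
    Submodule B (MvPolynomial (Fin 2 ⊕ Fin (r + 1)) B) :=
  ((J.restrictScalars B).map (subring B F G).val.toLinearMap).comap (proj B F G).toLinearMap

theorem mem_contraction {J : Ideal (subring B F G)} {p : MvPolynomial (Fin 2 ⊕ Fin (r + 1)) B} :
    p ∈ contraction J ↔ ∃ y ∈ J, (y : Hypersurface B F G) = proj B F G p := Iff.rfl

theorem equation_mul_mem_contraction (J : Ideal (subring B F G))
    (p : MvPolynomial (Fin 2 ⊕ Fin (r + 1)) B) : p * equation B F G ∈ contraction J :=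
  mem_contraction.2 ⟨0, zero_mem _, by rw [map_mul, proj_equation, mul_zero]; rfl⟩

variable (B F G) in
/-- The ideal generated by the `q`-th powers of the generators which do not involve the last
variable. -/
def powersIdeal (q : ℕ) : Ideal (subring B F G) :=
  Ideal.span {z | ∃ (j : Fin 2) (i : Fin (r + 1)), i ≠ Fin.last r ∧ z = gen B F G j i ^ q}

theorem apply_last_lt_of_ne {d : ℕ} {u : Fin (r + 1) →₀ ℕ} (hu : u.degree = d)
    (h : u ≠ Finsupp.single (Fin.last r) d) : u (Fin.last r) < d := by
  rw [Finsupp.degree_eq_sum, Fin.sum_univ_castSucc] at hu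
  by_contra! hc
  apply h
  have h0 : ∑ i : Fin r, u i.castSucc = 0 := by omega
  rw [Finset.sum_eq_zero_iff] at h0
  ext i
  induction i using Fin.lastCases with
  | last => rw [Finsupp.single_eq_same]; omega
  | cast i =>
    rw [h0 i (Finset.mem_univ i), Finsupp.single_eq_of_ne (Fin.castSucc_lt_last i).ne]

/-- The factor sⱼ^q·xᵢ^q is the q-th power of a generator. The complementary monomial has bidegree
(N−q, N−q), so it again lies in the subring. -/
theorem monomial_mem_contraction_of_le {q N : ℕ} {m : Fin 2 ⊕ Fin (r + 1) →₀ ℕ}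
    (hm : Finsupp.weight bideg m = (N, N)) {j : Fin 2} (hj : q ≤ m (Sum.inl j)) {i : Fin (r + 1)}
    (hi : i ≠ Fin.last r) (hiq : q ≤ m (Sum.inr i)) (c : B) :
    monomial m c ∈ contraction (powersIdeal B F G q) := by
  classical
  obtain ⟨m', rfl⟩ : ∃ m', m = Finsupp.single (Sum.inl j) q + Finsupp.single (Sum.inr i) q + m' := by
    refine ⟨m - (Finsupp.single (Sum.inl j) q + Finsupp.single (Sum.inr i) q),
      (add_tsub_cancel_of_le ?_).symm⟩
    intro l
    rw [Finsupp.add_apply, Finsupp.single_apply, Finsupp.single_apply]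
    rcases l with l | l
    · simp only [Sum.inl.injEq, reduceCtorEq, if_false, add_zero]
      split_ifs with h
      · subst h; exact hj
      · omega
    · simp only [Sum.inr.injEq, reduceCtorEq, if_false, zero_add]
      split_ifs with h
      · subst h; exact hiq
      · omega
  rw [map_add, map_add, Finsupp.weight_single, Finsupp.weight_single] at hm
  obtain ⟨y, -, hy⟩ := exists_grading_eq_proj_monomial B F G (N - q) m' c (by
    rcases h : Finsupp.weight bideg m' with ⟨a, b⟩
    rw [h] at hm
    simp [bideg, Prod.ext_iff] at hm ⊢
    omega)
  refine mem_contraction.2 ⟨gen B F G j i ^ q * y,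
    Ideal.mul_mem_right _ _ (Ideal.subset_span ⟨j, i, hi, rfl⟩), ?_⟩
  rw [MulMemClass.coe_mul, hy, SubmonoidClass.coe_pow, coe_gen, ← map_pow, ← map_mul, mul_pow,
    X_pow_eq_monomial, X_pow_eq_monomial, monomial_mul, monomial_mul]
  simp

variable {d : ℕ} (h : IsNormalized d F G)

include h

/-- Here f counts the available rewritings t·x_kᵈ → s·F + (t·x_kᵈ − t·G). Each one uses at most one
factor t and strictly lowers the exponent of x_k. Once that exponent is at most N − r(q−1) − 1,
pigeonhole gives an exponent ≥ q among the other Xᵢ, and N ≥ 2q − 1 gives one among s, t. -/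
theorem monomial_mem_contraction {q N : ℕ} (hq : 1 ≤ q) (hN : 2 * q - 1 ≤ N)
    (hN' : r * (q - 1) + d ≤ N) (f : ℕ) :
    ∀ (m : Fin 2 ⊕ Fin (r + 1) →₀ ℕ) (c : B), Finsupp.weight bideg m = (N, N) →
      r * (q - 1) + 1 + m (Sum.inr (Fin.last r)) ≤ N + f → f ≤ m (Sum.inl 1) →
        monomial m c ∈ contraction (powersIdeal B F G q) := by
  induction f with
  | zero =>
    intro m c hm h1 _
    have hm' := hm
    rw [weight_bideg, Prod.mk.injEq, Fin.sum_univ_castSucc] at hm'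
    obtain ⟨i, hi⟩ : ∃ i : Fin r, q ≤ m (Sum.inr i.castSucc) := by
      by_contra! hc
      have : ∑ i : Fin r, m (Sum.inr i.castSucc) ≤ ∑ _i : Fin r, (q - 1) :=
        Finset.sum_le_sum fun i _ => Nat.le_sub_one_of_lt (hc i)
      rw [Finset.sum_const, Finset.card_univ, Fintype.card_fin, smul_eq_mul] at this
      omega
    obtain ⟨j, hj⟩ : ∃ j : Fin 2, q ≤ m (Sum.inl j) := by
      by_contra! hc
      have := hc 0
      have := hc 1
      omega
    exact monomial_mem_contraction_of_le hm hj (Fin.castSucc_lt_last i).ne hi c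
  | succ f ih =>
    intro m c hm h1 h2
    by_cases h3 : r * (q - 1) + 1 + m (Sum.inr (Fin.last r)) ≤ N + f
    · exact ih m c hm h3 (by omega)
    classical
    -- Pigeonhole is not yet available, so the exponent of x_k exceeds N − r(q−1), which is at least
    -- d; hence t·x_kᵈ divides the monomial.
    obtain ⟨m', rfl⟩ : ∃ m', m = m' + Finsupp.single (Sum.inl 1) 1 +
        Finsupp.single (Sum.inr (Fin.last r)) d := by
      refine ⟨m - (Finsupp.single (Sum.inl 1) 1 + Finsupp.single (Sum.inr (Fin.last r)) d), ?_⟩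
      rw [add_assoc]
      refine (tsub_add_cancel_of_le ?_).symm
      intro l
      rw [Finsupp.add_apply, Finsupp.single_apply, Finsupp.single_apply]
      rcases l with l | l
      · simp only [Sum.inl.injEq, reduceCtorEq, if_false, add_zero]
        split_ifs with h
        · subst h; omega
        · omega
      · simp only [Sum.inr.injEq, reduceCtorEq, if_false, zero_add]
        split_ifs with h
        · subst h; omega
        · omega
    rw [map_add, map_add, Finsupp.weight_single, Finsupp.weight_single] at hm
    simp only [Finsupp.add_apply, Finsupp.single_eq_same] at h1 h2 h3
    rw [Finsupp.single_eq_of_ne (by simp)] at h1 h2 h3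
    have hw : Finsupp.weight bideg m' + (1, d) = (N, N) := by
      rw [← hm, add_assoc]
      simp [bideg]
    have key : ∀ (j : Fin 2) (u : Fin (r + 1) →₀ ℕ) (b : B), u.degree = d →
        u ≠ Finsupp.single (Fin.last r) d →
        monomial m' c * (X (Sum.inl j) * monomial (Finsupp.mapDomain Sum.inr u) b) ∈
          contraction (powersIdeal B F G q) := by
      intro j u b hu hne
      rw [X, monomial_mul, monomial_mul]
      have hlt := apply_last_lt_of_ne hu hne
      refine ih _ _ ?_ ?_ ?_
      · rw [map_add, map_add, ← hw, Finsupp.weight_single, weight_bideg (Finsupp.mapDomain _ u)]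
        have h0 : ∀ j : Fin 2, Finsupp.mapDomain (Sum.inr : Fin (r + 1) → _) u (Sum.inl j) = 0 :=
          fun j => Finsupp.mapDomain_of_notMem_range _ _ (by simp)
        rw [h0, h0]
        simp only [Finsupp.mapDomain_apply Sum.inr_injective, bideg, ← hu, Finsupp.degree_eq_sum]
        simp
      · simp only [Finsupp.add_apply, Finsupp.mapDomain_apply Sum.inr_injective]
        rw [Finsupp.single_eq_of_ne (by simp)]
        omega
      · simp only [Finsupp.add_apply]
        omega
    have hdeg : ∀ {H : MvPolynomial (Fin (r + 1)) ℤ}, H.IsHomogeneous d → ∀ u ∈ H.support,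
        u.degree = d := by
      intro H hH u hu
      have := hH (mem_support_iff.1 hu)
      rwa [Pi.one_def, ← Finsupp.degree_eq_weight_one] at this
    have hG : lift B G = ∑ u ∈ G.support.erase (Finsupp.single (Fin.last r) d),
        monomial (Finsupp.mapDomain Sum.inr u) ((G.coeff u : ℤ) : B) +
          X (Sum.inr (Fin.last r)) ^ d := by
      rw [lift_eq_sum, ← Finset.sum_erase_add _ _ (mem_support_iff.2 (by
        rw [h.coeff_right]; exact one_ne_zero : G.coeff (Finsupp.single (Fin.last r) d) ≠ 0)),
        h.coeff_right, Finsupp.mapDomain_single, Int.cast_one, X_pow_eq_monomial]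
    have hmon : monomial (m' + Finsupp.single (Sum.inl 1) 1 +
        Finsupp.single (Sum.inr (Fin.last r)) d) c =
        monomial m' c * (X (Sum.inl 0) * lift B F) -
        monomial m' c * (X (Sum.inl 1) * ∑ u ∈ G.support.erase (Finsupp.single (Fin.last r) d),
          monomial (Finsupp.mapDomain Sum.inr u) ((G.coeff u : ℤ) : B)) -
        monomial m' c * equation B F G := by
      rw [equation, hG, monomial_add_single, monomial_add_single, pow_one]
      ring
    rw [hmon]
    refine sub_mem (sub_mem ?_ ?_) (equation_mul_mem_contraction _ _)
    · rw [lift_eq_sum, Finset.mul_sum, Finset.mul_sum]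
      refine Submodule.sum_mem _ fun u hu => key 0 u _ (hdeg h.left u hu) ?_
      rintro rfl
      exact mem_support_iff.1 hu h.coeff_left
    · rw [Finset.mul_sum, Finset.mul_sum]
      refine Submodule.sum_mem _ fun u hu => key 1 u _ (hdeg h.right u (Finset.mem_of_mem_erase hu))
        (Finset.ne_of_mem_erase hu)

/-- Multiplication by `(t x_k)^((d-1)q)` carries forms of degree at least `d` into the ideal of
`q`-th powers. -/
theorem mul_pow_mem_powersIdeal (hr : 2 ≤ r) (hd : r + 1 ≤ d) {q n : ℕ} (hq : 1 ≤ q) (hn : d ≤ n)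
    {x : subring B F G} (hx : x ∈ grading B F G n) :
    x * gen B F G 1 (Fin.last r) ^ ((d - 1) * q) ∈ powersIdeal B F G q := by
  obtain ⟨p, hp, hpx⟩ := exists_bihom_of_mem_grading B F G hx
  have h1 : r * q ≤ (d - 1) * q := Nat.mul_le_mul_right _ (by omega)
  have h2 : 2 * q ≤ r * q := Nat.mul_le_mul_right _ hr
  have h3 : r * (q - 1) + r = r * q := by
    obtain ⟨q, rfl⟩ := Nat.exists_eq_add_of_le' hq
    rw [Nat.add_sub_cancel]; ring
  have key : p * (X (Sum.inl 1) ^ ((d - 1) * q) * X (Sum.inr (Fin.last r)) ^ ((d - 1) * q)) ∈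
      contraction (powersIdeal B F G q) := by
    refine mem_bihom_induction B (a := n) (b := n) (motive := fun p =>
      p * (X (Sum.inl 1) ^ ((d - 1) * q) * X (Sum.inr (Fin.last r)) ^ ((d - 1) * q)) ∈
        contraction (powersIdeal B F G q)) ?_ ?_ ?_ hp
    · rw [zero_mul]; exact zero_mem _
    · intro p p' h h'
      rw [add_mul]
      exact add_mem h h'
    · intro m c hm
      rw [X_pow_eq_monomial, X_pow_eq_monomial, monomial_mul, monomial_mul]
      -- All (d−1)q factors t of the multiplier serve as the budget. They suffice because r(q−1) + 1
      -- ≤ (d−1)q, where k ≤ d enters; n ≥ d supplies the lower bound on N.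
      refine monomial_mem_contraction h hq (N := n + (d - 1) * q) (by omega) (by omega)
        ((d - 1) * q) _ _ ?_ ?_ ?_
      · rw [map_add, map_add, hm, Finsupp.weight_single, Finsupp.weight_single]
        simp [bideg]
      · rw [weight_bideg, Prod.mk.injEq] at hm
        have : m (Sum.inr (Fin.last r)) ≤ n := by
          rw [← hm.2]
          exact Finset.single_le_sum (f := fun i => m (Sum.inr i)) (fun _ _ => Nat.zero_le _)
            (Finset.mem_univ (Fin.last r))
        simp only [Finsupp.add_apply, Finsupp.single_eq_same]
        rw [Finsupp.single_eq_of_ne (by simp)]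
        omega
      · simp only [Finsupp.add_apply, Finsupp.single_eq_same]
        omega
  obtain ⟨y, hy, hy'⟩ := mem_contraction.1 key
  have : x * gen B F G 1 (Fin.last r) ^ ((d - 1) * q) = y := by
    apply Subtype.ext
    rw [hy', MulMemClass.coe_mul, SubmonoidClass.coe_pow, coe_gen, ← hpx, ← map_pow, ← map_mul,
      mul_pow]
  rwa [this]

end PowerContainment

end FormPair

/-! ### Tight closure -/

section TightClosure

theorem comap_mem_minimalPrimes_of_ringEquiv {A B : Type*} [CommRing A] [CommRing B] (e : A ≃+* B)
    {P : Ideal B} (hP : P ∈ minimalPrimes B) : P.comap e ∈ minimalPrimes A := by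
  have hp : P.IsPrime := hP.1.1
  refine ⟨⟨Ideal.comap_isPrime e P, bot_le⟩, fun Q hQ hle => ?_⟩
  have hq : Q.IsPrime := hQ.1
  have h1 : Q.comap e.symm ≤ P := fun x hx => by
    have h2 : e.symm x ∈ P.comap e := hle hx
    rwa [Ideal.mem_comap, RingEquiv.apply_symm_apply] at h2
  intro x hx
  have h2 : e x ∈ Q.comap e.symm := hP.2 ⟨Ideal.comap_isPrime e.symm Q, bot_le⟩ h1 hx
  rwa [Ideal.mem_comap, RingEquiv.symm_apply_apply] at h2

theorem IsWeaklyFRegular.mem_of_mem_tightClosure {p : ℕ} {A B : Type*} [CommRing A] [CommRing B]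
    (h : IsWeaklyFRegular p B) (e : A ≃+* B) {I : Ideal A} {x : A} (hx : x ∈ tightClosure p I) :
    x ∈ I := by
  obtain ⟨c, hc, hcx⟩ := hx
  have h1 : e x ∈ tightClosure p (I.map e) := by
    refine ⟨e c, fun P hP hcP => hc _ (comap_mem_minimalPrimes_of_ringEquiv e hP) hcP, ?_⟩
    filter_upwards [hcx] with q hq
    rw [← map_pow, ← map_mul]
    have h2 : (frobeniusPower I (p ^ q)).map e ≤ frobeniusPower (I.map e) (p ^ q) := by
      rw [frobeniusPower, Ideal.map_span, Ideal.span_le]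
      rintro _ ⟨_, ⟨y, hy, rfl⟩, rfl⟩
      exact Ideal.subset_span ⟨e y, Ideal.mem_map_of_mem _ hy, (map_pow e y _).symm⟩
    exact h2 (Ideal.mem_map_of_mem _ hq)
  rw [h] at h1
  have h2 : e x ∈ I.map e := h1
  rw [Ideal.mem_map_of_equiv] at h2
  obtain ⟨y, hy, hyx⟩ := h2
  rwa [← e.injective hyx]

theorem IsFRegular.mem_of_mem_tightClosure {p : ℕ} {A B : Type*} [CommRing A] [CommRing B]
    (h : IsFRegular p B) (e : A ≃+* B) {I : Ideal A} {x : A} (hx : x ∈ tightClosure p I) :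
    x ∈ I :=
  -- The ring is its own localization at the trivial submonoid.
  (h ⊥).mem_of_mem_tightClosure (e.trans (IsLocalization.atUnits B (⊥ : Submonoid B)
    (S := Localization (⊥ : Submonoid B)) bot_le).toRingEquiv) hx

end TightClosure

namespace FormPair

open MvPolynomial

/-! ### Failure of F-regularity for base changes of R_ℤ -/

section BaseChange

universe u

/-- This puts the multiplier cᵈ into the ideal generated by the image of the degree d piece, where
the containment in the ideal of q-th powers applies. -/
theorem pow_mem_span_map_graded {K R A : Type*} [CommRing K] [CommRing R] [CommRing A] [Algebra K R]
    (𝒜 : ℕ → Submodule K R) [SetLike.GradedMonoid 𝒜] {s : Set R} (hs : s ⊆ 𝒜 1) (ι : R →+* A)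
    {c : A} (hc : c ∈ Ideal.span (ι '' s)) (n : ℕ) : c ^ n ∈ Ideal.span (ι '' 𝒜 n) := by
  have key : Ideal.span (ι '' s) ^ n ≤ Ideal.span (ι '' 𝒜 n) := by
    induction n with
    | zero =>
      rw [pow_zero, Ideal.one_eq_top, top_le_iff, Ideal.eq_top_iff_one]
      exact Ideal.subset_span ⟨1, SetLike.one_mem_graded _, map_one ι⟩
    | succ n ih =>
      rw [pow_succ]
      refine (Ideal.mul_mono ih le_rfl).trans ?_
      rw [Ideal.span_mul_span', Ideal.span_le]
      rintro _ ⟨_, ⟨x, hx, rfl⟩, _, ⟨y, hy, rfl⟩, rfl⟩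
      exact Ideal.subset_span ⟨x * y, SetLike.mul_mem_graded hx (hs hy), map_mul ι x y⟩
  exact key (Ideal.pow_mem_pow hc n)

/-- The ring `A` is the base change of the subring over `ℤ` to `κ`: it is generated by the images
of the generators, and homomorphisms out of the subring extend to it. -/
structure IsBaseChangeOf {k : ℕ} {F G : MvPolynomial (Fin k) ℤ} (κ : Type u) {A : Type*}
    [CommRing κ] [CommRing A] [Algebra κ A] (ι : subring ℤ F G →+* A) : Prop where
  adjoin : Algebra.adjoin κ (Set.range fun ji : Fin 2 × Fin k => ι (gen ℤ F G ji.1 ji.2)) = ⊤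
  exists_lift : ∀ (C : Type u) [CommRing C] [Algebra κ C] (φ : subring ℤ F G →+* C),
    ∃ ψ : A →ₐ[κ] C, ∀ x, ψ (ι x) = φ x

variable {r : ℕ} {κ : Type u} {A : Type*} [CommRing κ] {F G : MvPolynomial (Fin (r + 1)) ℤ}
  [CommRing A] [Algebra κ A] {ι : subring ℤ F G →+* A}

theorem IsBaseChangeOf.isNoetherianRing [IsNoetherianRing κ] (hA : IsBaseChangeOf κ ι) :
    IsNoetherianRing A := by
  have : Algebra.FiniteType κ A := ⟨⟨(Set.finite_range _).toFinset, by
    rw [Set.Finite.coe_toFinset]; exact hA.adjoin⟩⟩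
  exact Algebra.FiniteType.isNoetherianRing κ A

variable (ι) in
/-- The ideal generated by all generators. -/
def genIdeal : Ideal A :=
  Ideal.span (Set.range fun ji : Fin 2 × Fin (r + 1) => ι (gen ℤ F G ji.1 ji.2))

variable (ι) in
/-- The ideal generated by the generators which do not involve the last variable. -/
def initialIdeal : Ideal A :=
  Ideal.span {z | ∃ (j : Fin 2) (i : Fin (r + 1)), i ≠ Fin.last r ∧ z = ι (gen ℤ F G j i)}

theorem IsBaseChangeOf.sub_algebraMap_mem (hA : IsBaseChangeOf κ ι) (x : A) :
    ∃ c : κ, x - algebraMap κ A c ∈ genIdeal ι := by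
  have hx : x ∈ Algebra.adjoin κ
      (Set.range fun ji : Fin 2 × Fin (r + 1) => ι (gen ℤ F G ji.1 ji.2)) := by
    rw [hA.adjoin]; trivial
  induction hx using Algebra.adjoin_induction with
  | mem x hx => exact ⟨0, by rw [map_zero, sub_zero]; exact Ideal.subset_span hx⟩
  | algebraMap c => exact ⟨c, by rw [sub_self]; exact zero_mem _⟩
  | add x y _ _ hx hy =>
    obtain ⟨a, ha⟩ := hx
    obtain ⟨b, hb⟩ := hy
    refine ⟨a + b, ?_⟩
    rw [map_add, add_sub_add_comm]
    exact add_mem ha hb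
  | mul x y _ _ hx hy =>
    obtain ⟨a, ha⟩ := hx
    obtain ⟨b, hb⟩ := hy
    refine ⟨a * b, ?_⟩
    rw [map_mul, show x * y - algebraMap κ A a * algebraMap κ A b =
      y * (x - algebraMap κ A a) + algebraMap κ A a * (y - algebraMap κ A b) by ring]
    exact add_mem (Ideal.mul_mem_left _ _ ha) (Ideal.mul_mem_left _ _ hb)

variable {d : ℕ} (h : IsNormalized d F G)

include h

/-- Let Q be the kernel of the graph map to a polynomial ring. Constant terms show that Q lies in
the ideal of all generators. If a minimal prime P contained that ideal, minimality would force P ≤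
Q, although s x₁ is not in Q. The ring A need not be a domain. -/
theorem genIdeal_not_le_minimalPrimes [IsDomain κ] (hA : IsBaseChangeOf κ ι) {P : Ideal A}
    (hP : P ∈ minimalPrimes A) : ¬ genIdeal ι ≤ P := by
  intro hMP
  let f : Fin (r + 1) → MvPolynomial (Fin (r + 1)) κ := fun i => if i.val < 0 then 0 else X i
  let φ : subring ℤ F G →+* MvPolynomial (Fin (r + 1)) κ :=
    (evalHom (B := ℤ) F G (Sum.elim (fun l => evalInt f (if l = 0 then G else F)) f)
      (by simp [mul_comm])).toRingHom
  have hφ : ∀ j i, φ (gen ℤ F G j i) = evalInt f (if j = 0 then G else F) * X i :=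
    fun j i => evalHom_gen F G _ _ j i
  obtain ⟨ψ, hψ⟩ := hA.exists_lift _ φ
  have hQ : (RingHom.ker ψ).IsPrime := RingHom.ker_isPrime _
  have hc : genIdeal ι ≤ RingHom.ker ((constantCoeff (R := κ)).comp ψ.toRingHom) := by
    rw [genIdeal, Ideal.span_le]
    rintro _ ⟨⟨j, i⟩, rfl⟩
    change constantCoeff (ψ (ι (gen ℤ F G j i))) = 0
    rw [hψ, hφ, map_mul, constantCoeff_X, mul_zero]
  have hQM : RingHom.ker ψ ≤ genIdeal ι := by
    intro x hx
    obtain ⟨c, hc'⟩ := hA.sub_algebraMap_mem x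
    have h1 : constantCoeff (ψ (x - algebraMap κ A c)) = 0 := hc hc'
    rw [map_sub, (RingHom.mem_ker).1 hx, AlgHom.commutes, zero_sub, map_neg, neg_eq_zero,
      algebraMap_eq, constantCoeff_C] at h1
    rwa [h1, map_zero, sub_zero] at hc'
  have h1 : P ≤ RingHom.ker ψ := hP.2 ⟨hQ, bot_le⟩ (hQM.trans hMP)
  have h2 : ι (gen ℤ F G 0 0) ∈ RingHom.ker ψ := h1 (hMP (Ideal.subset_span ⟨(0, 0), rfl⟩))
  rw [RingHom.mem_ker, hψ, hφ] at h2
  exact mul_ne_zero (evalInt_right_ne_zero h (Nat.zero_le r)) (X_ne_zero _) h2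

/-- Prime avoidance over the finitely many minimal primes. -/
theorem exists_mem_genIdeal [IsDomain κ] [IsNoetherianRing κ] (hA : IsBaseChangeOf κ ι) :
    ∃ c ∈ genIdeal ι, ∀ P ∈ minimalPrimes A, c ∉ P := by
  have := hA.isNoetherianRing
  have hfin := minimalPrimes.finite_of_isNoetherianRing A
  by_contra! hc
  have hsub : (genIdeal ι : Set A) ⊆ ⋃ P ∈ (↑hfin.toFinset : Set (Ideal A)), (P : Set A) := by
    intro c hcM
    obtain ⟨P, hP, hcP⟩ := hc c hcM
    simp only [Set.Finite.coe_toFinset, Set.mem_iUnion]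
    exact ⟨P, hP, hcP⟩
  rw [Ideal.subset_union_prime ⊥ ⊥ fun P hP _ _ => (hfin.mem_toFinset.1 hP).1.1] at hsub
  obtain ⟨P, hP, hMP⟩ := hsub
  exact genIdeal_not_le_minimalPrimes h hA (hfin.mem_toFinset.1 hP) hMP

/-- The multiplier is cᵈ with c in the ideal of generators and outside all minimal primes; it works
for every power q = pᵉ. -/
theorem pow_mem_tightClosure [IsDomain κ] [IsNoetherianRing κ] (hA : IsBaseChangeOf κ ι)
    (hr : 2 ≤ r) (hd : r + 1 ≤ d) {p : ℕ} (hp : p.Prime) :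
    ι (gen ℤ F G 1 (Fin.last r)) ^ (d - 1) ∈ tightClosure p (initialIdeal ι) := by
  obtain ⟨c, hc, hcP⟩ := exists_mem_genIdeal h hA
  refine ⟨c ^ d, fun P hP hcd => hcP P hP (hP.1.1.mem_of_pow_mem d hcd),
    Filter.Eventually.of_forall fun e => ?_⟩
  set q := p ^ e
  have hq : 1 ≤ q := Nat.one_le_pow _ _ hp.pos
  rw [← pow_mul]
  have h1 : (powersIdeal ℤ F G q).map ι ≤ frobeniusPower (initialIdeal ι) q := by
    rw [powersIdeal, Ideal.map_span, Ideal.span_le]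
    rintro _ ⟨_, ⟨j, i, hi, rfl⟩, rfl⟩
    rw [map_pow]
    exact Ideal.subset_span ⟨_, Ideal.subset_span ⟨j, i, hi, rfl⟩, rfl⟩
  have h2 : genIdeal ι = Ideal.span (ι '' Set.range fun ji : Fin 2 × Fin (r + 1) =>
      gen ℤ F G ji.1 ji.2) := by
    rw [← Set.range_comp]
    rfl
  rw [h2] at hc
  have h3 := pow_mem_span_map_graded (grading ℤ F G) (by
    rintro _ ⟨⟨j, i⟩, rfl⟩
    exact gen_mem_grading ℤ F G j i) ι hc d
  refine h1 ?_
  generalize c ^ d = z at h3 ⊢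
  induction h3 using Submodule.span_induction with
  | mem x hx =>
    obtain ⟨y, hy, rfl⟩ := hx
    rw [← map_pow, ← map_mul]
    exact Ideal.mem_map_of_mem _ (mul_pow_mem_powersIdeal h hr hd hq le_rfl hy)
  | zero => rw [zero_mul]; exact zero_mem _
  | add x y _ _ hx hy => rw [add_mul]; exact add_mem hx hy
  | smul a x _ hx =>
    rw [smul_eq_mul, mul_assoc]
    exact Ideal.mul_mem_left _ _ hx

/-- Send s ↦ 0, t ↦ 1, x_k ↦ y and the other xᵢ to 0 in κ[y]/(yᵈ). The equation becomes −yᵈ = 0, the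
ideal dies, and y^{d-1} ≠ 0 survives. -/
theorem pow_notMem_initialIdeal [Nontrivial κ] (hA : IsBaseChangeOf κ ι) :
    ι (gen ℤ F G 1 (Fin.last r)) ^ (d - 1) ∉ initialIdeal ι := by
  let C := Polynomial κ ⧸ Ideal.span {(Polynomial.X : Polynomial κ) ^ d}
  let y : C := Ideal.Quotient.mk _ Polynomial.X
  have hy : y ^ d = 0 := by
    rw [← map_pow, Ideal.Quotient.eq_zero_iff_mem]
    exact Ideal.subset_span rfl
  let f : Fin (r + 1) → C := fun i => if i = Fin.last r then y else 0
  let φ : subring ℤ F G →+* C :=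
    (evalHom (B := ℤ) F G (Sum.elim (fun l => if l = 0 then 0 else 1) f) (by
      simp only [Sum.elim_inl, Sum.elim_inr, if_true, zero_mul, one_ne_zero, if_false, one_mul]
      rw [evalInt_of_eq_zero (i := Fin.last r) h.right f fun j hj => if_neg hj,
        show f (Fin.last r) = y from if_pos rfl, hy, mul_zero])).toRingHom
  have hφ : ∀ j i, φ (gen ℤ F G j i) = (if j = 0 then 0 else 1) * f i :=
    fun j i => evalHom_gen F G _ _ j i
  obtain ⟨ψ, hψ⟩ := hA.exists_lift _ φ
  intro hmem
  have h1 : initialIdeal ι ≤ RingHom.ker ψ := by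
    rw [initialIdeal, Ideal.span_le]
    rintro _ ⟨j, i, hi, rfl⟩
    rw [SetLike.mem_coe, RingHom.mem_ker, hψ, hφ, show f i = 0 from if_neg hi, mul_zero]
  have h2 := h1 hmem
  rw [RingHom.mem_ker, map_pow, hψ, hφ, if_neg one_ne_zero, one_mul,
    show f (Fin.last r) = y from if_pos rfl, ← map_pow, Ideal.Quotient.eq_zero_iff_mem,
    Ideal.mem_span_singleton] at h2
  have h3 := h.pos
  rw [Polynomial.X_pow_dvd_iff] at h2
  have := h2 (d - 1) (by omega)
  simp at this

theorem not_isFRegular [IsDomain κ] [IsNoetherianRing κ] (hA : IsBaseChangeOf κ ι)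
    (hr : 2 ≤ r) (hd : r + 1 ≤ d) {p : ℕ} (hp : p.Prime) : ¬ IsFRegular p A := fun hF =>
  pow_notMem_initialIdeal h hA
    (hF.mem_of_mem_tightClosure (RingEquiv.refl A) (pow_mem_tightClosure h hA hr hd hp))

end BaseChange

/-! ### The fibers of R_ℤ -/

section Fiber

variable {k : ℕ} (F G : MvPolynomial (Fin k) ℤ) (κ : Type*) [CommRing κ]

theorem adjoin_gen : Algebra.adjoin ℤ
    (Set.range fun ji : Fin 2 × Fin k => gen ℤ F G ji.1 ji.2) = ⊤ := by
  have h1 := Algebra.adjoin_adjoin_coe_preimage (R := ℤ) (s := Set.range fun ji : Fin 2 × Fin k =>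
    var ℤ F G (Sum.inl ji.1) * var ℤ F G (Sum.inr ji.2))
  rw [eq_top_iff]
  refine h1.ge.trans ?_
  refine Algebra.adjoin_mono ?_
  rintro ⟨x, hx⟩ ⟨⟨j, i⟩, h⟩
  exact ⟨(j, i), Subtype.ext h⟩

theorem isBaseChangeOf_tensorProduct : IsBaseChangeOf κ (A := κ ⊗[ℤ] subring ℤ F G)
    (Algebra.TensorProduct.includeRight : subring ℤ F G →ₐ[ℤ] κ ⊗[ℤ] subring ℤ F G).toRingHom where
  adjoin := by
    have := Algebra.TensorProduct.adjoin_one_tmul_image_eq_top (A := κ) _ (adjoin_gen F G)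
    rw [← Set.range_comp] at this
    exact this
  exists_lift C _ _ φ := ⟨Algebra.TensorProduct.lift (Algebra.ofId κ C)
    { φ with commutes' := fun n => by simp } fun _ _ => Commute.all _ _, fun x => by simp⟩

end Fiber

end FormPair

/-! ### Comparison of two forms of a ring -/

section Comparison

/-- Put ι x = θ b / q whenever q·u x = v b. This is well defined because θ kills the kernel of v and
the integers in W are invertible in T. -/
theorem exists_ringHom_of_forall_exists_mul_eq {B₁ B₂ R T : Type*} [CommRing B₁] [CommRing B₂]
    [CommRing R] [CommRing T] (u : B₁ →+* R) (v : B₂ →+* R) (θ : B₂ →+* T)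
    (hker : ∀ b, v b = 0 → θ b = 0) (W : Submonoid ℤ) (hW : ∀ q ∈ W, IsUnit (q : T))
    (hex : ∀ x, ∃ q ∈ W, ∃ b, (q : R) * u x = v b) :
    ∃ ι : B₁ →+* T, ∀ x, ∀ q ∈ W, ∀ b, (q : R) * u x = v b → (q : T) * ι x = θ b := by
  choose q hq b hb using hex
  have hval : ∀ x, ∃ y : T, (q x : T) * y = θ (b x) := fun x => by
    obtain ⟨w, hw⟩ := (hW _ (hq x)).exists_right_inv
    exact ⟨w * θ (b x), by rw [← mul_assoc, hw, one_mul]⟩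
  choose ι hι using hval
  have key : ∀ x, ∀ q' ∈ W, ∀ b', (q' : R) * u x = v b' → (q' : T) * ι x = θ b' := by
    intro x q' hq' b' hb'
    have h1 : v ((q x : B₂) * b' - (q' : B₂) * b x) = 0 := by
      rw [map_sub, map_mul, map_mul, map_intCast, map_intCast, ← hb', ← hb]
      ring
    have h2 := hker _ h1
    rw [map_sub, map_mul, map_mul, map_intCast, map_intCast, sub_eq_zero] at h2
    apply (hW _ (hq x)).mul_left_cancel
    rw [h2, ← hι]
    ring
  refine ⟨{ toFun := ι, map_one' := ?_, map_mul' := ?_, map_zero' := ?_, map_add' := ?_ }, key⟩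
  · have := key 1 1 W.one_mem 1 (by simp)
    simpa using this
  · intro x y
    have h1 := key (x * y) (q x * q y) (W.mul_mem (hq x) (hq y)) (b x * b y) (by
      rw [map_mul, map_mul, ← hb, ← hb]; push_cast; ring)
    apply (hW _ (W.mul_mem (hq x) (hq y))).mul_left_cancel
    rw [h1, map_mul, ← hι, ← hι]
    push_cast; ring
  · have := key 0 1 W.one_mem 0 (by simp)
    simpa using this
  · intro x y
    have h1 := key (x + y) (q x * q y) (W.mul_mem (hq x) (hq y))
      ((q y : B₂) * b x + (q x : B₂) * b y) (by
      rw [map_add, map_add, map_mul, map_mul, map_intCast, map_intCast, ← hb, ← hb]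
      push_cast; ring)
    apply (hW _ (W.mul_mem (hq x) (hq y))).mul_left_cancel
    rw [h1, map_add, map_mul, map_mul, map_intCast, map_intCast, ← hι, ← hι]
    push_cast; ring

/-- The elements with a multiple in a given subring. -/
def saturation {R : Type*} [CommRing R] (W : Submonoid ℤ) (B : Subring R) : Subring R where
  carrier := {x | ∃ q ∈ W, (q : R) * x ∈ B}
  mul_mem' := by
    rintro x y ⟨q, hq, hx⟩ ⟨q', hq', hy⟩
    refine ⟨q * q', W.mul_mem hq hq', ?_⟩
    rw [show ((q * q' : ℤ) : R) * (x * y) = (q * x) * (q' * y) by push_cast; ring]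
    exact B.mul_mem hx hy
  one_mem' := ⟨1, W.one_mem, by simp⟩
  add_mem' := by
    rintro x y ⟨q, hq, hx⟩ ⟨q', hq', hy⟩
    refine ⟨q * q', W.mul_mem hq hq', ?_⟩
    rw [show ((q * q' : ℤ) : R) * (x + y) = q' * (q * x) + q * (q' * y) by push_cast; ring]
    exact B.add_mem (B.mul_mem (intCast_mem B _) hx) (B.mul_mem (intCast_mem B _) hy)
  zero_mem' := ⟨1, W.one_mem, by simp⟩
  neg_mem' := by
    rintro x ⟨q, hq, hx⟩
    exact ⟨q, hq, by rw [mul_neg]; exact B.neg_mem hx⟩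

/-- A subalgebra of `ℚ` contains the inverses of the denominators of its elements. -/
theorem isUnit_den (A : Subalgebra ℤ ℚ) (a : A) : IsUnit (((a : ℚ).den : ℤ) : A) := by
  have h1 : IsCoprime (a : ℚ).num ((a : ℚ).den : ℤ) :=
    Int.isCoprime_iff_gcd_eq_one.2 (a : ℚ).reduced
  obtain ⟨u, v, huv⟩ := h1
  refine IsUnit.of_mul_eq_one ((u : A) * a + (v : A)) ?_
  apply Subtype.ext
  have h2 : ((a : ℚ).den : ℚ) * a = (a : ℚ).num := Rat.den_mul_eq_num _
  have h3 : (u : ℚ) * (a : ℚ).num + v * ((a : ℚ).den : ℤ) = 1 := by exact_mod_cast huv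
  push_cast at h3 ⊢
  rw [← h3, ← h2]
  ring

theorem isFractionRing_rat (A : Subalgebra ℤ ℚ) : IsFractionRing A ℚ where
  map_units y := by
    rw [isUnit_iff_ne_zero]
    exact fun h => nonZeroDivisors.coe_ne_zero y (Subtype.ext h)
  surj z := by
    refine ⟨⟨(z.num : A), ⟨((z.den : ℤ) : A), mem_nonZeroDivisors_of_ne_zero fun h => ?_⟩⟩, ?_⟩
    · have := congrArg (Subtype.val) h
      simp at this
    · change z * ((z.den : ℤ) : A) = ((z.num : A) : ℚ)
      simp
  exists_of_eq h := ⟨1, by rw [Subtype.ext h]⟩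

end Comparison

namespace FormPair

open MvPolynomial

/-! ### Comparing an arbitrary model of R with R_ℤ -/

section Rational

variable {r : ℕ} (F G : MvPolynomial (Fin (r + 1)) ℤ)

theorem evalHom_of_eq_proj {k : ℕ} {B C : Type*} [CommRing B] [CommRing C] [Algebra B C]
    (F G : MvPolynomial (Fin k) ℤ) (f : Fin 2 ⊕ Fin k → C)
    (hf : f (Sum.inl 0) * evalInt (fun i => f (Sum.inr i)) F =
      f (Sum.inl 1) * evalInt (fun i => f (Sum.inr i)) G) {x : subring B F G}
    {p : MvPolynomial (Fin 2 ⊕ Fin k) B} (h : (x : Hypersurface B F G) = proj B F G p) :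
    evalHom F G f hf x = aeval f p := by
  rw [evalHom, AlgHom.comp_apply, Subalgebra.coe_val, h]
  rfl

/-- The inclusion of the subring over `ℤ` into the hypersurface over `ℚ`. -/
def toRational : subring ℤ F G →+* Hypersurface ℚ F G :=
  (evalHom (B := ℤ) F G (var ℚ F G) (by
    have h := proj_equation ℚ F G
    have h1 := aeval_equation (B := ℚ) F G (var ℚ F G)
    have h2 : aeval (var ℚ F G) = proj ℚ F G := by
      apply MvPolynomial.algHom_ext
      intro l
      rw [aeval_X, proj_X]
    rw [h2, h] at h1
    exact sub_eq_zero.1 h1.symm)).toRingHom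

theorem toRational_gen (j : Fin 2) (i : Fin (r + 1)) :
    toRational F G (gen ℤ F G j i) = (gen ℚ F G j i : Hypersurface ℚ F G) :=
  evalHom_gen F G _ _ j i

theorem toRational_of_eq_proj {x : subring ℤ F G} {p : MvPolynomial (Fin 2 ⊕ Fin (r + 1)) ℤ}
    (h : (x : Hypersurface ℤ F G) = proj ℤ F G p) :
    toRational F G x = proj ℚ F G (map (Int.castRingHom ℚ) p) := by
  have h1 : ∀ p : MvPolynomial (Fin 2 ⊕ Fin (r + 1)) ℤ,
      aeval (var ℚ F G) p = proj ℚ F G (map (Int.castRingHom ℚ) p) := by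
    intro p
    have : (aeval (R := ℤ) (var ℚ F G)).toRingHom =
        (proj ℚ F G).toRingHom.comp (map (Int.castRingHom ℚ)) := by
      apply MvPolynomial.ringHom_ext
      · intro n; simp
      · intro l
        simp [proj_X]
    exact DFunLike.congr_fun this p
  rw [← h1]
  exact evalHom_of_eq_proj F G _ _ h

theorem map_equation : map (Int.castRingHom ℚ) (equation ℤ F G) = equation ℚ F G := by
  simp only [equation, lift, map_sub, map_mul, map_X, map_rename, map_map]
  rfl

theorem exists_natCast_mul_eq_map {σ : Type*} (p : MvPolynomial σ ℚ) :
    ∃ n : ℕ, n ≠ 0 ∧ ∃ q : MvPolynomial σ ℤ, (n : MvPolynomial σ ℚ) * p =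
      map (Int.castRingHom ℚ) q := by
  induction p using MvPolynomial.induction_on with
  | C a =>
    refine ⟨a.den, a.den_nz, C a.num, ?_⟩
    rw [map_C, ← map_natCast (C (σ := σ) (R := ℚ)), ← C_mul]
    congr 1
    simp
  | add p q hp hq =>
    obtain ⟨n, hn, p', hp'⟩ := hp
    obtain ⟨m, hm, q', hq'⟩ := hq
    refine ⟨n * m, mul_ne_zero hn hm, (m : MvPolynomial σ ℤ) * p' + (n : MvPolynomial σ ℤ) * q', ?_⟩
    rw [map_add, map_mul, map_mul, ← hp', ← hq', map_natCast, map_natCast]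
    push_cast; ring
  | mul_X p i hp =>
    obtain ⟨n, hn, p', hp'⟩ := hp
    refine ⟨n, hn, p' * X i, ?_⟩
    rw [map_mul, ← hp', map_X]
    ring

variable {F G} {d : ℕ} (h : IsNormalized d F G)

include h

/-- At S = 0, T = 1, X = (0, …, 0, 1) the equation takes the value −1, so it is primitive. -/
theorem not_C_dvd_equation {l : ℕ} (hl : l.Prime) :
    ¬ (C (l : ℤ) : MvPolynomial (Fin 2 ⊕ Fin (r + 1)) ℤ) ∣ equation ℤ F G := by
  intro hd
  let f : Fin 2 ⊕ Fin (r + 1) → ℤ :=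
    Sum.elim (fun j => if j = 0 then 0 else 1) (fun i => if i = Fin.last r then 1 else 0)
  have h1 := map_dvd (aeval (R := ℤ) f) hd
  rw [aeval_equation, evalInt_of_eq_zero (i := Fin.last r) h.right (fun i => f (Sum.inr i)) fun j hj => if_neg hj,
    h.coeff_right, ← algebraMap_eq, AlgHom.commutes] at h1
  simp only [f, Sum.elim_inl, Sum.elim_inr, if_true, zero_mul, one_ne_zero, if_false, one_mul,
    Int.cast_one, one_pow, zero_sub, dvd_neg, algebraMap_int_eq, eq_intCast, Int.cast_natCast] at h1
  exact hl.one_lt.ne' (Int.natCast_dvd_natCast.1 (by exact_mod_cast h1) |> Nat.dvd_one.1)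

/-- Gauss's argument: a prime number stays prime in the polynomial ring and does not divide the
equation, so it divides the cofactor. -/
theorem equation_dvd_of_dvd_natCast_mul (n : ℕ) (hn : n ≠ 0)
    {p : MvPolynomial (Fin 2 ⊕ Fin (r + 1)) ℤ} :
    equation ℤ F G ∣ (n : MvPolynomial (Fin 2 ⊕ Fin (r + 1)) ℤ) * p → equation ℤ F G ∣ p := by
  induction n using induction_on_primes generalizing p with
  | zero => exact absurd rfl hn
  | one => intro hd; rwa [Nat.cast_one, one_mul] at hd
  | prime_mul l n hl ih =>
    intro hd
    rw [Nat.cast_mul, mul_assoc] at hd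
    refine ih (by rintro rfl; simp at hn) ?_
    obtain ⟨q, hq⟩ := hd
    have hC : (l : MvPolynomial (Fin 2 ⊕ Fin (r + 1)) ℤ) = C (l : ℤ) := by simp
    have hpr : Prime (C (l : ℤ) : MvPolynomial (Fin 2 ⊕ Fin (r + 1)) ℤ) :=
      (prime_C_iff _).2 (Nat.prime_iff_prime_int.1 hl)
    rw [hC] at hq
    obtain ⟨q', rfl⟩ := (hpr.dvd_or_dvd (Dvd.intro _ hq)).resolve_left (not_C_dvd_equation h hl)
    refine ⟨q', ?_⟩
    apply mul_left_cancel₀ hpr.ne_zero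
    rw [hq]; ring

/-- Clear the denominators of the cofactor over ℚ, then cancel the resulting integer by primitivity.
-/
theorem toRational_injective : Function.Injective (toRational F G) := by
  rw [injective_iff_map_eq_zero]
  intro x hx
  obtain ⟨p, hp⟩ := proj_surjective ℤ F G x
  rw [toRational_of_eq_proj F G hp.symm, proj_eq_zero_iff] at hx
  obtain ⟨q, hq⟩ := hx
  obtain ⟨n, hn, q', hq'⟩ := exists_natCast_mul_eq_map q
  have h1 : (n : MvPolynomial (Fin 2 ⊕ Fin (r + 1)) ℤ) * p = equation ℤ F G * q' := by
    apply map_injective (Int.castRingHom ℚ) Int.cast_injective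
    rw [map_mul, map_mul, map_equation, ← hq', hq, map_natCast]
    ring
  apply Subtype.ext
  rw [← hp]
  exact (proj_eq_zero_iff ℤ F G).2 (equation_dvd_of_dvd_natCast_mul h n hn (Dvd.intro _ h1.symm))

omit h in
theorem exists_mul_eq_toRational (x : subring ℚ F G) : ∃ n : ℤ, n ≠ 0 ∧ ∃ c,
    (n : Hypersurface ℚ F G) * x = toRational F G c := by
  let W := nonZeroDivisors ℤ
  suffices hx : (x : Hypersurface ℚ F G) ∈ saturation W (toRational F G).range by
    obtain ⟨q, hq, c, hc⟩ := hx
    exact ⟨q, nonZeroDivisors.ne_zero hq, c, hc.symm⟩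
  refine Algebra.adjoin_induction (p := fun y _ => y ∈ saturation W (toRational F G).range)
    ?_ ?_ ?_ ?_ x.2
  · rintro _ ⟨⟨j, i⟩, rfl⟩
    exact ⟨1, W.one_mem, gen ℤ F G j i, by rw [toRational_gen]; simp; rfl⟩
  · intro a
    refine ⟨a.den, mem_nonZeroDivisors_of_ne_zero (by exact_mod_cast a.den_nz), a.num, ?_⟩
    rw [map_intCast]
    have := congrArg (algebraMap ℚ (Hypersurface ℚ F G)) (Rat.den_mul_eq_num a)
    rw [map_mul, map_natCast, map_intCast] at this
    exact_mod_cast this.symm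
  · intro y z _ _ hy hz
    exact Subring.add_mem _ hy hz
  · intro y z _ _ hy hz
    exact Subring.mul_mem _ hy hz

omit h in
theorem map_mem_of_gen_mem {C : Type*} [CommRing C] (f : subring ℤ F G →+* C) (S : Subring C)
    (hS : ∀ j i, f (gen ℤ F G j i) ∈ S) (c : subring ℤ F G) : f c ∈ S := by
  let T : Subalgebra ℤ (subring ℤ F G) :=
    { (S.comap f).toSubsemiring with
      algebraMap_mem' := fun n => by
        have h0 : algebraMap ℤ (subring ℤ F G) n = n := eq_intCast _ n
        rw [h0]
        exact intCast_mem (S.comap f) n }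
  have h1 : Algebra.adjoin ℤ (Set.range fun ji : Fin 2 × Fin (r + 1) => gen ℤ F G ji.1 ji.2) ≤
      T := by
    rw [Algebra.adjoin_le_iff]
    rintro _ ⟨ji, rfl⟩
    exact hS _ _
  exact h1 (by rw [adjoin_gen]; trivial)

omit h in
theorem exists_ne_zero_forall {α : Type*} (s : Finset α) (P : α → ℤ → Prop)
    (hP : ∀ a m n, P a n → P a (m * n)) (hs : ∀ a ∈ s, ∃ n, n ≠ 0 ∧ P a n) :
    ∃ n : ℤ, n ≠ 0 ∧ ∀ a ∈ s, P a n := by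
  classical
  induction s using Finset.induction_on with
  | empty => exact ⟨1, one_ne_zero, by simp⟩
  | insert a s ha ih =>
    obtain ⟨n, hn, hn'⟩ := ih fun b hb => hs b (Finset.mem_insert_of_mem hb)
    obtain ⟨m, hm, hm'⟩ := hs a (Finset.mem_insert_self _ _)
    refine ⟨m * n, mul_ne_zero hm hn, fun b hb => ?_⟩
    rcases Finset.mem_insert.1 hb with rfl | hb
    · rw [mul_comm]
      exact hP _ _ _ hm'
    · exact hP _ _ _ (hn' b hb)

omit h in
theorem exists_ne_zero_forall_mul_mem {α R : Type*} [CommRing R] (B : Subring R) (s : Finset α)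
    (f : α → R) (hf : ∀ a ∈ s, ∃ n : ℤ, n ≠ 0 ∧ (n : R) * f a ∈ B) :
    ∃ n : ℤ, n ≠ 0 ∧ ∀ a ∈ s, (n : R) * f a ∈ B :=
  exists_ne_zero_forall s (fun a n => (n : R) * f a ∈ B) (fun a m n h => by
    rw [Int.cast_mul, mul_assoc]
    exact B.mul_mem (intCast_mem B _) h) hf

omit h in
theorem exists_intCast_smul_eq {A : Type*} [CommRing A] [Algebra A ℚ] [IsFractionRing A ℚ] {a : A}
    (ha : a ≠ 0) (hden : ∃ q z : ℤ, IsUnit (q : A) ∧ (q : A) * a = z) :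
    ∃ n : ℤ, n ≠ 0 ∧ a ∣ n := by
  obtain ⟨q, z, hq, hz⟩ := hden
  refine ⟨z, ?_, q, by rw [← hz, mul_comm]⟩
  rintro rfl
  rw [Int.cast_zero, hq.mul_right_eq_zero] at hz
  exact ha hz

/-- A form of the subring over a subring of `ℚ` becomes a base change of the subring over `ℤ` at
almost all residue fields. -/
theorem exists_isBaseChangeOf (A : Type) [CommRing A] [IsNoetherianRing A] [Algebra A ℚ]
    [IsFractionRing A ℚ] (hden : ∀ a : A, ∃ q z : ℤ, IsUnit (q : A) ∧ (q : A) * a = z)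
    (RA : Type) [CommRing RA]
    [Algebra A RA] [Algebra.FiniteType A RA] (φ : (ℚ ⊗[A] RA) ≃ₐ[ℚ] subring ℚ F G) :
    ∃ n : ℤ, n ≠ 0 ∧ ∀ (κ : Type) [Field κ] [Algebra A κ], (n : κ) ≠ 0 →
      ∃ ι : subring ℤ F G →+* κ ⊗[A] RA, IsBaseChangeOf κ ι := by
  have hRAN : IsNoetherianRing RA := Algebra.FiniteType.isNoetherianRing A RA
  have hAdom : IsDomain A := (IsFractionRing.injective A ℚ).isDomain
  let ρ : RA →+* Hypersurface ℚ F G := (subring ℚ F G).val.toRingHom.comp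
    (φ.toAlgHom.toRingHom.comp
      (Algebra.TensorProduct.includeRight : RA →ₐ[A] ℚ ⊗[A] RA).toRingHom)
  have hρ : ∀ x, ρ x = (φ (1 ⊗ₜ[A] x) : Hypersurface ℚ F G) := fun x => rfl
  let f : RA →ₗ[A] ℚ ⊗[A] RA := TensorProduct.mk A ℚ RA 1
  have hf : IsLocalizedModule (nonZeroDivisors A) f :=
    (isLocalizedModule_iff_isBaseChange (nonZeroDivisors A) ℚ f).2 (TensorProduct.isBaseChange A RA ℚ)
  have hρ0 : ∀ x : RA, ρ x = 0 → ∃ n : ℤ, n ≠ 0 ∧ (n : RA) * x = 0 := by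
    intro x hx
    have h1 : φ (1 ⊗ₜ[A] x) = 0 := Subtype.ext hx
    rw [EmbeddingLike.map_eq_zero_iff] at h1
    obtain ⟨⟨a, ha0⟩, ha⟩ := (IsLocalizedModule.eq_zero_iff (nonZeroDivisors A) f).1 h1
    obtain ⟨n, hn, b, hb⟩ := exists_intCast_smul_eq (nonZeroDivisors.ne_zero ha0) (hden a)
    refine ⟨n, hn, ?_⟩
    rw [← map_intCast (algebraMap A RA), hb, mul_comm, map_mul, mul_comm (algebraMap A RA a),
      mul_left_comm, mul_comm x, ← Algebra.smul_def a x, show a • x = 0 from ha, mul_zero]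
  have hρ1 : ∀ y : subring ℚ F G, ∃ n : ℤ, n ≠ 0 ∧
      (n : Hypersurface ℚ F G) * y ∈ ρ.range := by
    intro y
    obtain ⟨⟨x, a, ha0⟩, hxa⟩ := IsLocalizedModule.surj (nonZeroDivisors A) f (φ.symm y)
    obtain ⟨n, hn, b, hb⟩ := exists_intCast_smul_eq (nonZeroDivisors.ne_zero ha0) (hden a)
    refine ⟨n, hn, b • x, ?_⟩
    have hxa' : a • φ.symm y = f x := hxa
    have h1 : (n : ℚ ⊗[A] RA) * φ.symm y = 1 ⊗ₜ[A] (b • x) := by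
      rw [← map_intCast (algebraMap A (ℚ ⊗[A] RA)), hb, ← Algebra.smul_def, mul_comm, mul_smul,
        hxa', ← map_smul]
      rfl
    rw [hρ, ← h1, map_mul, map_intCast, AlgEquiv.apply_symm_apply]
    push_cast
    rfl
  -- The kernel of ρ is finitely generated torsion, so one integer n₀ kills it. Next, n₁ brings the
  -- generators of R into the image of ρ, and n₂ brings the images under ρ of the algebra generators
  -- of `RA` into R_ℤ.
  obtain ⟨n₀, hn₀, hker⟩ : ∃ n : ℤ, n ≠ 0 ∧ ∀ x, ρ x = 0 → (n : RA) * x = 0 := by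
    obtain ⟨s, hs⟩ := (IsNoetherian.noetherian (RingHom.ker ρ) : (RingHom.ker ρ).FG)
    obtain ⟨n, hn, hns⟩ := exists_ne_zero_forall s (fun x n => (n : RA) * x = 0)
      (fun a m n h => by rw [Int.cast_mul, mul_assoc, h, mul_zero]) fun x hx =>
        hρ0 x (hs.le (Ideal.subset_span hx) : x ∈ RingHom.ker ρ)
    refine ⟨n, hn, fun x hx => ?_⟩
    have hx' : x ∈ Ideal.span (s : Set RA) := hs.ge hx
    clear hx
    induction hx' using Submodule.span_induction with
    | mem x hx => exact hns x hx
    | zero => rw [mul_zero]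
    | add x y _ _ h1 h2 => rw [mul_add, h1, h2, add_zero]
    | smul a x _ h1 => rw [smul_eq_mul, mul_left_comm, h1, mul_zero]
  obtain ⟨n₁, hn₁, hgen⟩ := exists_ne_zero_forall_mul_mem ρ.range
    (Finset.univ : Finset (Fin 2 × Fin (r + 1)))
    (fun ji => (gen ℚ F G ji.1 ji.2 : Hypersurface ℚ F G)) fun ji _ => hρ1 _
  obtain ⟨s, hs⟩ := (‹Algebra.FiniteType A RA›).out
  obtain ⟨n₂, hn₂, hs'⟩ := exists_ne_zero_forall_mul_mem (toRational F G).range s (fun x => ρ x)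
    fun x _ => by
      obtain ⟨n, hn, c, hc⟩ := exists_mul_eq_toRational (F := F) (G := G) (φ (1 ⊗ₜ[A] x))
      exact ⟨n, hn, c, hc.symm⟩
  refine ⟨n₀ * n₁ * n₂, mul_ne_zero (mul_ne_zero hn₀ hn₁) hn₂, fun κ _ _ hκ => ?_⟩
  push_cast at hκ
  have hκ0 : (n₀ : κ) ≠ 0 := fun h0 => hκ (by rw [h0, zero_mul, zero_mul])
  have hκ1 : (n₁ : κ) ≠ 0 := fun h0 => hκ (by rw [h0, mul_zero, zero_mul])
  have hκ2 : (n₂ : κ) ≠ 0 := fun h0 => hκ (by rw [h0, mul_zero])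
  let W : Submonoid ℤ := (IsUnit.submonoid κ).comap (Int.castRingHom κ)
  have hW : ∀ {C : Type} [CommRing C] [Algebra κ C], ∀ q ∈ W, IsUnit (q : C) := by
    intro C _ _ q hq
    have := IsUnit.map (algebraMap κ C) (show IsUnit (q : κ) from hq)
    rwa [map_intCast] at this
  have hWn : ∀ n : ℤ, (n : κ) ≠ 0 → n ∈ W := fun n hn => isUnit_iff_ne_zero.2 hn
  let π : RA →+* κ ⊗[A] RA := (Algebra.TensorProduct.includeRight : RA →ₐ[A] κ ⊗[A] RA).toRingHom
  have hex1 : ∀ c : subring ℤ F G, ∃ q ∈ W, ∃ b,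
      (q : Hypersurface ℚ F G) * toRational F G c = ρ b := by
    intro c
    suffices hc : toRational F G c ∈ saturation W ρ.range by
      obtain ⟨q, hq, b, hb⟩ := hc
      exact ⟨q, hq, b, hb.symm⟩
    refine map_mem_of_gen_mem (toRational F G) _ (fun j i => ?_) c
    rw [toRational_gen]
    exact ⟨n₁, hWn n₁ hκ1, hgen (j, i) (Finset.mem_univ _)⟩
  have hWden : ∀ a : A, ∃ q ∈ W, ∃ z : ℤ, (q : A) * a = z := by
    intro a
    obtain ⟨q, z, hq, hz⟩ := hden a
    refine ⟨q, ?_, z, hz⟩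
    have := hq.map (algebraMap A κ)
    rwa [map_intCast] at this
  have hex2 : ∀ x : RA, ∃ q ∈ W, ∃ c,
      (q : Hypersurface ℚ F G) * ρ x = toRational F G c := by
    intro x
    suffices hx : ρ x ∈ saturation W (toRational F G).range by
      obtain ⟨q, hq, b, hb⟩ := hx
      exact ⟨q, hq, b, hb.symm⟩
    have hx : x ∈ Algebra.adjoin A (s : Set RA) := by rw [hs]; trivial
    induction hx using Algebra.adjoin_induction with
    | mem x hx => exact ⟨n₂, hWn n₂ hκ2, hs' x hx⟩
    | algebraMap a =>
      obtain ⟨q, hq, z, hz⟩ := hWden a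
      refine ⟨q, hq, z, ?_⟩
      rw [← map_intCast ρ q, ← map_mul, ← map_intCast (algebraMap A RA) q, ← map_mul, hz,
        map_intCast, map_intCast, map_intCast]
    | add x y _ _ hx hy => rw [map_add]; exact Subring.add_mem _ hx hy
    | mul x y _ _ hx hy => rw [map_mul]; exact Subring.mul_mem _ hx hy
  -- Over κ the three integers are units, so R_ℤ maps to the fiber of `RA`; the kernel of ρ dies
  -- there because n₀ is invertible.
  obtain ⟨ι, hι⟩ := exists_ringHom_of_forall_exists_mul_eq (toRational F G) ρ π
    (fun x hx => by
      have h1 := congrArg π (hker x hx)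
      rw [map_mul, map_intCast, map_zero] at h1
      exact (hW n₀ (hWn n₀ hκ0)).mul_right_eq_zero.1 h1) W hW hex1
  refine ⟨ι, ?_, ?_⟩
  · have hιmem : ∀ c, ι c ∈ Algebra.adjoin κ (Set.range fun ji : Fin 2 × Fin (r + 1) =>
        ι (gen ℤ F G ji.1 ji.2)) :=
      map_mem_of_gen_mem ι (Algebra.adjoin κ _).toSubring
        fun j i => Algebra.subset_adjoin ⟨(j, i), rfl⟩
    rw [eq_top_iff]
    rintro t -
    induction t using TensorProduct.induction_on with
    | zero => exact zero_mem _
    | add x y hx hy => exact add_mem hx hy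
    | tmul a x =>
      obtain ⟨q, hq, c, hc⟩ := hex2 x
      have h1 := hι c 1 W.one_mem (q * x) (by
        rw [Int.cast_one, one_mul, map_mul, map_intCast, hc])
      rw [Int.cast_one, one_mul, map_mul, map_intCast] at h1
      have hq' : (q : κ) ≠ 0 := (show IsUnit (q : κ) from hq).ne_zero
      have h2 : a ⊗ₜ[A] x = (a * (q : κ)⁻¹) • ι c := by
        rw [h1, ← map_intCast (algebraMap κ (κ ⊗[A] RA)) q, ← Algebra.smul_def, smul_smul, mul_assoc,
          inv_mul_cancel₀ hq', mul_one]
        change _ = a • ((1 : κ) ⊗ₜ[A] x)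
        rw [TensorProduct.smul_tmul', smul_eq_mul, mul_one]
      rw [h2]
      exact Subalgebra.smul_mem _ (hιmem c) _
  · intro C _ _ θ
    -- In the other direction a homomorphism on R_ℤ is carried to `RA`; here injectivity of R_ℤ into
    -- the rational hypersurface gives the kernel condition.
    obtain ⟨ψ, hψ⟩ := exists_ringHom_of_forall_exists_mul_eq ρ (toRational F G) θ
      (fun x hx => by
        rw [(toRational_injective h) (hx.trans (map_zero _).symm), map_zero]) W hW hex2
    let _ : Algebra A C := ((algebraMap κ C).comp (algebraMap A κ)).toAlgebra
    have : IsScalarTower A κ C := IsScalarTower.of_algebraMap_eq fun _ => rfl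
    let ψ' : RA →ₐ[A] C := { ψ with
      commutes' := fun a => by
        obtain ⟨q, hq, z, hz⟩ := hWden a
        have h1 := hψ (algebraMap A RA a) q hq z (by
          rw [← map_intCast ρ q, ← map_mul, ← map_intCast (algebraMap A RA) q, ← map_mul, hz,
            map_intCast, map_intCast, map_intCast])
        apply (hW (C := C) q hq).mul_left_cancel
        refine h1.trans ?_
        rw [← map_intCast (algebraMap A C) q, ← map_mul, hz, map_intCast, map_intCast] }
    let Ψ : κ ⊗[A] RA →ₐ[κ] C :=
      Algebra.TensorProduct.lift (Algebra.ofId κ C) ψ' fun _ _ => Commute.all _ _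
    have hΨ : ∀ x, Ψ (π x) = ψ x := fun x => by
      change Ψ (1 ⊗ₜ[A] x) = _
      rw [Algebra.TensorProduct.lift_tmul, map_one, one_mul]
      rfl
    refine ⟨Ψ, fun c => ?_⟩
    obtain ⟨q, hq, b, hb⟩ := hex1 c
    have h1 := hι c q hq b hb
    have h2 := hψ b 1 W.one_mem (q * c) (by
      rw [Int.cast_one, one_mul, map_mul, map_intCast, hb])
    apply (hW (C := C) q hq).mul_left_cancel
    rw [Int.cast_one, one_mul, map_mul, map_intCast] at h2
    rw [← h2, ← map_intCast Ψ q, ← map_mul, h1, hΨ]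

end Rational

/-! ### R is not of F-regular type -/

section FRegularType

variable {r : ℕ} {F G : MvPolynomial (Fin (r + 1)) ℤ} {d : ℕ} (h : IsNormalized d F G)

include h

theorem exists_forall_not_isFRegular (hr : 2 ≤ r) (hd : r + 1 ≤ d) (A : Type) [CommRing A]
    [IsNoetherianRing A] [Algebra A ℚ] [IsFractionRing A ℚ]
    (hden : ∀ a : A, ∃ q z : ℤ, IsUnit (q : A) ∧ (q : A) * a = z) (RA : Type) [CommRing RA]
    [Algebra A RA] [Algebra.FiniteType A RA] (φ : (ℚ ⊗[A] RA) ≃ₐ[ℚ] subring ℚ F G) :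
    ∃ n : ℤ, (n : A) ≠ 0 ∧ ∀ μ : Ideal A, μ.IsMaximal → (n : A) ∉ μ → ∀ p : ℕ, p.Prime →
      ¬ IsFRegular p ((A ⧸ μ) ⊗[A] RA) := by
  obtain ⟨n, hn, hκ⟩ := exists_isBaseChangeOf h A hden RA φ
  refine ⟨n, fun h0 => hn ?_, fun μ hμ hnμ p hp => ?_⟩
  · have h1 := congrArg (algebraMap A ℚ) h0
    rw [map_intCast, map_zero] at h1
    exact_mod_cast h1
  · let _ : Field (A ⧸ μ) := Ideal.Quotient.field μ
    obtain ⟨ι, hι⟩ := hκ (A ⧸ μ) (by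
      intro h0
      apply hnμ
      rw [← Ideal.Quotient.eq_zero_iff_mem, map_intCast]
      exact h0)
    exact not_isFRegular h hι hr hd hp

theorem not_isOfFRegularType (hr : 2 ≤ r) (hd : r + 1 ≤ d) :
    ¬ IsOfFRegularType ℚ (subring ℚ F G) := by
  rintro ⟨A, RA, _, _, hA, hRA, ⟨φ⟩, D, hD, hDμ⟩
  have hfr : IsFractionRing A ℚ := isFractionRing_rat A
  have hAN : IsNoetherianRing A := by
    have : Algebra.FiniteType ℤ A := (Subalgebra.fg_iff_finiteType _).1 hA
    exact Algebra.FiniteType.isNoetherianRing ℤ A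
  obtain ⟨n, hn, hκ⟩ := exists_forall_not_isFRegular h hr hd A (fun a =>
    ⟨(a : ℚ).den, (a : ℚ).num, isUnit_den A a, Subtype.ext (by
      push_cast
      exact Rat.den_mul_eq_num _)⟩) RA φ
  -- The open set where n is invertible contains the generic point, so the dense set meets it.
  obtain ⟨μ, hμ, hμD⟩ := hD.inter_open_nonempty _ (PrimeSpectrum.basicOpen (n : A)).isOpen
    ⟨⟨⊥, Ideal.isPrime_bot⟩, fun h0 => hn h0⟩
  obtain ⟨hmax, p, hp, -, hF⟩ := hDμ μ hμD
  exact hκ μ.asIdeal hmax hμ p hp hF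

theorem fiber_tightClosure (hr : 2 ≤ r) (hd : r + 1 ≤ d) (hk : 3 ≤ r + 1) {p : ℕ} (hp : p.Prime) :
    fiberGen F G p 1 (last hk) ^ (d - 1) ∉ fiberIdeal F G hk p ∧
    fiberGen F G p 1 (last hk) ^ (d - 1) ∈ tightClosure p (fiberIdeal F G hk p) ∧
    ¬ IsFRegular p (Fiber F G p) := by
  have := Fact.mk hp
  have hlast : last hk = Fin.last r := Fin.ext (Nat.add_sub_cancel r 1)
  have hι := isBaseChangeOf_tensorProduct F G (ZMod p)
  have h1 := pow_notMem_initialIdeal h hι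
  have h2 := pow_mem_tightClosure h hι hr hd hp
  have h3 := not_isFRegular h hι hr hd hp
  rw [fiberIdeal, hlast]
  exact ⟨h1, h2, h3⟩

end FRegularType

/-! ### Regularity of quotients and of charts -/

section RegularQuotient

open IsLocalRing

/-- The quotient of a regular local ring by an element of the maximal ideal that does not lie in
its square is regular. -/
theorem isRegularLocalRing_quotient {A : Type*} [CommRing A] [IsRegularLocalRing A] {f : A}
    (hf : f ∈ maximalIdeal A) (hf2 : f ∉ maximalIdeal A ^ 2) :
    IsRegularLocalRing (A ⧸ Ideal.span {f}) := by
  classical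
  have hle : Ideal.span {f} ≤ maximalIdeal A := (Ideal.span_singleton_le_iff_mem _).2 hf
  have : Nontrivial (A ⧸ Ideal.span {f}) :=
    Ideal.Quotient.nontrivial_iff.2 (ne_top_of_le_ne_top (maximalIdeal.isMaximal A).ne_top hle)
  have : IsLocalRing (A ⧸ Ideal.span {f}) :=
    IsLocalRing.of_surjective' _ Ideal.Quotient.mk_surjective
  apply IsRegularLocalRing.of_spanFinrank_maximalIdeal_le
  set x : maximalIdeal A := ⟨f, hf⟩
  set v : CotangentSpace A := (maximalIdeal A).toCotangent x
  have hv : v ≠ 0 := fun h => hf2 (((maximalIdeal A).toCotangent_eq_zero x).1 h)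
  have hli : LinearIndepOn (ResidueField A) id ({v} : Set (CotangentSpace A)) :=
    (linearIndepOn_singleton_iff _).2 hv
  set t := hli.extend (Set.subset_univ _)
  have hvt : v ∈ t := Module.Basis.subset_extend hli rfl
  have htfin : t.Finite := Module.Finite.finite_basis (Module.Basis.extend hli)
  have htcard : t.ncard = Module.finrank (ResidueField A) (CotangentSpace A) :=
    (Module.finrank_eq_nat_card_basis (Module.Basis.extend hli)).symm
  have htspan : Submodule.span (ResidueField A) t = ⊤ := by
    rw [hli.span_extend_eq_span, Submodule.span_univ]
  have hsurj := (maximalIdeal A).toCotangent_surjective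
  -- Since f ∉ m², its class extends to a basis of the cotangent space; lifting the other basis
  -- vectors generates m together with f. So the embedding dimension drops by at least one, while
  -- the Krull dimension drops by at most one.
  set w := Function.surjInv hsurj
  set u : Set A := Subtype.val '' (w '' (t \ {v}))
  have hgen : maximalIdeal A = Ideal.span (insert f u) := by
    have h1 : Submodule.span A (insert x (w '' (t \ {v}))) = ⊤ := by
      rw [← CotangentSpace.span_image_eq_top_iff, eq_top_iff, ← htspan]
      apply Submodule.span_mono
      intro y hy
      by_cases hyv : y = v
      · exact ⟨x, Set.mem_insert _ _, hyv.symm⟩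
      · exact ⟨w y, Set.mem_insert_of_mem _ ⟨y, ⟨hy, hyv⟩, rfl⟩, Function.surjInv_eq hsurj y⟩
    have h2 := congrArg (Submodule.map (maximalIdeal A).subtype) h1
    rw [Submodule.map_span, Submodule.map_top, Submodule.range_subtype, Set.image_insert_eq] at h2
    exact h2.symm
  have hgen' : maximalIdeal (A ⧸ Ideal.span {f}) =
      Ideal.span (Ideal.Quotient.mk (Ideal.span {f}) '' u) := by
    have h1 : (maximalIdeal (A ⧸ Ideal.span {f})).comap (Ideal.Quotient.mk (Ideal.span {f})) =
        maximalIdeal A :=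
      have := Ideal.comap_isMaximal_of_surjective (Ideal.Quotient.mk (Ideal.span {f}))
        Ideal.Quotient.mk_surjective (K := maximalIdeal (A ⧸ Ideal.span {f}))
      IsLocalRing.eq_maximalIdeal this
    rw [← Ideal.map_comap_of_surjective _ Ideal.Quotient.mk_surjective
      (maximalIdeal (A ⧸ Ideal.span {f})), h1, hgen, Ideal.map_span, Set.image_insert_eq,
      Ideal.Quotient.eq_zero_iff_mem.2 (Ideal.mem_span_singleton_self f)]
    exact Submodule.span_insert_zero
  have hufin : u.Finite := ((htfin.sdiff).image _).image _
  have hcard : (maximalIdeal (A ⧸ Ideal.span {f})).spanFinrank + 1 ≤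
      Module.finrank (ResidueField A) (CotangentSpace A) := by
    rw [hgen', ← htcard, ← Set.ncard_sdiff_singleton_add_one hvt htfin]
    refine Nat.add_le_add_right ((Submodule.spanFinrank_span_le_ncard_of_finite
      (hufin.image _)).trans ?_) 1
    refine (Set.ncard_image_le hufin).trans ((Set.ncard_image_le (htfin.sdiff.image _)).trans ?_)
    exact Set.ncard_image_le htfin.sdiff
  have hdim : ringKrullDim A ≤ ringKrullDim (A ⧸ Ideal.span {f}) + 1 := by
    have := ringKrullDim_le_ringKrullDim_quotient_add_encard ({f} : Set A) (by
      rw [Set.singleton_subset_iff, SetLike.mem_coe, IsLocalRing.ringJacobson_eq_maximalIdeal]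
      exact hf)
    rwa [Set.encard_singleton] at this
  have h3 := (IsRegularLocalRing.iff_finrank_cotangentSpace A).1 inferInstance
  have h4 : (((maximalIdeal (A ⧸ Ideal.span {f})).spanFinrank : ℕ) : WithBot ℕ∞) + 1 ≤
      ringKrullDim (A ⧸ Ideal.span {f}) + 1 := by
    refine le_trans ?_ hdim
    rw [← h3]
    exact_mod_cast hcard
  exact ENat.WithBot.add_le_add_one_right_iff.1 h4

/-- A local ring of `R` is regular if it can be computed on a hypersurface `B/(f)` in a regular
scheme that is nonsingular at the corresponding point. -/
theorem isRegularLocalRing_of_chart {R B : Type*} [CommRing R] [CommRing B] [IsRegularRing B]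
    (P : Ideal R) [P.IsPrime] (f : B) (Θ : R →+* B ⧸ Ideal.span {f})
    (ψ : B ⧸ Ideal.span {f} →+* Localization.AtPrime P)
    (hψ : ∀ a, ψ (Θ a) = algebraMap R _ a)
    (hΘ : ∀ x, ∃ u, IsUnit (ψ u) ∧ ∃ a, Θ a = u * x)
    (hf : ∀ c, IsUnit (ψ (Ideal.Quotient.mk _ c)) →
      c * f ∉ ((maximalIdeal (Localization.AtPrime P)).comap
        (ψ.comp (Ideal.Quotient.mk (Ideal.span {f})))) ^ 2) :
    IsRegularLocalRing (Localization.AtPrime P) := by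
  set φ : B →+* Localization.AtPrime P := ψ.comp (Ideal.Quotient.mk (Ideal.span {f}))
  set Q := (maximalIdeal (Localization.AtPrime P)).comap φ
  have hQ : Q.IsPrime := Ideal.IsPrime.comap φ
  have hunit : ∀ c, IsUnit (φ c) ↔ c ∉ Q := fun c => by
    rw [Ideal.mem_comap, mem_maximalIdeal, mem_nonunits_iff, not_not]
  have hφf : φ f = 0 := by
    have : Ideal.Quotient.mk (Ideal.span {f}) f = 0 :=
      Ideal.Quotient.eq_zero_iff_mem.2 (Ideal.mem_span_singleton_self f)
    rw [RingHom.comp_apply, this, map_zero]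
  let ρ : Localization.AtPrime Q →+* Localization.AtPrime P :=
    IsLocalization.lift (M := Q.primeCompl) (g := φ) fun y => (hunit y).2 y.2
  have hρ : ∀ b, ρ (algebraMap B _ b) = φ b := fun b => IsLocalization.lift_eq _ b
  have hρs : Function.Surjective ρ := by
    intro y
    obtain ⟨a, s, rfl⟩ := IsLocalization.exists_mk'_eq P.primeCompl y
    obtain ⟨b, hb⟩ := Ideal.Quotient.mk_surjective (Θ a)
    obtain ⟨c, hc⟩ := Ideal.Quotient.mk_surjective (Θ s)
    have hb' : φ b = algebraMap R _ a := by rw [← hψ, ← hb]; rfl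
    have hc' : φ c = algebraMap R _ s := by rw [← hψ, ← hc]; rfl
    have hcQ : c ∉ Q := by
      rw [← hunit, hc']
      exact IsLocalization.map_units _ s
    refine ⟨IsLocalization.mk' _ b (⟨c, hcQ⟩ : Q.primeCompl), ?_⟩
    rw [IsLocalization.eq_mk'_iff_mul_eq, ← hc', ← hρ, ← map_mul]
    have := IsLocalization.mk'_spec (Localization.AtPrime Q) b (⟨c, hcQ⟩ : Q.primeCompl)
    rw [this, hρ, hb']
  have hker : RingHom.ker ρ = Ideal.span {algebraMap B (Localization.AtPrime Q) f} := by
    apply le_antisymm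
    · intro y hy
      obtain ⟨b, s, rfl⟩ := IsLocalization.exists_mk'_eq Q.primeCompl y
      have hb : φ b = 0 := by
        have h1 := IsLocalization.mk'_spec (Localization.AtPrime Q) b s
        rw [← hρ, ← h1, map_mul, RingHom.mem_ker.1 hy, zero_mul]
      obtain ⟨u, hu, a, ha⟩ := hΘ (Ideal.Quotient.mk _ b)
      have ha0 : algebraMap R (Localization.AtPrime P) a = 0 := by
        rw [← hψ, ha, map_mul]
        exact mul_eq_zero_of_right _ hb
      obtain ⟨q, hq⟩ := (IsLocalization.map_eq_zero_iff P.primeCompl _ a).1 ha0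
      obtain ⟨c, hc⟩ := Ideal.Quotient.mk_surjective (Θ q * u)
      have hc' : IsUnit (φ c) := by
        have : φ c = ψ (Θ q * u) := by rw [← hc]; rfl
        rw [this, map_mul, hψ]
        exact (IsLocalization.map_units _ q).mul hu
      have hcb : c * b ∈ Ideal.span {f} := by
        rw [← Ideal.Quotient.eq_zero_iff_mem, map_mul, hc, mul_assoc, ← ha, ← map_mul, hq, map_zero]
      have h2 : algebraMap B (Localization.AtPrime Q) (c * b) ∈
          Ideal.span {algebraMap B (Localization.AtPrime Q) f} := by
        rw [← Set.image_singleton, ← Ideal.map_span]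
        exact Ideal.mem_map_of_mem _ hcb
      rw [map_mul] at h2
      have hcu : IsUnit (algebraMap B (Localization.AtPrime Q) c) :=
        IsLocalization.map_units _ (⟨c, (hunit c).1 hc'⟩ : Q.primeCompl)
      rw [Ideal.unit_mul_mem_iff_mem _ hcu] at h2
      rw [IsLocalization.mk'_eq_mul_mk'_one]
      exact Ideal.mul_mem_right _ _ h2
    · rw [Ideal.span_singleton_le_iff_mem, RingHom.mem_ker, hρ, hφf]
  have hreg : IsRegularLocalRing
      (Localization.AtPrime Q ⧸ Ideal.span {algebraMap B (Localization.AtPrime Q) f}) := by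
    have hm : maximalIdeal (Localization.AtPrime Q) = Q.map (algebraMap B _) :=
      (Localization.AtPrime.map_eq_maximalIdeal).symm
    apply isRegularLocalRing_quotient
    · rw [hm]
      apply Ideal.mem_map_of_mem
      rw [Ideal.mem_comap, hφf]
      exact zero_mem _
    · rw [hm, ← Ideal.map_pow, IsLocalization.algebraMap_mem_map_algebraMap_iff Q.primeCompl]
      rintro ⟨c, hc, hcf⟩
      exact hf c ((hunit c).2 hc) hcf
  rw [← hker] at hreg
  exact IsRegularLocalRing.of_ringEquiv (RingHom.quotientKerEquivOfSurjective hρs)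

end RegularQuotient

/-! ### The Jacobian criterion on the charts -/

section Jacobian

variable {k : ℕ} (F G : MvPolynomial (Fin k) ℤ)

/-- The ideal generated by `F`, `G` and the `2 × 2` minors of their Jacobian matrix. -/
def singularIdeal : Ideal (MvPolynomial (Fin k) ℤ) :=
  Ideal.span ({F, G} ∪ Set.range fun ab : Fin k × Fin k =>
    pderiv ab.1 F * pderiv ab.2 G - pderiv ab.2 F * pderiv ab.1 G)

theorem left_mem_singularIdeal : F ∈ singularIdeal F G := Ideal.subset_span (by simp)

theorem right_mem_singularIdeal : G ∈ singularIdeal F G := Ideal.subset_span (by simp)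

theorem minor_mem_singularIdeal (a b : Fin k) :
    pderiv a F * pderiv b G - pderiv b F * pderiv a G ∈ singularIdeal F G :=
  Ideal.subset_span (Or.inr ⟨(a, b), rfl⟩)

theorem pderiv_evalInt {K τ : Type*} [CommRing K] (y : Fin k → MvPolynomial τ K) (v : τ)
    (H : MvPolynomial (Fin k) ℤ) :
    pderiv v (evalInt y H) = ∑ l, evalInt y (pderiv l H) * pderiv v (y l) := by
  classical
  induction H using MvPolynomial.induction_on with
  | C n =>
    have : evalInt y (C n) = C (n : K) := by simp [evalInt]
    rw [this]
    simp
  | add p q hp hq => simp only [map_add, hp, hq, add_mul, Finset.sum_add_distrib]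
  | mul_X p a hp =>
    simp only [map_mul, Derivation.leibniz, smul_eq_mul, hp, map_add, evalInt_X, add_mul,
      Finset.sum_add_distrib]
    congr 1
    · rw [Finset.sum_eq_single a]
      · simp
      · intro b _ hb
        simp [pderiv_X, hb.symm]
      · simp
    · rw [Finset.mul_sum]
      exact Finset.sum_congr rfl fun l _ => by ring

theorem derivation_mem_of_mem_sq {K A : Type*} [CommRing K] [CommRing A] [Algebra K A]
    (D : Derivation K A A) {I : Ideal A} {x : A} (hx : x ∈ I ^ 2) : D x ∈ I := by
  rw [pow_two] at hx
  induction hx using Submodule.mul_induction_on' with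
  | mem_mul_mem a ha b hb =>
    rw [D.leibniz]
    exact add_mem (I.mul_mem_right _ ha) (I.mul_mem_right _ hb)
  | add a _ b _ ha hb =>
    rw [map_add]
    exact add_mem ha hb

/-- The dehomogenized coordinates on the chart where the `i`th coordinate is invertible. -/
def chartCoord (i : Fin k) (l : Fin k) : MvPolynomial (Option (Fin k)) ℚ :=
  if l = i then 1 else X (some l)

/-- The dehomogenized `S`, `T` on the chart where the `j`th of them is invertible. -/
def chartParam (j l : Fin 2) : MvPolynomial (Option (Fin k)) ℚ := if l = j then 1 else X none

/-- The equation of the chart. -/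
def chartEquation (j : Fin 2) (i : Fin k) : MvPolynomial (Option (Fin k)) ℚ :=
  chartParam j 0 * evalInt (chartCoord i) F - chartParam j 1 * evalInt (chartCoord i) G

variable {F G} {d : ℕ}

theorem pderiv_none_chart (i : Fin k) (H : MvPolynomial (Fin k) ℤ) :
    pderiv none (evalInt (chartCoord i) H) = 0 := by
  rw [pderiv_evalInt]
  refine Finset.sum_eq_zero fun l _ => ?_
  unfold chartCoord
  split_ifs <;> simp [pderiv_X]

theorem pderiv_some_chart {i a : Fin k} (ha : a ≠ i) (H : MvPolynomial (Fin k) ℤ) :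
    pderiv (some a) (evalInt (chartCoord i) H) = evalInt (chartCoord i) (pderiv a H) := by
  classical
  rw [pderiv_evalInt, Finset.sum_eq_single a]
  · simp [chartCoord, ha]
  · intro b _ hb
    unfold chartCoord
    split_ifs <;> simp [pderiv_X, hb.symm]
  · simp

/-- At a singular point of σF − τG = 0, with σ or τ equal to 1, the derivative in the remaining
parameter gives F = G = 0. The other derivatives give σ∂ₐF = τ∂ₐG for a ≠ i, Euler's formula gives
it for a = i, and eliminating σ, τ makes the minors vanish. -/
theorem evalInt_mem_of_mem_singularIdeal (hF : F.IsHomogeneous d) (hG : G.IsHomogeneous d)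
    (j : Fin 2) (i : Fin k) {Q : Ideal (MvPolynomial (Option (Fin k)) ℚ)} [Q.IsPrime]
    (hf : chartEquation F G j i ∈ Q) (hD : ∀ v, pderiv v (chartEquation F G j i) ∈ Q) :
    singularIdeal F G ≤ Q.comap (evalInt (chartCoord i)) := by
  set y := chartCoord i
  have hj : (chartParam j j : MvPolynomial (Option (Fin k)) ℚ) = 1 := if_pos rfl
  have h0 := hD none
  rw [chartEquation, map_sub, Derivation.leibniz, Derivation.leibniz, pderiv_none_chart,
    pderiv_none_chart, smul_zero, smul_zero, zero_add, zero_add] at h0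
  have hFG : evalInt y F ∈ Q ∧ evalInt y G ∈ Q := by
    unfold chartEquation at hf
    fin_cases j
    · simp [chartParam] at h0 hf
      refine ⟨?_, h0⟩
      simpa using add_mem hf (Q.mul_mem_left (X none) h0)
    · simp [chartParam] at h0 hf
      refine ⟨h0, ?_⟩
      simpa using sub_mem (Q.mul_mem_left (X none) h0) hf
  have h1 : ∀ a, a ≠ i → chartParam j 0 * evalInt y (pderiv a F) -
      chartParam j 1 * evalInt y (pderiv a G) ∈ Q := by
    intro a ha
    have h2 := hD (some a)
    have h3 : ∀ l, pderiv (some a) (chartParam j l) = 0 := by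
      intro l
      unfold chartParam
      split_ifs <;> simp [pderiv_X]
    rw [chartEquation, map_sub, Derivation.leibniz, Derivation.leibniz, pderiv_some_chart ha,
      pderiv_some_chart ha, h3, h3, smul_zero, smul_zero, add_zero, add_zero] at h2
    exact h2
  have hE : ∀ {H : MvPolynomial (Fin k) ℤ}, H.IsHomogeneous d → evalInt y H ∈ Q →
      ∑ l, y l * evalInt y (pderiv l H) ∈ Q := by
    intro H hH hHQ
    have h2 := congrArg (evalInt y) hH.sum_X_mul_pderiv
    rw [map_sum, map_nsmul] at h2
    simp only [map_mul, evalInt_X] at h2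
    rw [h2]
    exact nsmul_mem hHQ d
  -- The coordinate y i equals 1, so no derivative is taken in that direction; Euler's formula
  -- recovers it from the others.
  have h4 : ∀ a, chartParam j 0 * evalInt y (pderiv a F) -
      chartParam j 1 * evalInt y (pderiv a G) ∈ Q := by
    intro a
    by_cases ha : a = i
    · subst ha
      have h5 : ∑ l, y l * (chartParam j 0 * evalInt y (pderiv l F) -
          chartParam j 1 * evalInt y (pderiv l G)) ∈ Q := by
        have := sub_mem (Q.mul_mem_left (chartParam j 0) (hE hF hFG.1))
          (Q.mul_mem_left (chartParam j 1) (hE hG hFG.2))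
        rw [Finset.mul_sum, Finset.mul_sum, ← Finset.sum_sub_distrib] at this
        refine (Finset.sum_congr rfl fun l _ => ?_).subst (motive := (· ∈ Q)) this
        ring
      rw [← Finset.add_sum_erase _ _ (Finset.mem_univ a)] at h5
      have h6 : y a = 1 := if_pos rfl
      rw [h6, one_mul] at h5
      refine (Q.add_mem_iff_left (sum_mem fun l hl => ?_)).1 h5
      exact Q.mul_mem_left _ (h1 l (Finset.ne_of_mem_erase hl))
    · exact h1 a ha
  rw [singularIdeal, Ideal.span_le]
  rintro _ ((rfl | rfl) | ⟨⟨a, b⟩, rfl⟩)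
  · exact hFG.1
  · exact hFG.2
  · change evalInt y (pderiv a F * pderiv b G - pderiv b F * pderiv a G) ∈ Q
    have ha := h4 a
    have hb := h4 b
    rw [map_sub, map_mul, map_mul]
    generalize evalInt y (pderiv a F) = Fa at *
    generalize evalInt y (pderiv b F) = Fb at *
    generalize evalInt y (pderiv a G) = Ga at *
    generalize evalInt y (pderiv b G) = Gb at *
    have h7 := sub_mem (Q.mul_mem_left Gb ha) (Q.mul_mem_left Ga hb)
    have h8 := sub_mem (Q.mul_mem_left Fb ha) (Q.mul_mem_left Fa hb)
    have hj' : j = 0 ∨ j = 1 := by omega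
    rcases hj' with rfl | rfl
    · rw [hj] at h7
      convert h7 using 1; ring
    · rw [hj] at h8
      convert h8 using 1; ring

/-- A derivation maps Q² into Q. So if c·f ∈ Q² with f ∈ Q and c ∉ Q, all derivatives of f lie in Q.
Then Q contains the singular ideal, hence the nonzero rational number to which n·Xᵢᴺ specializes at
Xᵢ = 1. -/
theorem mul_chartEquation_notMem_sq (hF : F.IsHomogeneous d) (hG : G.IsHomogeneous d)
    (j : Fin 2) (i : Fin k)
    (hsing : ∃ N : ℕ, ∃ n : ℤ, n ≠ 0 ∧ C n * X i ^ N ∈ singularIdeal F G)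
    (Q : Ideal (MvPolynomial (Option (Fin k)) ℚ)) [Q.IsPrime]
    (hf : chartEquation F G j i ∈ Q) {c : MvPolynomial (Option (Fin k)) ℚ} (hc : c ∉ Q) :
    c * chartEquation F G j i ∉ Q ^ 2 := by
  intro h
  obtain ⟨N, n, hn, hmem⟩ := hsing
  have hD : ∀ v, pderiv v (chartEquation F G j i) ∈ Q := by
    intro v
    have h1 := derivation_mem_of_mem_sq (pderiv v) h
    rw [Derivation.leibniz, smul_eq_mul, smul_eq_mul] at h1
    exact (Ideal.IsPrime.mem_or_mem ‹_›
      ((Q.add_mem_iff_left (Q.mul_mem_right _ hf)).1 h1)).resolve_left hc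
  have h1 := evalInt_mem_of_mem_singularIdeal hF hG j i hf hD hmem
  rw [Ideal.mem_comap, map_mul, map_pow, evalInt_X, chartCoord, if_pos rfl, one_pow, mul_one] at h1
  have h2 : evalInt (chartCoord i) (C n) = C (n : ℚ) := by simp [evalInt]
  rw [h2] at h1
  refine (Ideal.IsPrime.ne_top ‹_›) (Ideal.eq_top_of_isUnit_mem _ h1 ?_)
  exact (IsUnit.mk0 _ (Int.cast_ne_zero.2 hn)).map C

end Jacobian

/-! ### Charts of R away from the irrelevant ideal -/

section Chart

variable {k : ℕ} {F G : MvPolynomial (Fin k) ℤ} {d : ℕ}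

theorem evalInt_smul {C : Type*} [CommRing C] {H : MvPolynomial (Fin k) ℤ} (hH : H.IsHomogeneous d)
    (c : C) (f : Fin k → C) : evalInt (fun i => c * f i) H = c ^ d * evalInt f H := by
  rw [evalInt, evalInt, coe_eval₂Hom, coe_eval₂Hom, eval₂_eq', eval₂_eq', Finset.mul_sum]
  refine Finset.sum_congr rfl fun m hm => ?_
  have h1 : ∑ i, m i = d := by
    have := hH (mem_support_iff.1 hm)
    rwa [Finsupp.weight_apply, Finsupp.sum_fintype _ _ (by simp), Finset.sum_congr rfl
      (fun i _ => by rw [Pi.one_apply, smul_eq_mul, mul_one])] at this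
  simp only [mul_pow, Finset.prod_mul_distrib, Finset.prod_pow_eq_pow_sum, h1]
  ring

theorem gen_mul_gen_comm (B : Type*) [CommRing B] (F G : MvPolynomial (Fin k) ℤ) (j l : Fin 2)
    (i m : Fin k) : gen B F G l i * gen B F G j m = gen B F G l m * gen B F G j i := by
  apply Subtype.ext
  simp only [MulMemClass.coe_mul, gen]
  ring

/-- The defining equation multiplied by xᵢ and the d-th power of s or t, so that it can be written
in the generators. -/
theorem gen_mul_evalInt (B : Type*) [CommRing B] (hF : F.IsHomogeneous d) (hG : G.IsHomogeneous d)
    (j : Fin 2) (i : Fin k) :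
    gen B F G 0 i * evalInt (gen B F G j) F = gen B F G 1 i * evalInt (gen B F G j) G := by
  have h1 : ∀ H : MvPolynomial (Fin k) ℤ, H.IsHomogeneous d →
      ((evalInt (gen B F G j) H : subring B F G) : Hypersurface B F G) =
        var B F G (Sum.inl j) ^ d * evalInt (fun i => var B F G (Sum.inr i)) H := by
    intro H hH
    rw [← evalInt_smul hH]
    exact map_evalInt (subring B F G).val.toRingHom _ H
  have h2 : var B F G (Sum.inl 0) * evalInt (fun i => var B F G (Sum.inr i)) F =
      var B F G (Sum.inl 1) * evalInt (fun i => var B F G (Sum.inr i)) G := by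
    rw [← sub_eq_zero, ← aeval_equation (B := B)]
    have h3 : aeval (var B F G) = proj B F G := by
      apply MvPolynomial.algHom_ext
      intro l
      rw [aeval_X, proj_X]
    rw [h3, proj_equation]
  apply Subtype.ext
  rw [MulMemClass.coe_mul, MulMemClass.coe_mul, h1 F hF, h1 G hG]
  simp only [gen]
  linear_combination var B F G (Sum.inr i) * var B F G (Sum.inl j) ^ d * h2

/-- The chart of the hypersurface on which the `i`th coordinate and the `j`th of `S`, `T` are
invertible. -/
abbrev Chart (F G : MvPolynomial (Fin k) ℤ) (j : Fin 2) (i : Fin k) : Type :=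
  MvPolynomial (Option (Fin k)) ℚ ⧸ Ideal.span {chartEquation F G j i}

/-- The projection to the coordinate ring of the chart. -/
def chartProj (F G : MvPolynomial (Fin k) ℤ) (j : Fin 2) (i : Fin k) :
    MvPolynomial (Option (Fin k)) ℚ →ₐ[ℚ] Chart F G j i := Ideal.Quotient.mkₐ ℚ _

theorem chartProj_chartEquation (j : Fin 2) (i : Fin k) :
    chartProj F G j i (chartEquation F G j i) = 0 :=
  Ideal.Quotient.eq_zero_iff_mem.2 (Ideal.mem_span_singleton_self _)

/-- The generators of the subring, in the coordinates of a chart. -/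
def toChart (F G : MvPolynomial (Fin k) ℤ) (j : Fin 2) (i : Fin k) :
    subring ℚ F G →ₐ[ℚ] Chart F G j i :=
  evalHom F G (Sum.elim (fun l => chartProj F G j i (X (some i) * chartParam j l))
    (fun l => chartProj F G j i (chartCoord i l))) (by
    have h : chartProj F G j i (chartParam j 0 * evalInt (chartCoord i) F -
        chartParam j 1 * evalInt (chartCoord i) G) = 0 := chartProj_chartEquation j i
    rw [map_sub, map_mul, map_mul] at h
    simp only [Sum.elim_inl, Sum.elim_inr]
    have h1 : ∀ H, evalInt (fun l => chartProj F G j i (chartCoord i l)) H =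
        chartProj F G j i (evalInt (chartCoord i) H) := fun H =>
      (map_evalInt (chartProj F G j i).toRingHom _ H).symm
    rw [h1, h1, map_mul, map_mul]
    linear_combination chartProj F G j i (X (some i)) * h)

theorem toChart_gen (j l : Fin 2) (i m : Fin k) : toChart F G j i (gen ℚ F G l m) =
    chartProj F G j i (X (some i) * chartParam j l * chartCoord i m) := by
  rw [toChart, evalHom_gen, map_mul _ (_ * _)]
  rfl

theorem toChart_gen_self (j : Fin 2) (i : Fin k) : toChart F G j i (gen ℚ F G j i) =
    chartProj F G j i (X (some i)) := by
  rw [toChart_gen, chartParam, chartCoord, if_pos rfl, if_pos rfl, mul_one, mul_one]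

/-- The chart variables are ratios of generators with the chosen generator as denominator, except `X
(some i)`, which is that generator itself. So its powers clear all denominators. -/
theorem exists_toChart_eq (j : Fin 2) (i : Fin k) (b : MvPolynomial (Option (Fin k)) ℚ) :
    ∃ (N : ℕ) (a : subring ℚ F G),
      toChart F G j i a = chartProj F G j i (X (some i)) ^ N * chartProj F G j i b := by
  have hX : ∀ v, ∃ a : subring ℚ F G, toChart F G j i a =
      chartProj F G j i (X (some i)) * chartProj F G j i (X v) := by
    rintro (_ | l)
    · refine ⟨gen ℚ F G (1 - j) i, ?_⟩
      rw [toChart_gen, ← map_mul]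
      congr 1
      have : (1 - j : Fin 2) ≠ j := by fin_cases j <;> decide
      rw [chartParam, chartCoord, if_neg this, if_pos rfl, mul_one]
    · by_cases hl : l = i
      · subst hl
        exact ⟨gen ℚ F G j l * gen ℚ F G j l, by rw [map_mul, toChart_gen_self]⟩
      · refine ⟨gen ℚ F G j l, ?_⟩
        rw [toChart_gen, ← map_mul]
        congr 1
        rw [chartParam, chartCoord, if_neg hl, if_pos rfl, mul_one]
  induction b using MvPolynomial.induction_on with
  | C c =>
    refine ⟨0, algebraMap ℚ _ c, ?_⟩
    rw [AlgHom.commutes, pow_zero, one_mul]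
    exact ((chartProj F G j i).commutes c).symm
  | add p q hp hq =>
    obtain ⟨N, a, ha⟩ := hp
    obtain ⟨M, b, hb⟩ := hq
    refine ⟨N + M, a * gen ℚ F G j i ^ M + b * gen ℚ F G j i ^ N, ?_⟩
    rw [map_add, map_add, map_mul, map_mul, map_pow, map_pow, ha, hb, toChart_gen_self]
    ring
  | mul_X p v hp =>
    obtain ⟨N, a, ha⟩ := hp
    obtain ⟨b, hb⟩ := hX v
    refine ⟨N + 1, a * b, ?_⟩
    rw [map_mul, map_mul, ha, hb]
    ring

/-- The map from the coordinate ring of a chart to a localization in which the corresponding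
generator `g` has the inverse `v`. -/
theorem exists_fromChart (hF : F.IsHomogeneous d) (hG : G.IsHomogeneous d) (j : Fin 2) (i : Fin k)
    {L : Type*} [CommRing L] [Algebra ℚ L] (α : subring ℚ F G →ₐ[ℚ] L)
    (hα : IsUnit (α (gen ℚ F G j i))) :
    ∃ ψ : Chart F G j i →ₐ[ℚ] L, ψ.comp (toChart F G j i) = α := by
  obtain ⟨v, hv⟩ := hα.exists_right_inv
  let e : Option (Fin k) → L := fun o => o.elim (α (gen ℚ F G (1 - j) i) * v) fun l =>
    if l = i then α (gen ℚ F G j i) else α (gen ℚ F G j l) * v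
  let φ : MvPolynomial (Option (Fin k)) ℚ →ₐ[ℚ] L := aeval e
  have hpar : ∀ l, φ (chartParam j l) = v * α (gen ℚ F G l i) := by
    intro l
    unfold chartParam
    split_ifs with hl
    · subst hl
      rw [map_one, mul_comm, hv]
    · have : l = 1 - j := by
        have : ∀ a b : Fin 2, a ≠ b → a = 1 - b := by decide
        exact this l j hl
      rw [aeval_X, this]
      exact mul_comm _ _
  have hcoord : ∀ l, φ (chartCoord i l) = v * α (gen ℚ F G j l) := by
    intro l
    unfold chartCoord
    split_ifs with hl
    · subst hl
      rw [map_one, mul_comm, hv]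
    · rw [aeval_X]
      change (if l = i then _ else _) = _
      rw [if_neg hl, mul_comm]
  have hz : φ (X (some i)) = α (gen ℚ F G j i) := by
    rw [aeval_X]
    exact if_pos rfl
  have heq : φ (chartEquation F G j i) = 0 := by
    have h1 : ∀ H : MvPolynomial (Fin k) ℤ, H.IsHomogeneous d →
        φ (evalInt (chartCoord i) H) = v ^ d * α (evalInt (gen ℚ F G j) H) := by
      intro H hH
      rw [show α (evalInt (gen ℚ F G j) H) = evalInt (fun l => α (gen ℚ F G j l)) H from
        map_evalInt α.toRingHom _ H, ← evalInt_smul hH]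
      refine (map_evalInt φ.toRingHom _ H).trans ?_
      congr 1
      congr 1
      funext l
      exact hcoord l
    have h2 := congrArg α (gen_mul_evalInt ℚ hF hG j i)
    rw [map_mul, map_mul] at h2
    rw [chartEquation, map_sub, map_mul, map_mul, hpar, hpar, h1 F hF, h1 G hG]
    linear_combination v * v ^ d * h2
  have hker : ∀ b ∈ Ideal.span {chartEquation F G j i}, φ b = 0 := by
    intro b hb
    obtain ⟨c, rfl⟩ := Ideal.mem_span_singleton.1 hb
    rw [map_mul, heq, zero_mul]
  refine ⟨Ideal.Quotient.liftₐ _ φ hker, ?_⟩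
  have hψ : ∀ b, Ideal.Quotient.liftₐ _ φ hker (chartProj F G j i b) = φ b := fun b => rfl
  apply algHom_ext_gen F G
  intro l m
  rw [AlgHom.comp_apply, toChart_gen, hψ, map_mul, map_mul, hpar, hcoord, hz]
  have h3 := congrArg α (gen_mul_gen_comm ℚ F G j l i m)
  rw [map_mul, map_mul] at h3
  linear_combination v * α (gen ℚ F G j i) * v * h3 +
    (α (gen ℚ F G j i) * v + 1) * α (gen ℚ F G l m) * hv

/-- A prime other than the irrelevant ideal, which is maximal, misses some generator; the chart of
that generator computes the local ring. -/
theorem hasOnlyIsolatedSingularity (hF : F.IsHomogeneous d) (hG : G.IsHomogeneous d)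
    (hsing : ∀ i, ∃ N : ℕ, ∃ n : ℤ, n ≠ 0 ∧ C n * X i ^ N ∈ singularIdeal F G) :
    HasOnlyIsolatedSingularity (grading ℚ F G) := by
  intro P hP hne
  obtain ⟨j, i, hji⟩ : ∃ j i, gen ℚ F G j i ∉ P := by
    by_contra! hc
    refine hne ((irrelevantIdeal_isMaximal F G ℚ).eq_of_le hP.ne_top ?_).symm
    intro x hx
    have h1 := (mem_irrelevantIdeal_iff F G ℚ (φ := Ideal.Quotient.mkₐ ℚ P)
      (fun j i => Ideal.Quotient.eq_zero_iff_mem.2 (hc j i)) x).1 hx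
    exact Ideal.Quotient.eq_zero_iff_mem.1 h1
  let α : subring ℚ F G →ₐ[ℚ] Localization.AtPrime P := Algebra.algHom ℚ _ _
  have hα : IsUnit (α (gen ℚ F G j i)) :=
    IsLocalization.map_units (Localization.AtPrime P) (⟨_, hji⟩ : P.primeCompl)
  obtain ⟨ψ, hψ⟩ := exists_fromChart (L := Localization.AtPrime P) hF hG j i α hα
  have hψ' : ∀ a, ψ (toChart F G j i a) = α a := fun a => DFunLike.congr_fun hψ a
  refine isRegularLocalRing_of_chart P (chartEquation F G j i) (toChart F G j i).toRingHom
    ψ.toRingHom hψ' ?_ ?_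
  · intro x
    obtain ⟨b, rfl⟩ := Ideal.Quotient.mk_surjective x
    obtain ⟨N, a, ha⟩ := exists_toChart_eq (F := F) (G := G) j i b
    refine ⟨chartProj F G j i (X (some i)) ^ N, ?_, a, ha⟩
    rw [map_pow, ← toChart_gen_self]
    refine IsUnit.pow N ?_
    exact (hψ' _).symm ▸ hα
  · intro c hc
    have hprime := Ideal.IsPrime.comap (ψ.toRingHom.comp
      (Ideal.Quotient.mk (Ideal.span {chartEquation F G j i})))
      (K := IsLocalRing.maximalIdeal (Localization.AtPrime P))
    refine mul_chartEquation_notMem_sq hF hG j i (hsing i) _ ?_ ?_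
    · rw [Ideal.mem_comap, RingHom.comp_apply,
        Ideal.Quotient.eq_zero_iff_mem.2 (Ideal.mem_span_singleton_self _), map_zero]
      exact zero_mem _
    · rw [Ideal.mem_comap, IsLocalRing.mem_maximalIdeal, mem_nonunits_iff, not_not]
      exact hc

end Chart

/-! ### An eliminant for general pairs -/

section Elimination

variable {k : ℕ} {Λ : Type*} [CommRing Λ]

/-- The generators `F`, `G` and `∂F/∂Xₐ ∂G/∂X_b - ∂F/∂X_b ∂G/∂Xₐ` of the singular ideal. -/
def singularGen (F G : MvPolynomial (Fin k) Λ) :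
    Fin 2 ⊕ Fin k × Fin k → MvPolynomial (Fin k) Λ :=
  Sum.elim ![F, G] fun ab => pderiv ab.1 F * pderiv ab.2 G - pderiv ab.2 F * pderiv ab.1 G

/-- The degrees of the generators of the singular ideal of two forms of degree `d`. -/
def singularDeg (d : ℕ) : Fin 2 ⊕ Fin k × Fin k → ℕ :=
  Sum.elim (fun _ => d) fun _ => 2 * (d - 1)

/-- The linear combination of the generators of the singular ideal with coefficients `c`. -/
def singularComb (c : Fin 2 ⊕ Fin k × Fin k → MvPolynomial (Fin k) ℤ)
    (F G : MvPolynomial (Fin k) Λ) : MvPolynomial (Fin k) Λ :=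
  ∑ i, map (Int.castRingHom Λ) (c i) * singularGen F G i

theorem map_singularComb {Λ' : Type*} [CommRing Λ'] (f : Λ →+* Λ')
    (c : Fin 2 ⊕ Fin k × Fin k → MvPolynomial (Fin k) ℤ) (F G : MvPolynomial (Fin k) Λ) :
    map f (singularComb c F G) = singularComb c (map f F) (map f G) := by
  have h1 : f.comp (Int.castRingHom Λ) = Int.castRingHom Λ' := RingHom.ext_int _ _
  rw [singularComb, map_sum]
  refine Finset.sum_congr rfl fun i _ => ?_
  rw [map_mul, map_map, h1]
  congr 1
  rcases i with i | ⟨a, b⟩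
  · fin_cases i <;> rfl
  · simp [singularGen, pderiv_map]

theorem singularGen_isHomogeneous {d : ℕ} {F G : MvPolynomial (Fin k) Λ} (hF : F.IsHomogeneous d)
    (hG : G.IsHomogeneous d) (i : Fin 2 ⊕ Fin k × Fin k) :
    (singularGen F G i).IsHomogeneous (singularDeg d i) := by
  rcases i with i | ⟨a, b⟩
  · fin_cases i
    · exact hF
    · exact hG
  · change IsHomogeneous _ (2 * (d - 1))
    rw [two_mul]
    exact (hF.pderiv.mul hG.pderiv).sub (hF.pderiv.mul hG.pderiv)

theorem singularComb_isHomogeneous {d N : ℕ} {F G : MvPolynomial (Fin k) Λ}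
    (hF : F.IsHomogeneous d) (hG : G.IsHomogeneous d)
    {c : Fin 2 ⊕ Fin k × Fin k → MvPolynomial (Fin k) ℤ} {e : Fin 2 ⊕ Fin k × Fin k → ℕ}
    (hc : ∀ i, (c i).IsHomogeneous (e i)) (he : ∀ i, e i + singularDeg d i = N) :
    (singularComb c F G).IsHomogeneous N := by
  refine IsHomogeneous.sum _ _ _ fun i _ => ?_
  rw [← he i]
  exact ((hc i).map _).mul (singularGen_isHomogeneous hF hG i)

theorem singularComb_mem (c : Fin 2 ⊕ Fin k × Fin k → MvPolynomial (Fin k) ℤ)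
    (F G : MvPolynomial (Fin k) ℤ) : singularComb c F G ∈ singularIdeal F G := by
  refine sum_mem fun i _ => Ideal.mul_mem_left _ _ ?_
  rcases i with i | ⟨a, b⟩
  · fin_cases i
    · exact left_mem_singularIdeal F G
    · exact right_mem_singularIdeal F G
  · exact minor_mem_singularIdeal F G a b

/-- The exponents of the monomials of degree `N`. -/
abbrev Expo (k N : ℕ) : Type := ↥(Finset.finsuppAntidiag (Finset.univ : Finset (Fin k)) N)

theorem expo_sum {N : ℕ} (m : Expo k N) : ∑ i, m.1 i = N := by
  have h := (Finset.mem_finsuppAntidiag.1 m.2).1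
  exact h

theorem eq_sum_expo {N : ℕ} {H : MvPolynomial (Fin k) Λ} (hH : H.IsHomogeneous N) :
    H = ∑ m : Expo k N, C (H.coeff m.1) * monomial m.1 1 := by
  rw [Finset.sum_coe_sort (Finset.finsuppAntidiag (Finset.univ : Finset (Fin k)) N)
    (fun m => C (H.coeff m) * monomial m 1)]
  conv_lhs => rw [H.as_sum]
  simp only [C_mul_monomial, mul_one]
  refine Finset.sum_subset ?_ fun m _ hm => ?_
  · intro m hm
    have := hH (mem_support_iff.1 hm)
    rw [Finsupp.weight_apply, Finsupp.sum_fintype _ _ (by simp), Finset.sum_congr rfl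
      (fun i _ => by rw [Pi.one_apply, smul_eq_mul, mul_one])] at this
    exact Finset.mem_finsuppAntidiag.2 ⟨this, Finset.subset_univ _⟩
  · rw [notMem_support_iff.1 hm, monomial_zero]

/-- The form of degree `d` with coefficients the variables `e m`. -/
def genericForm (d : ℕ) (e : (Fin k →₀ ℕ) → (Fin k →₀ ℕ) ⊕ (Fin k →₀ ℕ)) :
    MvPolynomial (Fin k) (MvPolynomial ((Fin k →₀ ℕ) ⊕ (Fin k →₀ ℕ)) ℤ) :=
  ∑ m : Expo k d, C (X (e m.1)) * monomial m.1 1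

theorem map_genericForm {d : ℕ} {e : (Fin k →₀ ℕ) → (Fin k →₀ ℕ) ⊕ (Fin k →₀ ℕ)}
    {γ : (Fin k →₀ ℕ) ⊕ (Fin k →₀ ℕ) → ℤ} {H : MvPolynomial (Fin k) ℤ} (hH : H.IsHomogeneous d)
    (hγ : ∀ m, γ (e m) = H.coeff m) : map (eval γ) (genericForm d e) = H := by
  rw [genericForm, map_sum]
  conv_rhs => rw [eq_sum_expo hH]
  refine Finset.sum_congr rfl fun m _ => ?_
  rw [map_mul, map_C, eval_X, hγ, map_monomial, map_one]

/-- If for one pair of forms all monomials of degree `N` are, up to nonzero integers, combinations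
of the generators of the singular ideal, then the same holds for general pairs. -/
theorem exists_eliminant {d N : ℕ} {F₀ G₀ : MvPolynomial (Fin k) ℤ} (hF₀ : F₀.IsHomogeneous d)
    (hG₀ : G₀.IsHomogeneous d)
    (c : Expo k N → Fin 2 ⊕ Fin k × Fin k → MvPolynomial (Fin k) ℤ)
    (e : Fin 2 ⊕ Fin k × Fin k → ℕ) (hc : ∀ m i, (c m i).IsHomogeneous (e i))
    (he : ∀ i, e i + singularDeg d i = N) (n : Expo k N → ℤ) (hn : ∀ m, n m ≠ 0)
    (h : ∀ m, singularComb (c m) F₀ G₀ = C (n m) * monomial m.1 1) :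
    ∃ Φ : MvPolynomial ((Fin k →₀ ℕ) ⊕ (Fin k →₀ ℕ)) ℤ, eval (coefficients F₀ G₀) Φ ≠ 0 ∧
      ∀ F G : MvPolynomial (Fin k) ℤ, F.IsHomogeneous d → G.IsHomogeneous d → ∀ i,
        C (eval (coefficients F G) Φ) * X i ^ N ∈ singularIdeal F G := by
  let M : ∀ {Λ : Type} [CommRing Λ], MvPolynomial (Fin k) Λ → MvPolynomial (Fin k) Λ →
      Matrix (Expo k N) (Expo k N) Λ :=
    fun F G => Matrix.of fun m m' => (singularComb (c m) F G).coeff m'.1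
  -- The rows of M hold the coefficients of the combinations with the fixed multipliers c. For the
  -- generic pair the determinant is a polynomial in the coefficients of F and G; at F₀, G₀ the
  -- matrix is diagonal with entries n m.
  let Φ := (M (genericForm d Sum.inl) (genericForm d Sum.inr)).det
  have heval : ∀ F G : MvPolynomial (Fin k) ℤ, F.IsHomogeneous d → G.IsHomogeneous d →
      eval (coefficients F G) Φ = (M F G).det := by
    intro F G hF hG
    rw [RingHom.map_det]
    congr 1
    ext m m'
    change eval _ (coeff _ _) = coeff _ _
    rw [← coeff_map, map_singularComb, map_genericForm hF fun _ => rfl,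
      map_genericForm hG fun _ => rfl]
  refine ⟨Φ, ?_, fun F G hF hG i => ?_⟩
  · have hM : M F₀ G₀ = Matrix.diagonal n := by
      ext m m'
      change coeff _ _ = _
      rw [h, coeff_C_mul, coeff_monomial, Matrix.diagonal_apply]
      by_cases hm : m = m'
      · simp [hm]
      · rw [if_neg (fun h => hm (Subtype.ext h)), if_neg hm, mul_zero]
    rw [heval F₀ G₀ hF₀ hG₀, hM, Matrix.det_diagonal]
    exact Finset.prod_ne_zero_iff.2 fun m _ => hn m
  · rw [heval F G hF hG]
    let m₀ : Expo k N := ⟨Finsupp.single i N, Finset.mem_finsuppAntidiag.2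
      ⟨by simp [Finsupp.single_apply], Finset.subset_univ _⟩⟩
    -- Cramer's rule: the row m₀ of the adjugate combines the elements of the singular ideal to
    -- det·Xᵢᴺ.
    have h1 : ∑ m, C ((M F G).adjugate m₀ m) * singularComb (c m) F G =
        C (M F G).det * X i ^ N := by
      have h2 : ∀ m, singularComb (c m) F G = ∑ m', C (M F G m m') * monomial m'.1 1 :=
        fun m => eq_sum_expo (singularComb_isHomogeneous hF hG (hc m) he)
      have h3 := Matrix.adjugate_mul (M F G)
      calc ∑ m, C ((M F G).adjugate m₀ m) * singularComb (c m) F G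
          = ∑ m', C (((M F G).adjugate * M F G) m₀ m') * monomial m'.1 1 := by
            simp only [Matrix.mul_apply, map_sum, Finset.sum_mul, h2, Finset.mul_sum]
            rw [Finset.sum_comm]
            refine Finset.sum_congr rfl fun m' _ => Finset.sum_congr rfl fun m _ => ?_
            rw [C_mul, mul_assoc]
        _ = C (M F G).det * X i ^ N := by
            rw [h3, Finset.sum_eq_single m₀]
            · simp [m₀, X_pow_eq_monomial]
            · intro m _ hm
              simp [hm.symm]
            · simp
    rw [← h1]
    exact sum_mem fun m _ => Ideal.mul_mem_left _ _ (singularComb_mem _ _ _)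

end Elimination

/-! ### Diagonal pairs -/

section Diagonal

variable {k : ℕ}

/-- The diagonal form `∑ aᵢ Xᵢᵈ`. -/
def diagonalForm (d : ℕ) (a : Fin k → ℤ) : MvPolynomial (Fin k) ℤ := ∑ i, C (a i) * X i ^ d

theorem diagonalForm_isHomogeneous (d : ℕ) (a : Fin k → ℤ) :
    (diagonalForm d a).IsHomogeneous d := by
  refine IsHomogeneous.sum _ _ _ fun i _ => ?_
  simpa using (isHomogeneous_C (Fin k) (a i)).mul (isHomogeneous_X_pow (R := ℤ) i d)

theorem coeff_diagonalForm {d : ℕ} (hd : 1 ≤ d) (a : Fin k → ℤ) (i : Fin k) :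
    (diagonalForm d a).coeff (Finsupp.single i d) = a i := by
  classical
  rw [diagonalForm, coeff_sum, Finset.sum_eq_single i]
  · rw [coeff_C_mul, coeff_X_pow, if_pos rfl, mul_one]
  · intro j _ hj
    rw [coeff_C_mul, coeff_X_pow, if_neg, mul_zero]
    intro h
    exact hj ((Finsupp.single_left_inj (by omega)).1 h)
  · simp

theorem pderiv_diagonalForm (d : ℕ) (a : Fin k → ℤ) (i : Fin k) :
    pderiv i (diagonalForm d a) = C (d * a i) * X i ^ (d - 1) := by
  classical
  rw [diagonalForm, map_sum, Finset.sum_eq_single i]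
  · rw [pderiv_C_mul, pderiv_pow, pderiv_X_self, C_mul]
    simp
    ring
  · intro j _ hj
    rw [pderiv_C_mul, pderiv_pow, pderiv_X_of_ne hj, mul_zero, mul_zero]
  · simp

theorem degreeOf_eq_zero_of_dvd {F G : MvPolynomial (Fin k) ℤ} (hG : G ≠ 0) (h : F ∣ G) {i : Fin k}
    (hi : G.degreeOf i = 0) : F.degreeOf i = 0 := by
  obtain ⟨q, rfl⟩ := h
  rw [degreeOf_mul_eq (left_ne_zero_of_mul hG) (right_ne_zero_of_mul hG)] at hi
  omega

/-- A common divisor divides F − aᵢG, a nonzero form without Xᵢ, so it does not involve Xᵢ. Being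
constant and dividing the coefficient 1 of G, it is a unit. -/
theorem isRelPrime_diagonalForm {d : ℕ} (hk : 2 ≤ k) (hd : 1 ≤ d) {a : Fin k → ℤ}
    (ha : Function.Injective a) :
    IsRelPrime (diagonalForm d a) (diagonalForm d fun _ => 1) := by
  intro p hp hq
  have hdeg : ∀ i, p.degreeOf i = 0 := by
    intro i
    have h1 : diagonalForm d a - C (a i) * diagonalForm d (fun _ => 1) =
        diagonalForm d (fun j => a j - a i) := by
      simp only [diagonalForm, Finset.mul_sum, ← Finset.sum_sub_distrib]
      refine Finset.sum_congr rfl fun j _ => ?_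
      rw [C_sub, C_1]
      ring
    have h2 : p ∣ diagonalForm d (fun j => a j - a i) := by
      rw [← h1]
      exact dvd_sub hp (hq.mul_left _)
    refine degreeOf_eq_zero_of_dvd ?_ h2 ?_
    · obtain ⟨j, hj⟩ : ∃ j, j ≠ i := by
        have : Nontrivial (Fin k) := Fin.nontrivial_iff_two_le.2 hk
        exact exists_ne i
      intro h0
      have h3 := coeff_diagonalForm hd (fun j => a j - a i) j
      rw [h0, coeff_zero] at h3
      exact hj (ha (sub_eq_zero.1 h3.symm))
    · refine Nat.le_zero.1 ((degreeOf_sum_le _ _ _).trans (Finset.sup_le fun j _ => ?_))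
      by_cases hj : j = i
      · simp [hj]
      · refine (degreeOf_C_mul_le _ _ _).trans ?_
        rw [degreeOf_X_pow_of_ne _ (Ne.symm hj)]
  have hC : p = C (p.coeff 0) := by
    rw [← totalDegree_eq_zero_iff_eq_C]
    rw [totalDegree_eq_zero_iff]
    intro m hm i
    exact Nat.le_zero.1 ((hdeg i) ▸ monomial_le_degreeOf i hm)
  have h4 : p.coeff 0 ∣ 1 := by
    rw [hC, C_dvd_iff_dvd_coeff] at hq
    have h5 := hq (Finsupp.single ⟨0, by omega⟩ d)
    rwa [coeff_diagonalForm hd] at h5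
  rw [hC]
  exact (isUnit_of_dvd_one h4).map C

/-- The integers by which the minors of the Jacobian matrix of a diagonal pair are divided. -/
def minorCoeff (d : ℕ) (a : Fin k → ℤ) (i j : Fin k) : ℤ := d * d * (a i - a j)

/-- The minors are d²(aᵢ − aⱼ)Xᵢ^{d-1}Xⱼ^{d-1}. Subtracting multiples of them from Xᵢ^{d-1}·G leaves
Xᵢ^{2d-1}, up to a nonzero integer. In degree k(2d−1) every monomial is divisible by some Xᵢ^{2d-1}.
-/
theorem exists_singularComb_diagonalForm {d N : ℕ} (hd : 1 ≤ d) (hN : k * (2 * d - 1) = N)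
    (hk : 1 ≤ k) {a : Fin k → ℤ} (ha : Function.Injective a) (m : Expo k N) :
    ∃ c : Fin 2 ⊕ Fin k × Fin k → MvPolynomial (Fin k) ℤ, ∃ n : ℤ, n ≠ 0 ∧
      (∀ i, (c i).IsHomogeneous (N - singularDeg d i)) ∧
      singularComb c (diagonalForm d a) (diagonalForm d fun _ => 1) = C n * monomial m.1 1 := by
  classical
  have hN1 : 2 * d - 1 ≤ N := by
    rw [← hN]
    exact Nat.le_mul_of_pos_left _ hk
  obtain ⟨i, hi⟩ : ∃ i, 2 * d - 1 ≤ m.1 i := by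
    by_contra! hc
    have h1 : ∑ i, m.1 i < ∑ _i : Fin k, (2 * d - 1) :=
      Finset.sum_lt_sum_of_nonempty ⟨⟨0, hk⟩, Finset.mem_univ _⟩ fun i _ => hc i
    rw [expo_sum, Finset.sum_const, Finset.card_univ, Fintype.card_fin, smul_eq_mul, hN] at h1
    exact lt_irrefl _ h1
  set m' := m.1 - Finsupp.single i (2 * d - 1) with hm'
  have hm : Finsupp.single i (2 * d - 1) + m' = m.1 :=
    add_tsub_cancel_of_le (Finsupp.single_le_iff.2 hi)
  set μ : MvPolynomial (Fin k) ℤ := monomial m' 1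
  have hμ : X i ^ (2 * d - 1) * μ = monomial m.1 1 := by
    rw [X_pow_eq_monomial, monomial_mul, hm, one_mul]
  have hμd : μ.IsHomogeneous (N - (2 * d - 1)) := by
    apply isHomogeneous_monomial
    have h1 := congrArg Finsupp.degree hm
    rw [map_add, Finsupp.degree_single] at h1
    have h2 : m.1.degree = N := by
      rw [Finsupp.degree_eq_sum, expo_sum]
    omega
  let w := minorCoeff d a
  have hw : ∀ j, j ≠ i → w i j ≠ 0 := by
    intro j hj
    have : (d : ℤ) ≠ 0 := by exact_mod_cast (show d ≠ 0 by omega)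
    refine mul_ne_zero (mul_ne_zero this this) (sub_ne_zero.2 fun h => hj (ha h).symm)
  let n := ∏ j ∈ Finset.univ.erase i, w i j
  let n' := fun j => ∏ l ∈ (Finset.univ.erase i).erase j, w i l
  have hn' : ∀ j, j ≠ i → n' j * w i j = n := fun j hj =>
    Finset.prod_erase_mul _ _ (Finset.mem_erase.2 ⟨hj, Finset.mem_univ _⟩)
  -- The integer n is the product of all d²(aᵢ − aⱼ) with j ≠ i. The coefficient −n' q on the minor
  -- (i, q) omits the factor that this minor supplies, so that the terms Xᵢ^{d-1}X_qᵈ of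
  -- n·Xᵢ^{d-1}·G cancel.
  refine ⟨Sum.elim ![0, C n * (X i ^ (d - 1) * μ)] fun pq =>
    if pq.1 = i ∧ pq.2 ≠ i then C (-n' pq.2) * (X pq.2 * μ) else 0, n,
    Finset.prod_ne_zero_iff.2 fun j hj => hw j (Finset.ne_of_mem_erase hj), ?_, ?_⟩
  · rintro (l | ⟨p, q⟩)
    · fin_cases l
      · exact isHomogeneous_zero _ _ _
      · have h1 := (isHomogeneous_C (Fin k) n).mul ((isHomogeneous_X_pow (R := ℤ) i (d - 1)).mul hμd)
        have h2 : 0 + (d - 1 + (N - (2 * d - 1))) = N - d := by omega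
        rw [h2] at h1
        exact h1
    · change IsHomogeneous (if p = i ∧ q ≠ i then _ else _) (N - 2 * (d - 1))
      split_ifs with hpq
      · have h1 := (isHomogeneous_C (Fin k) (-n' q)).mul ((isHomogeneous_X ℤ q).mul hμd)
        have h2 : 0 + (1 + (N - (2 * d - 1))) = N - 2 * (d - 1) := by omega
        rw [h2] at h1
        exact h1
      · exact isHomogeneous_zero _ _ _
  · have hid : Int.castRingHom ℤ = RingHom.id ℤ := RingHom.ext_int _ _
    rw [singularComb, hid]
    simp only [map_id, Fintype.sum_sum_type, Fin.sum_univ_two, Sum.elim_inl, Sum.elim_inr,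
      singularGen, Matrix.cons_val_zero, Matrix.cons_val_one, zero_mul, zero_add,
      Fintype.sum_prod_type, pderiv_diagonalForm]
    rw [Finset.sum_eq_single i (fun p _ hp => Finset.sum_eq_zero fun q _ => by simp [hp])
      (by simp), ← Finset.add_sum_erase _ _ (Finset.mem_univ i)]
    have h1 : ∀ q ∈ Finset.univ.erase i,
        (if i = i ∧ q ≠ i then C (-n' q) * (X q * μ) else 0) *
        (C (d * a i) * X i ^ (d - 1) * (C ((d : ℤ) * 1) * X q ^ (d - 1)) -
          C (d * a q) * X q ^ (d - 1) * (C ((d : ℤ) * 1) * X i ^ (d - 1))) =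
        - (C n * (X i ^ (d - 1) * μ) * X q ^ d) := by
      intro q hq
      have hq' := Finset.ne_of_mem_erase hq
      rw [if_pos ⟨rfl, hq'⟩, ← hn' q hq', show X q ^ d = X q ^ (d - 1) * X q by
        rw [← pow_succ]; congr 1; omega]
      simp only [w, minorCoeff, C_mul, C_neg, C_sub, C_1]
      ring
    rw [Finset.sum_congr rfl h1, if_neg (fun h => h.2 rfl), zero_mul, zero_add, diagonalForm,
      ← Finset.add_sum_erase _ _ (Finset.mem_univ i), Finset.sum_neg_distrib,
      ← hμ, show 2 * d - 1 = d - 1 + d by omega, pow_add]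
    simp only [C_1, one_mul]
    rw [← Finset.mul_sum]
    ring

theorem exists_isolatedSingularity_polynomial {d : ℕ} (hd : 1 ≤ d) (hk : 1 ≤ k) {a : Fin k → ℤ}
    (ha : Function.Injective a) :
    ∃ Φ : MvPolynomial ((Fin k →₀ ℕ) ⊕ (Fin k →₀ ℕ)) ℤ,
      eval (coefficients (diagonalForm d a) (diagonalForm d fun _ => 1)) Φ ≠ 0 ∧
      ∀ F G : MvPolynomial (Fin k) ℤ, F.IsHomogeneous d → G.IsHomogeneous d →
        eval (coefficients F G) Φ ≠ 0 → HasOnlyIsolatedSingularity (grading ℚ F G) := by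
  choose c n hn hc h using exists_singularComb_diagonalForm hd (N := k * (2 * d - 1)) rfl hk ha
  obtain ⟨Φ, h1, h2⟩ := exists_eliminant (diagonalForm_isHomogeneous d a)
    (diagonalForm_isHomogeneous d fun _ => 1) c (fun i => k * (2 * d - 1) - singularDeg d i) hc
    (fun i => by
      have h3 : 2 * d - 1 ≤ k * (2 * d - 1) := Nat.le_mul_of_pos_left _ hk
      refine Nat.sub_add_cancel (le_trans ?_ h3)
      rcases i with i | i
      · change d ≤ _
        omega
      · change 2 * (d - 1) ≤ _
        omega) n hn h
  exact ⟨Φ, h1, fun F G hF hG h3 =>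
    hasOnlyIsolatedSingularity hF hG fun i => ⟨_, _, h3, h2 F G hF hG i⟩⟩

end Diagonal

/-! ### The pair X₁X₂X₃, X₁³ + X₂³ + X₃³ -/

section Example

/-- Modulo xyz, the elements h3 and h4 multiplied by x give 3x⁴y and 3x⁴z. Multiplying the sum of
cubes by 3x⁴ then leaves 3x⁷. -/
theorem three_mul_pow_mem {A : Type*} [CommRing A] {J : Ideal A} {x y z : A} (h1 : x * y * z ∈ J)
    (h2 : x ^ 3 + y ^ 3 + z ^ 3 ∈ J) (h3 : 3 * y * (x ^ 3 - z ^ 3) ∈ J)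
    (h4 : 3 * z * (x ^ 3 - y ^ 3) ∈ J) : 3 * x ^ 7 ∈ J := by
  have h5 : 3 * x ^ 4 * y ∈ J := by
    convert add_mem (J.mul_mem_left x h3) (J.mul_mem_left (3 * z ^ 2) h1) using 1
    ring
  have h6 : 3 * x ^ 4 * z ∈ J := by
    convert add_mem (J.mul_mem_left x h4) (J.mul_mem_left (3 * y ^ 2) h1) using 1
    ring
  convert sub_mem (sub_mem (J.mul_mem_left (3 * x ^ 4) h2) (J.mul_mem_left (y ^ 2) h5))
    (J.mul_mem_left (z ^ 2) h6) using 1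
  ring

theorem fermatCubic_left_isHomogeneous :
    (X 0 * X 1 * X 2 : MvPolynomial (Fin 3) ℤ).IsHomogeneous 3 :=
  ((isHomogeneous_X ℤ 0).mul (isHomogeneous_X ℤ 1)).mul (isHomogeneous_X ℤ 2)

theorem fermatCubic_right_isHomogeneous :
    (X 0 ^ 3 + X 1 ^ 3 + X 2 ^ 3 : MvPolynomial (Fin 3) ℤ).IsHomogeneous 3 :=
  ((isHomogeneous_X_pow 0 3).add (isHomogeneous_X_pow 1 3)).add (isHomogeneous_X_pow 2 3)

theorem three_mul_X_pow_mem_singularIdeal (i : Fin 3) :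
    C 3 * X i ^ 7 ∈ singularIdeal (X 0 * X 1 * X 2 : MvPolynomial (Fin 3) ℤ)
      (X 0 ^ 3 + X 1 ^ 3 + X 2 ^ 3) := by
  have hl := left_mem_singularIdeal (X 0 * X 1 * X 2 : MvPolynomial (Fin 3) ℤ)
    (X 0 ^ 3 + X 1 ^ 3 + X 2 ^ 3)
  have hr := right_mem_singularIdeal (X 0 * X 1 * X 2 : MvPolynomial (Fin 3) ℤ)
    (X 0 ^ 3 + X 1 ^ 3 + X 2 ^ 3)
  have hm := minor_mem_singularIdeal (X 0 * X 1 * X 2 : MvPolynomial (Fin 3) ℤ)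
    (X 0 ^ 3 + X 1 ^ 3 + X 2 ^ 3)
  have h01 := hm 0 1
  have h02 := hm 0 2
  have h12 := hm 1 2
  clear hm
  revert hl hr h01 h02 h12
  generalize singularIdeal (X 0 * X 1 * X 2 : MvPolynomial (Fin 3) ℤ)
    (X 0 ^ 3 + X 1 ^ 3 + X 2 ^ 3) = J
  intro hl hr h01 h02 h12
  simp only [map_add, pderiv_mul, pderiv_pow, pderiv_X_self,
    pderiv_X_of_ne (show (0 : Fin 3) ≠ 1 by decide), pderiv_X_of_ne (show (1 : Fin 3) ≠ 0 by decide),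
    pderiv_X_of_ne (show (0 : Fin 3) ≠ 2 by decide), pderiv_X_of_ne (show (2 : Fin 3) ≠ 0 by decide),
    pderiv_X_of_ne (show (1 : Fin 3) ≠ 2 by decide),
    pderiv_X_of_ne (show (2 : Fin 3) ≠ 1 by decide)] at h01 h02 h12
  norm_num at h01 h02 h12
  have hC : (C 3 : MvPolynomial (Fin 3) ℤ) = 3 := by simp
  rw [hC]
  fin_cases i
  · refine three_mul_pow_mem (x := X 0) (y := X 1) (z := X 2) hl hr ?_ ?_
    · convert neg_mem h02 using 1
      ring
    · convert neg_mem h01 using 1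
      ring
  · refine three_mul_pow_mem (x := X 1) (y := X 0) (z := X 2) ?_ ?_ ?_ ?_
    · convert hl using 1
      ring
    · convert hr using 1
      ring
    · convert neg_mem h12 using 1
      ring
    · convert h01 using 1
      ring
  · refine three_mul_pow_mem (x := X 2) (y := X 0) (z := X 1) ?_ ?_ ?_ ?_
    · convert hl using 1
      ring
    · convert hr using 1
      ring
    · convert h12 using 1
      ring
    · convert h02 using 1
      ring

theorem hasOnlyIsolatedSingularity_fermatCubic {F G : MvPolynomial (Fin 3) ℤ}
    (hF : F = X 0 * X 1 * X 2) (hG : G = X 0 ^ 3 + X 1 ^ 3 + X 2 ^ 3) :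
    HasOnlyIsolatedSingularity (grading ℚ F G) := by
  refine hasOnlyIsolatedSingularity (d := 3) (hF ▸ fermatCubic_left_isHomogeneous)
    (hG ▸ fermatCubic_right_isHomogeneous) fun i => ⟨7, 3, three_ne_zero, ?_⟩
  rw [hF, hG]
  exact three_mul_X_pow_mem_singularIdeal i

theorem isRelPrime_fermatCubic :
    IsRelPrime (X 0 * X 1 * X 2 : MvPolynomial (Fin 3) ℤ) (X 0 ^ 3 + X 1 ^ 3 + X 2 ^ 3) := by
  have h : ∀ i j : Fin 3, i ≠ j →
      IsRelPrime (X i : MvPolynomial (Fin 3) ℤ) (X 0 ^ 3 + X 1 ^ 3 + X 2 ^ 3) := by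
    intro i j hij
    refine (X_prime (R := ℤ) (i := i)).irreducible.isRelPrime_iff_not_dvd.2 fun hd => ?_
    -- At the j-th unit vector Xᵢ vanishes while the sum of cubes equals 1.
    have h1 := map_dvd (eval (Pi.single j 1 : Fin 3 → ℤ)) hd
    have h2 : (Pi.single j 1 : Fin 3 → ℤ) i = 0 := Pi.single_eq_of_ne hij _
    rw [eval_X, h2, zero_dvd_iff] at h1
    fin_cases j <;> simp at h1
  exact ((h 0 1 (by decide)).mul_left (h 1 0 (by decide))).mul_left (h 2 0 (by decide))

end Example

end FormPair

end

/-! ### Assembly of the results -/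

theorem mainTheorem6 :
    -- for all admissible pairs `F, G` of degree `d`, with `R = subring ℚ F G`
    (∀ (k : ℕ) (hk : 3 ≤ k) (d : ℕ), 1 ≤ d → ∀ F G : MvPolynomial (Fin k) ℤ,
      FormPair.IsAdmissible hk d F G →
        -- the dimension, the multiplicity and a homogeneous system of parameters of `R`
        ringKrullDim (FormPair.subring ℚ F G) = (k : WithBot ℕ∞) ∧
        HasHilbertMultiplicity (FormPair.grading ℚ F G) (d * (k - 1) + 1) ∧
        IsHomogeneousSOP (FormPair.grading ℚ F G) (FormPair.parameters ℚ F G) (fun _ => 1) ∧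
        -- the Cohen–Macaulay property
        (d ≤ k →
          quotientLength (FormPair.parameters ℚ F G) = ((d * (k - 1) + 1 : ℕ) : ℕ∞) ∧
          IsCohenMacaulay (FormPair.subring ℚ F G)) ∧
        -- the `a`-invariant
        (d = k → HasAInvariant (FormPair.grading ℚ F G) (-1)) ∧
        -- failure of `F`-regularity
        (k ≤ d →
          (∀ p : ℕ, p.Prime →
            FormPair.fiberGen F G p 1 (FormPair.last hk) ^ (d - 1) ∉ FormPair.fiberIdeal F G hk p ∧
            FormPair.fiberGen F G p 1 (FormPair.last hk) ^ (d - 1) ∈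
              tightClosure p (FormPair.fiberIdeal F G hk p) ∧
            ¬ IsFRegular p (FormPair.Fiber F G p)) ∧
          ¬ IsOfFRegularType ℚ (FormPair.subring ℚ F G))) ∧
    -- for suitably general admissible pairs of degree `k`, `R` has only isolated singularities
    (∀ (k : ℕ) (hk : 3 ≤ k),
      ∃ Φ : MvPolynomial ((Fin k →₀ ℕ) ⊕ (Fin k →₀ ℕ)) ℤ,
        (∃ F G : MvPolynomial (Fin k) ℤ, FormPair.IsAdmissible hk k F G ∧
          MvPolynomial.eval (FormPair.coefficients F G) Φ ≠ 0) ∧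
        ∀ F G : MvPolynomial (Fin k) ℤ, FormPair.IsAdmissible hk k F G →
          MvPolynomial.eval (FormPair.coefficients F G) Φ ≠ 0 →
            HasOnlyIsolatedSingularity (FormPair.grading ℚ F G)) ∧
    -- an explicit such pair for `k = 3`
    (∀ F G : MvPolynomial (Fin 3) ℤ,
      F = MvPolynomial.X 0 * MvPolynomial.X 1 * MvPolynomial.X 2 →
      G = MvPolynomial.X 0 ^ 3 + MvPolynomial.X 1 ^ 3 + MvPolynomial.X 2 ^ 3 →
        FormPair.IsAdmissible le_rfl 3 F G ∧
          HasOnlyIsolatedSingularity (FormPair.grading ℚ F G)) := by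
  have hlast : ∀ (r : ℕ) (hk : 3 ≤ r + 3), FormPair.last hk = Fin.last (r + 2) :=
    fun r hk => Fin.ext rfl
  refine ⟨?_, ?_, ?_⟩
  · intro k hk d hd F G h
    obtain ⟨r, rfl⟩ : ∃ r, k = r + 3 := ⟨k - 3, by omega⟩
    have hN : FormPair.IsNormalized (r := r + 2) d F G :=
      ⟨h.homogeneous_left, h.homogeneous_right, hlast r hk ▸ h.coeff_left,
        hlast r hk ▸ h.coeff_right, hd⟩
    exact ⟨FormPair.ringKrullDim_subring hN ℚ, FormPair.hasHilbertMultiplicity hN,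
      FormPair.isHomogeneousSOP_parameters hN ℚ,
      fun hdk => ⟨FormPair.quotientLength_parameters ℚ hN hdk,
        FormPair.isCohenMacaulay_subring ℚ hN hdk⟩,
      fun hdk => FormPair.hasAInvariant_grading ℚ hN hdk (by omega),
      fun hkd => ⟨fun p hp => FormPair.fiber_tightClosure hN (by omega) hkd hk hp,
        FormPair.not_isOfFRegularType hN (by omega) hkd⟩⟩
  · intro k hk
    -- The diagonal coefficients aᵢ are distinct and shifted so that the last one is 0, which
    -- removes X_kᵈ from F.
    have ha : Function.Injective fun i : Fin k => (i : ℤ) - (k - 1 : ℕ) := by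
      intro i j hij
      exact Fin.ext (by exact_mod_cast sub_left_injective hij)
    obtain ⟨Φ, h1, h2⟩ := FormPair.exists_isolatedSingularity_polynomial (d := k) (by omega)
      (by omega) ha
    refine ⟨Φ, ⟨_, _, ⟨FormPair.diagonalForm_isHomogeneous k _,
      FormPair.diagonalForm_isHomogeneous k _,
      FormPair.isRelPrime_diagonalForm (by omega) (by omega) ha,
      FormPair.coeff_diagonalForm (by omega) _ _, ?_⟩, h1⟩,
      fun F G h => h2 F G h.homogeneous_left h.homogeneous_right⟩
    rw [FormPair.coeff_diagonalForm (by omega)]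
    exact sub_self _
  · intro F G hF hG
    refine ⟨⟨?_, ?_, ?_, ?_, ?_⟩, FormPair.hasOnlyIsolatedSingularity_fermatCubic hF hG⟩
    · exact hF ▸ FormPair.fermatCubic_left_isHomogeneous
    · exact hG ▸ FormPair.fermatCubic_right_isHomogeneous
    · rw [hF, hG]
      exact FormPair.isRelPrime_fermatCubic
    · have h1 : G = FormPair.diagonalForm 3 fun _ => 1 := by
        rw [hG, FormPair.diagonalForm, Fin.sum_univ_three]
        simp
      rw [h1, FormPair.coeff_diagonalForm (by omega)]
    · have h1 : FormPair.last (le_refl 3) = 2 := rfl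
      rw [hF, h1, mul_assoc, MvPolynomial.coeff_X_mul', if_neg (by simp)]
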